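/- Let $(M,\Phi)$ be a $Spin(7)$-manifold: a smooth $8$-manifold with a $4$-form $\Phi$ for which every point has a neighbourhood carrying a smooth frame whose dual coframe $e_0,\dots,e_7$ satisfies (with $e_{ijkl}=e_i\wedge e_j\wedge e_k\wedge e_l$) $$\Phi=-e_{0127}+e_{0236}-e_{0347}-e_{0567}+e_{0146}+e_{0245}-e_{0135}-e_{3456}-e_{1457}-e_{1256}-e_{1234}-e_{2357}-e_{1367}+e_{2467}.$$ Let $g$ be the induced Riemannian metric, for which these frames are orthonormal, and let $M$ carry the orientation given by these frames. Let $\delta\Phi=-*d*\Phi$, and let $\theta$ be the Lee form, $\theta_a=\frac1{42}(\delta\Phi)_{ijk}\Phi_{ijka}$ (indices refer to an adapted orthonormal frame, repeated indices are summed). Let $\nabla$ be the $Spin(7)$-torsion connection, i.e. the linear connection with $\nabla g=0$, $\nabla\Phi=0$ and totally skew-symmetric torsion $T(X,Y,Z)=g(\nabla_XY-\nabla_YX-[X,Y],Z)$. Vectors and covectors are identified through $g$, so that $(\theta\lrcorner\beta)_{ij}=\theta_s\beta_{sij}$ for a $3$-form $\beta$. Put $$\Lambda^2_{21}=\{\phi\in\Lambda^2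 : *(\phi\wedge\Phi)=\phi\}=\{\phi\in\Lambda^2 : \phi_{ij}\Phi_{ijkl}=2\phi_{kl}\}\cong spin(7).$$ Suppose that the Ricci tensor $Ric(Y,Z)=\sum_i g(R(e_i,Y)Z,e_i)$ of $\nabla$, where $R(X,Y)=[\nabla_X,\nabla_Y]-\nabla_{[X,Y]}$, is symmetric. Then $\theta\lrcorner\delta\Phi=\theta\lrcorner T$, and the following three conditions are equivalent: (a) the covariant derivative of the Lee form with respect to $\nabla$ is symmetric, $(\nabla_X\theta)Y=(\nabla_Y\theta)X$ for all $X,Y$; (b) the $2$-form $\theta\lrcorner\delta\Phi=\theta\lrcorner T$ belongs to $\Lambda^2_{21}$ at every point; (c) the $2$-form $d\theta$ belongs to $\Lambda^2_{21}$ at every point. -/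

import Mathlib

open Bundle
open scoped Manifold ContDiff

noncomputable section

namespace Spin7

/-! ### Linear algebra in an eight-dimensional Euclidean space -/

/-- The elementary 4-form `e_i ∧ e_j ∧ e_k ∧ e_l` on `ℝ⁸`, evaluated on four vectors. -/
def elem (i j k l : Fin 8) (v : Fin 4 → Fin 8 → ℝ) : ℝ :=
  (Matrix.of fun a b => v a (![i, j, k, l] b)).det

/-- The fundamental 4-form on `ℝ⁸` with coordinates indexed by `0, …, 7`. -/
def stdForm (v : Fin 4 → Fin 8 → ℝ) : ℝ :=
  -elem 0 1 2 7 v + elem 0 2 3 6 v - elem 0 3 4 7 v - elem 0 5 6 7 v + elem 0 1 4 6 v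
    + elem 0 2 4 5 v - elem 0 1 3 5 v - elem 3 4 5 6 v - elem 1 4 5 7 v - elem 1 2 5 6 v
    - elem 1 2 3 4 v - elem 2 3 5 7 v - elem 1 3 6 7 v + elem 2 4 6 7 v

section Linear

variable {V : Type*} [NormedAddCommGroup V] [InnerProductSpace ℝ V]

/-- The volume form `e₀ ∧ … ∧ e₇` of an orthonormal basis. The number of arguments is written as
`n = 8`, so that it can be a sum of two degrees. -/
def volForm (b : OrthonormalBasis (Fin 8) ℝ V) {n : ℕ} (h : 8 = n) : V [⋀^Fin n]→L[ℝ] ℝ where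
  toMultilinearMap := (b.toBasis.det.domDomCongr (finCongr h)).toMultilinearMap
  map_eq_zero_of_eq' := (b.toBasis.det.domDomCongr (finCongr h)).map_eq_zero_of_eq'
  cont := by
    have hdet : ∀ v : Fin n → V, (b.toBasis.det.domDomCongr (finCongr h)) v =
        (Matrix.of fun i j => inner ℝ (b i) (v (finCongr h j))).det := by
      intro v
      rw [AlternatingMap.domDomCongr_apply, Module.Basis.det_apply]
      congr 1
      ext i j
      simp [Module.Basis.toMatrix_apply, OrthonormalBasis.repr_apply_apply]
    have hcont : Continuous fun v : Fin n → V =>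
        (Matrix.of fun i j => inner ℝ (b i) (v (finCongr h j))).det := by
      refine Continuous.matrix_det (continuous_matrix fun i j => ?_)
      exact continuous_const.inner (continuous_apply (finCongr h j))
    exact hcont.congr fun v => (hdet v).symm

/-- Interior multiplication of a form by `k` vectors, inserted in the first `k` slots. -/
def insertFirst {l : ℕ} : (k : ℕ) → (Fin k → V) → (V [⋀^Fin (l + k)]→L[ℝ] ℝ) →
    (V [⋀^Fin l]→L[ℝ] ℝ)
  | 0, _, α => α
  | k + 1, u, α => insertFirst k (Fin.tail u) (ContinuousAlternatingMap.curryLeft α (u 0))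

/-- The Hodge star on `k`-forms (`l + k = 8`) for the inner product and for the orientation given by
the orthonormal basis `b`:
`(*α)(v₁, …, v_l) = (1 / k!) ∑ α(e_{s₁}, …, e_{s_k}) vol(e_{s₁}, …, e_{s_k}, v₁, …, v_l)`. -/
def hodgeStar (b : OrthonormalBasis (Fin 8) ℝ V) {k l : ℕ} (h : 8 = l + k)
    (α : V [⋀^Fin k]→L[ℝ] ℝ) : V [⋀^Fin l]→L[ℝ] ℝ :=
  (1 / (k.factorial : ℝ)) • ∑ s : Fin k → Fin 8,
    α (fun a => b (s a)) •
      insertFirst k (fun a => b (s a)) (volForm b h)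

end Linear

/-! ### Differential forms and connections on an eight-manifold -/

/-- The model space of an eight-manifold. -/
abbrev E8 := EuclideanSpace ℝ (Fin 8)

section Manifold

variable {M : Type*} [TopologicalSpace M] [ChartedSpace E8 M]
  [IsManifold (𝓡 8) ∞ M]

variable (M) in
/-- Differential `k`-forms (sections of `Λᵏ T*M`, no regularity is imposed here). -/
abbrev Form (k : ℕ) := (x : M) → TangentSpace (𝓡 8) x [⋀^Fin k]→L[ℝ] ℝ

variable (M) in
/-- Vector fields (sections of `TM`, no regularity is imposed here). -/
abbrev VField := (x : M) → TangentSpace (𝓡 8) x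

/-- Differentiability of a vector field at a point. -/
def DiffAt (X : VField M) (x : M) : Prop :=
  MDifferentiableAt (𝓡 8) (𝓡 8).tangent (fun y => (⟨y, X y⟩ : TangentBundle (𝓡 8) M)) x

/-- Smoothness of a vector field on a set. -/
def SmoothOn (X : VField M) (U : Set M) : Prop :=
  ContMDiffOn (𝓡 8) (𝓡 8).tangent ∞ (fun y => (⟨y, X y⟩ : TangentBundle (𝓡 8) M)) U

/-- The form `α` read in the preferred chart at `x`. -/
def chartForm {k : ℕ} (α : Form M k) (x : M) (y : E8) : E8 [⋀^Fin k]→L[ℝ] ℝ :=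
  letI : ChartedSpace E8 E8 := chartedSpaceSelf E8
  (α ((extChartAt (𝓡 8) x).symm y)).compContinuousLinearMap
    (mfderiv 𝓘(ℝ, E8) (𝓡 8) (extChartAt (𝓡 8) x).symm y)

/-- The exterior derivative `dα`. -/
def extD {k : ℕ} (α : Form M k) : Form M (k + 1) := fun x =>
  letI : ChartedSpace E8 E8 := chartedSpaceSelf E8
  (extDeriv (chartForm α x) (extChartAt (𝓡 8) x x)).compContinuousLinearMap
    (mfderiv (𝓡 8) 𝓘(ℝ, E8) (extChartAt (𝓡 8) x) x)

variable (M) in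
/-- Linear connections on `TM`. The value `(∇_X Y)(x)` is written `D Y x (X x)`. -/
abbrev Connection := CovariantDerivative (𝓡 8) E8 (fun x : M => TangentSpace (𝓡 8) x)

/-- The covariant derivative of a `k`-form:
`(∇_v α)(Y₁, …, Y_k) = v (α(Y₁, …, Y_k)) - ∑ α(Y₁, …, ∇_v Y_a, …, Y_k)` at the point `x`. -/
def nablaForm (D : Connection M) {k : ℕ} (α : Form M k) (x : M) (v : TangentSpace (𝓡 8) x)
    (Y : Fin k → VField M) : ℝ :=
  mvfderiv (𝓡 8) (fun y => α y (fun a => Y a y)) x v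
    - ∑ a, α x (Function.update (fun c => Y c x) a (D (Y a) x v))

/-- The curvature `R(X, Y) Z = ∇_X ∇_Y Z - ∇_Y ∇_X Z - ∇_[X, Y] Z`. -/
def curv (D : Connection M) (X Y Z : VField M) : VField M := fun x =>
  D (fun y => D Z y (Y y)) x (X x) - D (fun y => D Z y (X y)) x (Y x)
    - D Z x (VectorField.mlieBracket (𝓡 8) X Y x)

variable [RiemannianBundle (fun x : M => TangentSpace (𝓡 8) x)]

instance (x : M) : FiniteDimensional ℝ (TangentSpace (𝓡 8) x) :=
  inferInstanceAs (FiniteDimensional ℝ E8)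

/-- The Ricci tensor `Ric(v, w) = ∑ g(R(e_i, v) w, e_i)` of a connection, for an orthonormal basis
`e_i` of the tangent space. The curvature is tensorial, it is evaluated on local extensions of the
tangent vectors. -/
def ricci (D : Connection M) (x : M) (v w : TangentSpace (𝓡 8) x) : ℝ :=
  let e := stdOrthonormalBasis ℝ (TangentSpace (𝓡 8) x)
  ∑ i, inner ℝ (curv D (FiberBundle.extend E8 (e i)) (FiberBundle.extend E8 v)
    (FiberBundle.extend E8 w) x) (e i)

/-! ### `Spin(7)`-structures -/

variable (M) in
/-- A `Spin(7)`-structure on a Riemannian eight-manifold: a 4-form `Φ` for which every point has a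
neighbourhood with a smooth orthonormal frame in which `Φ` is the standard form. The Riemannian
metric is the one induced by `Φ`: the adapted frames are orthonormal. -/
structure Structure where
  /-- The fundamental 4-form. -/
  Φ : Form M 4
  exists_frame : ∀ x : M, ∃ U : Set M, IsOpen U ∧ x ∈ U ∧ ∃ e : Fin 8 → VField M,
    (∀ i, SmoothOn (e i) U) ∧
    ∀ y ∈ U, Orthonormal ℝ (fun i => e i y) ∧
      ∀ v : Fin 4 → TangentSpace (𝓡 8) y, Φ y v = stdForm fun a i => inner ℝ (e i y) (v a)

namespace Structure

variable (S : Structure M)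

theorem exists_basis (x : M) : ∃ b : OrthonormalBasis (Fin 8) ℝ (TangentSpace (𝓡 8) x),
    ∀ v : Fin 4 → TangentSpace (𝓡 8) x, S.Φ x v = stdForm fun a i => inner ℝ (b i) (v a) := by
  obtain ⟨U, -, hxU, e, -, he⟩ := S.exists_frame x
  obtain ⟨h1, h2⟩ := he x hxU
  have hc : Fintype.card (Fin 8) = Module.finrank ℝ (TangentSpace (𝓡 8) x) := by
    have : Module.finrank ℝ (TangentSpace (𝓡 8) x) = Module.finrank ℝ E8 := rfl
    rw [this]; simp
  refine ⟨OrthonormalBasis.mk h1 ?_, ?_⟩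
  · exact (h1.linearIndependent.span_eq_top_of_card_eq_finrank' hc).ge
  · simpa using h2

/-- An adapted orthonormal basis `e₀, …, e₇` of the tangent space at `x`. -/
def basis (x : M) : OrthonormalBasis (Fin 8) ℝ (TangentSpace (𝓡 8) x) :=
  (S.exists_basis x).choose

/-- The Hodge star of the metric and of the orientation given by the adapted bases. -/
def star {k l : ℕ} (h : 8 = l + k) (α : Form M k) : Form M l := fun x =>
  hodgeStar (S.basis x) h (α x)

/-- `δΦ = - * d * Φ`. -/
def codiff : Form M 3 := -S.star (by norm_num) (extD (S.star (l := 4) (by norm_num) S.Φ))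

/-- The Lee form `θ_a = (1 / 42) (δΦ)_{ijk} Φ_{ijka}`. -/
def lee : Form M 1 := fun x =>
  (1 / 42 : ℝ) • ∑ s : Fin 3 → Fin 8,
    S.codiff x (fun a => S.basis x (s a)) • insertFirst 3 (fun a => S.basis x (s a)) (S.Φ x)

/-- The interior product `(θ ⌟ α)_{a…} = θ_s α_{s a…}` of a 1-form with a `(k + 1)`-form, the 1-form
being identified with a vector through the metric. -/
def contract {k : ℕ} (θ : Form M 1) (α : Form M (k + 1)) : Form M k := fun x =>
  ∑ s, θ x ![S.basis x s] • ContinuousAlternatingMap.curryLeft (α x) (S.basis x s)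

/-- The space `Λ²₂₁ ≅ spin(7)` of the 2-forms at `x` with `φ_{ij} Φ_{ijkl} = 2 φ_{kl}`. -/
def lambda21 (x : M) : Submodule ℝ (TangentSpace (𝓡 8) x [⋀^Fin 2]→L[ℝ] ℝ) where
  carrier := {φ | ∀ k l : Fin 8,
    ∑ i, ∑ j, φ ![S.basis x i, S.basis x j] *
      S.Φ x ![S.basis x i, S.basis x j, S.basis x k, S.basis x l] =
    2 * φ ![S.basis x k, S.basis x l]}
  add_mem' := by
    intro φ ψ hφ hψ k l
    simp only [ContinuousAlternatingMap.add_apply, add_mul, Finset.sum_add_distrib, mul_add]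
    rw [hφ k l, hψ k l]
  zero_mem' := by
    intro k l
    simp
  smul_mem' := by
    intro c φ hφ k l
    simp only [ContinuousAlternatingMap.smul_apply, smul_eq_mul, mul_assoc, ← Finset.mul_sum]
    rw [hφ k l]
    ring

variable [IsContMDiffRiemannianBundle (𝓡 8) ∞ E8 (fun x : M => TangentSpace (𝓡 8) x)]

instance : IsContMDiffRiemannianBundle (𝓡 8) 1 E8 (fun x : M => TangentSpace (𝓡 8) x) :=
  IsContMDiffRiemannianBundle.of_le (n := ∞) (by norm_cast)

/-- `D` is the torsion connection of the `Spin(7)`-structure and `T` is its torsion 3-form: `D` is a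
smooth linear connection with `∇g = 0` and `∇Φ = 0`, and its torsion `g(T(u, v), w)` is the 3-form
`T`, in particular it is totally skew-symmetric. -/
structure IsTorsionConnection (D : Connection M) (T : Form M 3) : Prop where
  smooth : CovariantDerivative.ContMDiffCovariantDerivative D ∞
  metric : D.IsMetricCompatible
  parallel : ∀ (x : M) (v : TangentSpace (𝓡 8) x) (Y : Fin 4 → VField M),
    (∀ a, DiffAt (Y a) x) → nablaForm D S.Φ x v Y = 0
  torsion : ∀ (x : M) (u v w : TangentSpace (𝓡 8) x), inner ℝ (D.torsion x u v) w = T x ![u, v, w]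

end Structure

end Manifold

end Spin7
end

noncomputable section

namespace Spin7

/-! Work in an adapted orthonormal frame near a point. Write c(φ)_{kl} = φ_{ij}Φ_{ijkl} for a 2-form
φ, t_s = T_{abc}Φ_{abcs} and β = θ ⌟ T. Because ∇Φ = 0, dΦ is algebraic in T, and self-duality of Φ
yields δΦ = T + (1/6) t ⌟ Φ (`codiff_apply`) and θ = -t/7 (`lee_frame`). So δΦ - T is a multiple of
θ ⌟ Φ, and a second contraction with θ kills it: this is θ ⌟ δΦ = θ ⌟ T.

Let A_{ij} = ∇_iθ_j - ∇_jθ_i. As ∇ has torsion T, dθ = A + β (`extD_lee`). The heart of the proof is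
the identity c(dθ) = 2β (`sum_extD_lee_mul_ph`, `sum_extD_lee`). Symmetry of Ric enters it twice:
the trace of the first Bianchi identity gives div T = 0 (`sum_nabla_eq_zero`), and, the curvature
being spin(7)-valued, R_{ibcj}Φ_{ibck} is symmetric in j, k (`sum_curvature_mul_ph`). Contracting
the Bianchi identity with Φ and taking the skew part in j, k then relates ∇T to a quadratic
expression in T, which `skew_sum_phPair_mul` evaluates through t ⌟ T.

The rest is linear algebra at each point. Condition (a) says A = 0. Condition (c) says 2β = c(A + β)
= 2(A + β), that is A = 0. Condition (b) says c(β) = 2β, that is c(A) = 0; on 2-forms c² = 12 - 4c,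
so c has only the eigenvalues 2 and -6, is injective (`eq_zero_of_sum_mul_ph`), and again A = 0.

The tensor identities for Φ are checked on increasing indices by evaluation over the integers, and
extended to all indices by alternation. -/

set_option linter.unusedSectionVars false

/-! ### The components of Φ and the contraction of Φ with itself over one index -/

/-- The sign of the difference `j - i`, as an integer. -/
def ordSign (i j : Fin 8) : ℤ := if i = j then 0 else if i < j then 1 else -1

/-- The coefficient of the standard form on the increasing quadruple whose elements are the
binary digits of `m`. -/
def maskCoeff (m : ℕ) : ℤ :=
  -- The binary digits of the two constants mark the quadruples with coefficient 1 and -1 (for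
  -- instance 0236 is the mask 77). `stdInt_eq_phi` confirms the table against `stdForm`.
  if Nat.testBit 6582018229284824168619876730229402019940765984827695514693664768 m then 1
  else if Nat.testBit 53919899762053845735502473346579693138969538244937640423060456603648 m then -1 else 0

/-- The components `Φ_{ijkl}` of the standard form. -/
def phi (i j k l : Fin 8) : ℤ :=
  -- A repeated index leaves at most three binary digits, so the lookup gives 0; the zero branch
  -- spares the six signs in later evaluations.
  match maskCoeff (2 ^ i.val + 2 ^ j.val + 2 ^ k.val + 2 ^ l.val) with
  | 0 => 0
  | c => c * (ordSign i j * ordSign i k * ordSign i l * ordSign j k * ordSign j l * ordSign k l)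

theorem phi_swap₁₂ : ∀ i j k l, phi j i k l = -phi i j k l := by decide +kernel

theorem phi_swap₂₃ : ∀ i j k l, phi i k j l = -phi i j k l := by decide +kernel

theorem phi_swap₃₄ : ∀ i j k l, phi i j l k = -phi i j k l := by decide +kernel

/-- The Kronecker symbol. -/
def kron (i j : Fin 8) : ℤ := if i = j then 1 else 0

/-- The expression of the contraction `∑ Φ_{abcs} Φ_{ijks}` through the metric and `Φ`. -/
def phiSq (a b c i j k : Fin 8) : ℤ :=
  kron a i * (kron b j * kron c k - kron b k * kron c j - phi b c j k)
  + kron a j * (kron b k * kron c i - kron b i * kron c k - phi b c k i)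
  + kron a k * (kron b i * kron c j - kron b j * kron c i - phi b c i j)
  - kron b i * phi c a j k - kron b j * phi c a k i - kron b k * phi c a i j
  - kron c i * phi a b j k - kron c j * phi a b k i - kron c k * phi a b i j

-- The only case of the contraction identity that is evaluated; both sides alternate in each triple,
-- so increasing triples suffice.
set_option maxRecDepth 100000 in
theorem sum_phi_mul_phi_of_lt : ∀ a b, a < b → ∀ c, b < c → ∀ i j, i < j → ∀ k, j < k →
    ∑ s, phi a b c s * phi i j k s - phiSq a b c i j k = 0 := by decide +kernel

/-- An alternating function of three indices that vanishes on increasing triples is zero. -/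
theorem eq_zero_of_skew {F : Fin 8 → Fin 8 → Fin 8 → ℤ} (h₁ : ∀ a b c, F b a c = -F a b c)
    (h₂ : ∀ a b c, F a c b = -F a b c) (h : ∀ a b, a < b → ∀ c, b < c → F a b c = 0)
    (a b c : Fin 8) : F a b c = 0 := by
  have e₁ : ∀ a c, F a a c = 0 := fun a c => by have := h₁ a a c; omega
  have e₂ : ∀ a c, F a c c = 0 := fun a c => by have := h₂ a c c; omega
  have main : ∀ a b c, a < b → F a b c = 0 := by
    intro a b c hab
    rcases lt_trichotomy b c with hbc | rfl | hbc
    · exact h a b hab c hbc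
    · exact e₂ a b
    · rw [← neg_eq_zero, ← h₂]
      rcases lt_trichotomy a c with hac | rfl | hac
      · exact h a c hac b hbc
      · exact e₁ a b
      · rw [← neg_eq_zero, ← h₁]
        exact h c a hac b hab
  rcases lt_trichotomy a b with hab | rfl | hab
  · exact main a b c hab
  · exact e₁ a c
  · rw [← neg_eq_zero, ← h₁]
    exact main b a c hab

theorem sum_phi_mul_phi (a b c i j k : Fin 8) :
    ∑ s, phi a b c s * phi i j k s = phiSq a b c i j k := by
  rw [← sub_eq_zero]
  refine eq_zero_of_skew (F := fun a b c => ∑ s, phi a b c s * phi i j k s - phiSq a b c i j k)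
    ?_ ?_ ?_ a b c
  · intro a b c
    simp only [phiSq, phi_swap₁₂ a b, neg_mul, Finset.sum_neg_distrib]
    rw [phi_swap₁₂ b c, phi_swap₁₂ b c, phi_swap₁₂ b c, phi_swap₁₂ c a, phi_swap₁₂ c a,
      phi_swap₁₂ c a]
    ring
  · intro a b c
    simp only [phiSq, phi_swap₂₃ a b c, neg_mul, Finset.sum_neg_distrib]
    rw [phi_swap₁₂ b c, phi_swap₁₂ b c, phi_swap₁₂ b c, phi_swap₁₂ a b, phi_swap₁₂ a b,
      phi_swap₁₂ a b, phi_swap₁₂ c a, phi_swap₁₂ c a, phi_swap₁₂ c a]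
    ring
  · intro a b hab c hbc
    refine eq_zero_of_skew
      (F := fun i j k => ∑ s, phi a b c s * phi i j k s - phiSq a b c i j k) ?_ ?_ ?_ i j k
    · intro i j k
      simp only [phiSq, phi_swap₁₂ i j, mul_neg, Finset.sum_neg_distrib]
      rw [phi_swap₃₄ _ _ j k, phi_swap₃₄ _ _ j k, phi_swap₃₄ _ _ j k, phi_swap₃₄ _ _ k i,
        phi_swap₃₄ _ _ k i, phi_swap₃₄ _ _ k i, phi_swap₃₄ _ _ i j, phi_swap₃₄ _ _ i j,
        phi_swap₃₄ _ _ i j]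
      ring
    · intro i j k
      simp only [phiSq, phi_swap₂₃ i j k, mul_neg, Finset.sum_neg_distrib]
      rw [phi_swap₃₄ _ _ j k, phi_swap₃₄ _ _ j k, phi_swap₃₄ _ _ j k, phi_swap₃₄ _ _ k i,
        phi_swap₃₄ _ _ k i, phi_swap₃₄ _ _ k i, phi_swap₃₄ _ _ i j, phi_swap₃₄ _ _ i j,
        phi_swap₃₄ _ _ i j]
      ring
    · exact sum_phi_mul_phi_of_lt a b hab c hbc

/-- The components of the standard form, as real numbers. -/
def ph (i j k l : Fin 8) : ℝ := (phi i j k l : ℝ)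

theorem ph_swap₁₂ (i j k l) : ph j i k l = -ph i j k l := by simp [ph, phi_swap₁₂ i j]

theorem ph_swap₂₃ (i j k l) : ph i k j l = -ph i j k l := by simp [ph, phi_swap₂₃ i j k]

theorem ph_swap₃₄ (i j k l) : ph i j l k = -ph i j k l := by simp [ph, phi_swap₃₄ i j k l]

theorem ph_rot₃ (i j k l) : ph i j k l = ph j k i l := by
  rw [ph_swap₁₂, ph_swap₂₃, neg_neg]

theorem ph_rot₃' (i j k l) : ph i j k l = ph i k l j := by
  rw [ph_swap₂₃, ph_swap₃₄, neg_neg]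

theorem ph_rot (i j k l) : ph i j k l = -ph j k l i := by
  rw [ph_rot₃, ph_swap₃₄]

theorem ph_pair (i j k l) : ph i j k l = ph k l i j := by
  rw [ph_rot, ph_rot, neg_neg]

/-! ### Contractions of 2-forms and 3-forms with Φ -/

theorem sum_kron_mul (i : Fin 8) (f : Fin 8 → ℝ) : ∑ a, (kron a i : ℝ) * f a = f i := by
  simp [kron]

theorem sum_rot {A : Type*} [AddCommMonoid A] (G : Fin 8 → Fin 8 → Fin 8 → A) :
    ∑ a, ∑ b, ∑ c, G a b c = ∑ a, ∑ b, ∑ c, G b c a := by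
  symm
  rw [Finset.sum_comm]
  exact Finset.sum_congr rfl fun b _ => Finset.sum_comm

theorem sum_sum_comm {A : Type*} [AddCommMonoid A] (G : Fin 8 → Fin 8 → Fin 8 → Fin 8 → A) :
    ∑ a, ∑ b, ∑ i, ∑ j, G a b i j = ∑ i, ∑ j, ∑ a, ∑ b, G a b i j := by
  rw [Finset.sum_congr rfl fun a _ => (sum_rot fun i j b => G a b i j).symm]
  exact (sum_rot fun i j a => ∑ b, G a b i j).symm

/-- Total skew-symmetry in three indices. -/
structure Skew (T : Fin 8 → Fin 8 → Fin 8 → ℝ) : Prop where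
  swap₁₂ : ∀ i j k, T j i k = -T i j k
  swap₂₃ : ∀ i j k, T i k j = -T i j k

theorem Skew.rot {T : Fin 8 → Fin 8 → Fin 8 → ℝ} (hT : Skew T) (i j k) : T i j k = T j k i := by
  rw [hT.swap₁₂, hT.swap₂₃, neg_neg]

theorem Skew.self₁₂ {T : Fin 8 → Fin 8 → Fin 8 → ℝ} (hT : Skew T) (i j) : T i i j = 0 := by
  linarith [hT.swap₁₂ i i j]

theorem Skew.self₂₃ {T : Fin 8 → Fin 8 → Fin 8 → ℝ} (hT : Skew T) (i j) : T i j j = 0 := by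
  linarith [hT.swap₂₃ i j j]

/-- The contraction `T_{abc} Φ_{abcs}`. -/
def phTrace (T : Fin 8 → Fin 8 → Fin 8 → ℝ) (s : Fin 8) : ℝ :=
  ∑ a, ∑ b, ∑ c, T a b c * ph a b c s

/-- The contraction `T_{abj} Φ_{abkl}`. -/
def phPair (T : Fin 8 → Fin 8 → Fin 8 → ℝ) (j k l : Fin 8) : ℝ :=
  ∑ a, ∑ b, T a b j * ph a b k l

/-- The six products of three deltas each return T_{ijk}. The nine mixed terms form three cyclic
classes, each contributing the same cyclic sum of `phPair`. -/
theorem sum_mul_phiSq {T : Fin 8 → Fin 8 → Fin 8 → ℝ} (hT : Skew T) (i j k : Fin 8) :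
    ∑ a, ∑ b, ∑ c, T a b c * (phiSq a b c i j k : ℝ) =
      6 * T i j k - 3 * (phPair T i j k + phPair T j k i + phPair T k i j) := by
  -- `P` is one cyclic class of the mixed terms of `phiSq`, and `d` is its purely metric part.
  set P : Fin 8 → Fin 8 → Fin 8 → ℝ := fun a b c => kron a i * ph b c j k + kron a j * ph b c k i
    + kron a k * ph b c i j with hP
  set d : Fin 8 → Fin 8 → Fin 8 → ℝ := fun a b c =>
    kron a i * (kron b j * kron c k - kron b k * kron c j)
    + kron a j * (kron b k * kron c i - kron b i * kron c k)
    + kron a k * (kron b i * kron c j - kron b j * kron c i) with hd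
  have e : ∀ a b c, T a b c * (phiSq a b c i j k : ℝ) = T a b c * d a b c
      - T a b c * P a b c - T b c a * P b c a - T c a b * P c a b := by
    intro a b c
    rw [← hT.rot a b c, hT.rot c a b]
    simp only [phiSq, hP, hd, ph]
    push_cast
    ring
  have r₁ := sum_rot fun a b c => T a b c * P a b c
  have r₂ := sum_rot fun a b c => T b c a * P b c a
  have h₁ : ∑ a, ∑ b, ∑ c, T a b c * P a b c = phPair T i j k + phPair T j k i + phPair T k i j := by
    have : ∀ a, ∑ b, ∑ c, T a b c * P a b c = kron a i * phPair T a j k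
        + kron a j * phPair T a k i + kron a k * phPair T a i j := by
      intro a
      simp only [hP, phPair, Finset.mul_sum, ← Finset.sum_add_distrib]
      refine Finset.sum_congr rfl fun b _ => Finset.sum_congr rfl fun c _ => ?_
      rw [hT.rot a b c]
      ring
    simp only [this, Finset.sum_add_distrib, sum_kron_mul]
  have h₂ : ∑ a, ∑ b, ∑ c, T a b c * d a b c = 6 * T i j k := by
    have : ∀ x y z : Fin 8, ∑ a, ∑ b, ∑ c, T a b c * (kron a x * (kron b y * kron c z)) =
        T x y z := by
      intro x y z
      simp [kron]
    simp only [hd, mul_add, mul_sub, Finset.sum_add_distrib, Finset.sum_sub_distrib, this]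
    have := hT.rot i j k
    have := hT.rot j k i
    have := hT.swap₂₃ i j k
    have := hT.swap₁₂ i j k
    have := hT.swap₁₂ j k i
    linarith
  simp only [e, Finset.sum_sub_distrib]
  linarith

/-- The contraction of `T_{abc} Φ_{abcs}` with `Φ`. -/
theorem sum_phTrace_mul {T : Fin 8 → Fin 8 → Fin 8 → ℝ} (hT : Skew T) (i j k : Fin 8) :
    ∑ s, phTrace T s * ph s i j k =
      3 * (phPair T i j k + phPair T j k i + phPair T k i j) - 6 * T i j k := by
  have h : ∑ s, phTrace T s * ph s i j k = -∑ a, ∑ b, ∑ c, T a b c * (phiSq a b c i j k : ℝ) := by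
    simp only [phTrace, Finset.sum_mul]
    rw [Finset.sum_comm, ← Finset.sum_neg_distrib]
    refine Finset.sum_congr rfl fun a _ => ?_
    rw [Finset.sum_comm, ← Finset.sum_neg_distrib]
    refine Finset.sum_congr rfl fun b _ => ?_
    rw [Finset.sum_comm, ← Finset.sum_neg_distrib]
    refine Finset.sum_congr rfl fun c _ => ?_
    rw [← sum_phi_mul_phi]
    push_cast
    rw [Finset.mul_sum, ← Finset.sum_neg_distrib]
    refine Finset.sum_congr rfl fun s _ => ?_
    rw [ph_rot s i j k]
    simp only [ph]
    ring
  rw [h, sum_mul_phiSq hT]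
  ring

/-- A trace of `sum_phi_mul_phi`. It encodes c² = 12 - 4c for the contraction c of 2-forms with Φ;
the 6 is 8 - 2, the dimension less two delta terms. -/
theorem sum_ph_mul_ph₁ (i j k l : Fin 8) :
    ∑ a, ∑ b, ph a b i j * ph a b k l =
      6 * (kron i k * kron j l - kron i l * kron j k) - 4 * ph i j k l := by
  have h : ∀ a, ∑ b, ph a b i j * ph a b k l = (phiSq i j a k l a : ℝ) := by
    intro a
    rw [← sum_phi_mul_phi]
    push_cast
    refine Finset.sum_congr rfl fun b _ => ?_
    change _ = ph i j a b * ph k l a b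
    rw [ph_pair a b, ph_pair a b k]
  have hk : ∀ x y : Fin 8, kron x y = kron y x := fun x y => by simp [kron, eq_comm]
  have h₀ : ∀ x y : Fin 8, ∀ z, ph x y z z = 0 ∧ ph z x z y = 0 ∧ ph z x y z = 0 ∧
      ph x z z y = 0 ∧ ph x z y z = 0 := by
    intro x y z
    have h₁ := ph_swap₃₄ x y z z
    have h₂ := ph_rot₃ z x z y
    have h₃ := ph_swap₁₂ z z x y
    have h₄ := ph_rot₃ z z x y
    have h₅ := ph_rot z x y z
    have h₆ := ph_rot₃ x z z y
    have h₇ := ph_swap₂₃ x z y z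
    have h₈ := ph_swap₂₃ x y z z
    refine ⟨?_, ?_, ?_, ?_, ?_⟩ <;> linarith
  have h₁ : ∀ a, (phiSq i j a k l a : ℝ) = kron a a * (kron i k * kron j l - kron i l * kron j k
      - ph i j k l) + kron a j * (kron i l * kron a k - kron i k * kron a l - ph a i k l)
      + kron a i * (kron j k * kron a l - kron j l * kron a k - ph j a k l)
      - kron a k * ph i j l a - kron a l * ph i j a k := by
    intro a
    obtain ⟨-, -, -, z₁, z₂⟩ := h₀ j k a
    obtain ⟨-, -, -, -, z₃⟩ := h₀ j l a
    obtain ⟨-, z₄, -, -, -⟩ := h₀ i k a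
    obtain ⟨-, -, z₅, -, -⟩ := h₀ i l a
    unfold ph at z₁ z₂ z₃ z₄ z₅ ⊢
    simp only [phiSq, hk i a, hk j a]
    push_cast
    rw [z₁, z₃, z₄, z₅]
    ring
  have s₀ : ∑ a : Fin 8, (kron a a : ℝ) = 8 := by simp [kron]
  simp only [h, h₁, Finset.sum_add_distrib, Finset.sum_sub_distrib, sum_kron_mul,
    ← Finset.sum_mul, s₀]
  rw [ph_swap₃₄ i j k l, ph_swap₁₂ i j]
  ring

/-- Contraction of a 2-form with `Φ` is injective. -/
theorem eq_zero_of_sum_mul_ph {A : Fin 8 → Fin 8 → ℝ} (hA : ∀ i j, A j i = -A i j)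
    (h : ∀ k l, ∑ i, ∑ j, A i j * ph i j k l = 0) (k l : Fin 8) : A k l = 0 := by
  have h₁ : ∑ a, ∑ b, (∑ i, ∑ j, A i j * ph i j a b) * ph a b k l =
      ∑ i, ∑ j, A i j * ∑ a, ∑ b, ph a b i j * ph a b k l := by
    simp only [Finset.sum_mul, Finset.mul_sum]
    rw [sum_sum_comm]
    refine Finset.sum_congr rfl fun i _ => Finset.sum_congr rfl fun j _ =>
      Finset.sum_congr rfl fun a _ => Finset.sum_congr rfl fun b _ => ?_
    rw [ph_pair i j a b]
    ring
  simp only [h, zero_mul, Finset.sum_const_zero, sum_ph_mul_ph₁] at h₁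
  have h₂ : ∀ i j, A i j * (6 * (kron i k * kron j l - kron i l * kron j k) - 4 * ph i j k l) =
      6 * (kron i k * (kron j l * A i j)) - 6 * (kron i l * (kron j k * A i j))
      - 4 * (A i j * ph i j k l) := fun i j => by ring
  simp only [h₂, Finset.sum_sub_distrib, ← Finset.mul_sum, h, sum_kron_mul] at h₁
  linarith [hA k l]

/-- The skew part of a quadratic expression in a 3-form `T`. -/
theorem skew_sum_phPair_mul {T : Fin 8 → Fin 8 → Fin 8 → ℝ} (hT : Skew T) (j k : Fin 8) :
    6 * (∑ s, ∑ c, phPair T s c k * T s c j - ∑ s, ∑ c, phPair T s c j * T s c k) =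
      ∑ i, ∑ l, (∑ r, phTrace T r * T r i l) * ph i l j k
        - 2 * ∑ r, phTrace T r * T r j k := by
  have h := fun i j k => sum_phTrace_mul hT i j k
  -- With t = `phTrace T`, `Y k j` is (t ⌟ Φ)_{sck} T_{scj}. Its skew part is found twice: in `key`
  -- by expanding t ⌟ Φ, and from `hQ` by expanding t ⌟ (t ⌟ Φ) = 0. Comparison gives the claim.
  set Y : Fin 8 → Fin 8 → ℝ := fun k j => ∑ s, ∑ c, (∑ r, phTrace T r * ph r s c k) * T s c j
    with hY
  have skewP : ∀ s c k, phPair T s k c = -phPair T s c k := fun s c k => by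
    simp only [phPair, ← Finset.sum_neg_distrib]
    exact Finset.sum_congr rfl fun a _ => Finset.sum_congr rfl fun b _ => by
      rw [ph_swap₃₄]; ring
  have key : ∀ j k, Y k j = 6 * ∑ s, ∑ c, phPair T s c k * T s c j
      + 3 * ∑ s, ∑ c, phPair T k s c * T s c j - 6 * ∑ s, ∑ c, T s c k * T s c j := by
    intro j k
    have h₁ : ∑ s, ∑ c, phPair T c k s * T s c j = ∑ s, ∑ c, phPair T s c k * T s c j := by
      rw [Finset.sum_comm]
      refine Finset.sum_congr rfl fun s _ => Finset.sum_congr rfl fun c _ => ?_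
      rw [skewP, hT.swap₁₂]
      ring
    have h₂ : ∀ s c, (∑ r, phTrace T r * ph r s c k) * T s c j =
        3 * (phPair T s c k * T s c j) + 3 * (phPair T c k s * T s c j)
        + 3 * (phPair T k s c * T s c j) - 6 * (T s c k * T s c j) := fun s c => by
      rw [h]
      ring
    simp only [hY, h₂, Finset.sum_add_distrib, Finset.sum_sub_distrib, ← Finset.mul_sum, h₁]
    ring
  -- This term and the next are symmetric in j and k, hence drop out of the difference of `e₁` and
  -- `e₂`.
  have sym₁ : ∑ s, ∑ c, phPair T k s c * T s c j = ∑ s, ∑ c, phPair T j s c * T s c k := by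
    simp only [phPair, Finset.sum_mul]
    rw [sum_sum_comm]
    refine Finset.sum_congr rfl fun i _ => Finset.sum_congr rfl fun l _ =>
      Finset.sum_congr rfl fun a _ => Finset.sum_congr rfl fun b _ => ?_
    rw [ph_pair]
    ring
  have sym₂ : ∑ s, ∑ c, T s c k * T s c j = ∑ s, ∑ c, T s c j * T s c k :=
    Finset.sum_congr rfl fun s _ => Finset.sum_congr rfl fun c _ => mul_comm _ _
  have e₁ := key j k
  have e₂ := key k j
  have hQ : ∑ r, phTrace T r * ∑ s, phTrace T s * ph s r j k = 0 := by
    simp only [Finset.mul_sum]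
    have : ∑ r, ∑ s, phTrace T r * (phTrace T s * ph s r j k) =
        -∑ r, ∑ s, phTrace T r * (phTrace T s * ph s r j k) := by
      conv_lhs => rw [Finset.sum_comm]
      simp only [← Finset.sum_neg_distrib]
      refine Finset.sum_congr rfl fun r _ => Finset.sum_congr rfl fun s _ => ?_
      rw [ph_swap₁₂]
      ring
    linarith
  have y₁ : ∀ j k, ∑ r, phTrace T r * phPair T k r j = Y j k := by
    intro j k
    simp only [phPair, hY, Finset.mul_sum, Finset.sum_mul]
    rw [← sum_rot]
    refine Finset.sum_congr rfl fun a _ => Finset.sum_congr rfl fun b _ =>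
      Finset.sum_congr rfl fun r _ => ?_
    rw [ph_rot₃ r a b j]
    ring
  have y₂ : ∑ r, phTrace T r * phPair T j k r = -Y k j := by
    rw [← y₁ k j, ← Finset.sum_neg_distrib]
    exact Finset.sum_congr rfl fun r _ => by rw [skewP]; ring
  have y₃ : ∑ r, phTrace T r * phPair T r j k =
      ∑ i, ∑ l, (∑ r, phTrace T r * T r i l) * ph i l j k := by
    simp only [phPair, Finset.mul_sum, Finset.sum_mul]
    rw [← sum_rot]
    refine Finset.sum_congr rfl fun a _ => Finset.sum_congr rfl fun b _ =>
      Finset.sum_congr rfl fun r _ => ?_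
    rw [hT.rot r a b]
    ring
  have h₃ : ∀ r, phTrace T r * ∑ s, phTrace T s * ph s r j k =
      3 * (phTrace T r * phPair T r j k) + 3 * (phTrace T r * phPair T j k r)
      + 3 * (phTrace T r * phPair T k r j) - 6 * (phTrace T r * T r j k) := fun r => by
    rw [h]
    ring
  simp only [h₃, Finset.sum_add_distrib, Finset.sum_sub_distrib, ← Finset.mul_sum, y₁, y₂, y₃]
    at hQ
  linarith

/-! ### The algebraic core: curvature, Bianchi identity and symmetric Ricci tensor -/

/-- The components of a curvature tensor with values in the stabilizer of the standard form:
`R i j k l = g(R(e_i, e_j) e_k, e_l)`. -/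
structure IsCurvature (R : Fin 8 → Fin 8 → Fin 8 → Fin 8 → ℝ) : Prop where
  swap₁₂ : ∀ i j k l, R j i k l = -R i j k l
  swap₃₄ : ∀ i j k l, R i j l k = -R i j k l
  phi : ∀ i b j l m k, ∑ s, (R i b j s * ph s l m k + R i b l s * ph j s m k
    + R i b m s * ph j l s k + R i b k s * ph j l m s) = 0

/-- The first Bianchi identity for the curvature `R` of a metric connection with torsion 3-form `T`
and with `N = ∇T`. -/
def Bianchi (R N : Fin 8 → Fin 8 → Fin 8 → Fin 8 → ℝ) (T : Fin 8 → Fin 8 → Fin 8 → ℝ) : Prop :=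
  ∀ i b c j, R i b c j + R b c i j + R c i b j = N i b c j + N b c i j + N c i b j
    + ∑ s, (T i b s * T s c j + T b c s * T s i j + T c i s * T s b j)

variable {R N : Fin 8 → Fin 8 → Fin 8 → Fin 8 → ℝ} {T : Fin 8 → Fin 8 → Fin 8 → ℝ}

/-- Trace the Bianchi identity over its first and last index. The curvature terms become the skew
part of Ric and the quadratic terms cancel in pairs, so the divergence of T is that skew part up to
sign. -/
theorem sum_nabla_eq_zero (hR : IsCurvature R) (hT : Skew T) (hN : ∀ i, Skew (N i))
    (hB : Bianchi R N T) (hRic : ∀ j k, ∑ i, R i j k i = ∑ i, R i k j i) (j k : Fin 8) :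
    ∑ i, N i i j k = 0 := by
  have h : ∀ i, R i j k i - R i k j i = N i i j k
      + ∑ s, (T i j s * T s k i + T k i s * T s j i) := by
    intro i
    have := hB i j k i
    have e₁ : R j k i i = 0 := by linarith [hR.swap₃₄ j k i i]
    have e₂ := hR.swap₁₂ i k j i
    have e₃ : N i j k i = N i i j k := by rw [(hN i).rot i j k]
    have e₄ := (hN j).self₂₃ k i
    have e₅ : N k i j i = 0 := by rw [← (hN k).rot]; exact (hN k).self₁₂ i j
    have e₆ : ∀ s, T s i i = 0 := fun s => hT.self₂₃ s i
    simp only [e₆, mul_zero, add_zero] at this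
    linarith
  have h' : ∑ i, ∑ s, (T i j s * T s k i + T k i s * T s j i) = 0 := by
    refine Finset.sum_eq_zero fun i _ => Finset.sum_eq_zero fun s _ => ?_
    rw [← hT.rot s k i, hT.rot i j s, hT.swap₁₂ s j i]
    ring
  have h₁ : ∑ i, (R i j k i - R i k j i) = 0 := by
    rw [Finset.sum_sub_distrib, hRic, sub_self]
  simp only [h, Finset.sum_add_distrib] at h₁
  simp only [Finset.sum_add_distrib] at h'
  linarith

/-- The curvature does not contribute to the skew part of the contraction with `Φ`. -/
theorem sum_curvature_mul_ph (hR : IsCurvature R)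
    (hRic : ∀ j k, ∑ i, R i j k i = ∑ i, R i k j i) (j k : Fin 8) :
    ∑ i, ∑ b, ∑ c, R i b c j * ph i b c k = ∑ i, ∑ b, ∑ c, R i b c k * ph i b c j := by
  -- The endomorphism R_{ib} annihilates Φ; this is applied to Φ_{jibk} and summed over i, b. The
  -- two outer terms are the two sides of the claim, and the two inner ones contract the symmetric
  -- Ricci tensor with Φ, hence vanish.
  have h : ∑ i, ∑ b, ∑ s, (R i b j s * ph s i b k + R i b i s * ph j s b k
    + R i b b s * ph j i s k + R i b k s * ph j i b s) = 0 :=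
    Finset.sum_eq_zero fun i _ => Finset.sum_eq_zero fun b _ => hR.phi i b j i b k
  have e₁ : ∀ i b s, R i b j s * ph s i b k = -(R i b s j * ph i b s k) := fun i b s => by
    rw [hR.swap₃₄ i b s j, ph_rot₃ s i b k]; ring
  have e₄ : ∀ i b s, R i b k s * ph j i b s = R i b s k * ph i b s j := fun i b s => by
    rw [hR.swap₃₄ i b s k, ph_rot j i b s]; ring
  have vanish : ∀ (S : Fin 8 → Fin 8 → ℝ) (P : Fin 8 → Fin 8 → ℝ), (∀ b s, S b s = S s b) →
      (∀ b s, P s b = -P b s) → ∑ b, ∑ s, S b s * P b s = 0 := by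
    intro S P hS hP
    have : ∑ b, ∑ s, S b s * P b s = -∑ b, ∑ s, S b s * P b s := by
      conv_lhs => rw [Finset.sum_comm]
      simp only [← Finset.sum_neg_distrib]
      refine Finset.sum_congr rfl fun b _ => Finset.sum_congr rfl fun s _ => ?_
      rw [hS s b, hP b s]
      ring
    linarith
  have e₂ : ∑ i, ∑ b, ∑ s, R i b i s * ph j s b k = 0 := by
    rw [← sum_rot fun b s i => R i b i s * ph j s b k]
    simp only [← Finset.sum_mul]
    refine vanish _ _ (fun b s => ?_) fun b s => by rw [ph_swap₂₃]
    have e : ∀ b s, ∑ i, R i b i s = -∑ i, R i b s i := fun b s => by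
      rw [← Finset.sum_neg_distrib]
      exact Finset.sum_congr rfl fun i _ => hR.swap₃₄ _ _ _ _
    rw [e, e, hRic]
  have e₃ : ∑ i, ∑ b, ∑ s, R i b b s * ph j i s k = 0 := by
    rw [Finset.sum_congr rfl fun i _ => Finset.sum_comm]
    simp only [← Finset.sum_mul]
    refine vanish _ _ (fun i s => ?_) fun i s => by rw [ph_swap₂₃]
    have e : ∀ i s, ∑ b, R i b b s = ∑ b, R b i s b := fun i s =>
      Finset.sum_congr rfl fun b _ => by rw [hR.swap₁₂, hR.swap₃₄, neg_neg]
    rw [e, e, hRic]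
  simp only [Finset.sum_add_distrib, e₁, e₂, e₃, e₄, Finset.sum_neg_distrib] at h
  linarith

/-- If the Ricci tensor is symmetric, then the exterior derivative of the Lee form
`θ = -1/7 T_{abc} Φ_{abcs}` satisfies `dθ_{is} Φ_{isjk} = 2 (θ ⌟ T)_{jk}`, where
`dθ_{is} = ∇_i θ_s - ∇_s θ_i + (θ ⌟ T)_{is}`. -/
theorem sum_extD_lee_mul_ph (hR : IsCurvature R) (hT : Skew T) (hN : ∀ i, Skew (N i))
    (hB : Bianchi R N T) (hRic : ∀ j k, ∑ i, R i j k i = ∑ i, R i k j i) (j k : Fin 8) :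
    ∑ i, ∑ s, (phTrace (N i) s - phTrace (N s) i + ∑ r, phTrace T r * T r i s) * ph i s j k =
      2 * ∑ r, phTrace T r * T r j k := by
  have hdiv := sum_nabla_eq_zero hR hT hN hB hRic
  set Z : Fin 8 → Fin 8 → ℝ := fun j k => ∑ i, ∑ b, ∑ c, N i b c j * ph i b c k with hZ
  -- The Bianchi identity times Φ_{ibck}: the three cyclic terms coincide after summation, so a
  -- common factor 3 divides out.
  have bian : ∀ j k, ∑ i, ∑ b, ∑ c, R i b c j * ph i b c k = Z j k
      + ∑ s, ∑ c, phPair T s c k * T s c j := by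
    intro j k
    have h : ∀ i b c, R i b c j * ph i b c k + R b c i j * ph b c i k + R c i b j * ph c i b k
        = N i b c j * ph i b c k + N b c i j * ph b c i k + N c i b j * ph c i b k
        + ((∑ s, T i b s * T s c j) * ph i b c k + (∑ s, T b c s * T s i j) * ph b c i k
        + (∑ s, T c i s * T s b j) * ph c i b k) := by
      intro i b c
      have := hB i b c j
      simp only [Finset.sum_add_distrib] at this
      rw [ph_rot₃ c i b, ← ph_rot₃ i b c]
      linear_combination ph i b c k * this
    have h' := Finset.sum_congr (rfl : Finset.univ = Finset.univ) fun i _ =>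
      Finset.sum_congr (rfl : Finset.univ = Finset.univ) fun b _ =>
      Finset.sum_congr (rfl : Finset.univ = Finset.univ) fun c _ => h i b c
    have rot₂ : ∀ G : Fin 8 → Fin 8 → Fin 8 → ℝ,
        ∑ i, ∑ b, ∑ c, G c i b = ∑ i, ∑ b, ∑ c, G i b c := fun G =>
      sum_rot fun i b c => G c i b
    simp only [Finset.sum_add_distrib] at h'
    rw [← sum_rot fun i b c => R i b c j * ph i b c k, rot₂ fun i b c => R i b c j * ph i b c k,
      ← sum_rot fun i b c => N i b c j * ph i b c k, rot₂ fun i b c => N i b c j * ph i b c k,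
      ← sum_rot fun i b c => (∑ s, T i b s * T s c j) * ph i b c k,
      rot₂ fun i b c => (∑ s, T i b s * T s c j) * ph i b c k] at h'
    have e : ∑ i, ∑ b, ∑ c, (∑ s, T i b s * T s c j) * ph i b c k =
        ∑ s, ∑ c, phPair T s c k * T s c j := by
      simp only [phPair, Finset.sum_mul]
      rw [sum_sum_comm, Finset.sum_comm]
      refine Finset.sum_congr rfl fun s _ => Finset.sum_congr rfl fun c _ =>
        Finset.sum_congr rfl fun i _ => Finset.sum_congr rfl fun b _ => ?_
      ring
    rw [e] at h'
    linarith
  have hsk := sum_curvature_mul_ph hR hRic j k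
  rw [bian, bian] at hsk
  have hq := skew_sum_phPair_mul hT j k
  -- `sum_phTrace_mul` applied to each N_i, then summed over i: two of the four resulting terms are
  -- divergences of T and vanish, leaving 3(Z_{jk} - Z_{kj}), doubled by skew-symmetrisation.
  have hA : ∑ i, ∑ s, (phTrace (N i) s - phTrace (N s) i) * ph i s j k =
      6 * (Z j k - Z k j) := by
    have h₁ : ∑ i, ∑ s, phTrace (N s) i * ph i s j k =
        -∑ i, ∑ s, phTrace (N i) s * ph i s j k := by
      rw [Finset.sum_comm]
      simp only [← Finset.sum_neg_distrib]
      refine Finset.sum_congr rfl fun b _ => Finset.sum_congr rfl fun s _ => ?_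
      rw [ph_swap₁₂]
      ring
    have h₂ : ∀ i, ∑ s, phTrace (N i) s * ph i s j k = 6 * N i i j k
        + 3 * (∑ b, ∑ c, N i b c j * ph i b c k) - 3 * ∑ b, ∑ c, N i b c k * ph i b c j
        - 3 * ∑ b, ∑ c, N i b c i * ph b c j k := by
      intro i
      have e₀ := sum_phTrace_mul (hN i) i j k
      have e₁ : ∑ s, phTrace (N i) s * ph i s j k = -∑ s, phTrace (N i) s * ph s i j k := by
        rw [← Finset.sum_neg_distrib]
        exact Finset.sum_congr rfl fun s _ => by rw [ph_swap₁₂]; ring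
      have e₂ : phPair (N i) j k i = -∑ b, ∑ c, N i b c j * ph i b c k := by
        simp only [phPair, ← Finset.sum_neg_distrib]
        exact Finset.sum_congr rfl fun b _ => Finset.sum_congr rfl fun c _ => by
          rw [ph_rot i b c k]; ring
      have e₃ : phPair (N i) k i j = ∑ b, ∑ c, N i b c k * ph i b c j := by
        simp only [phPair]
        exact Finset.sum_congr rfl fun b _ => Finset.sum_congr rfl fun c _ => by
          rw [ph_rot₃ i b c j]
      have e₄ : phPair (N i) i j k = ∑ b, ∑ c, N i b c i * ph b c j k := rfl
      linarith
    have h₃ : ∑ i, ∑ b, ∑ c, N i b c i * ph b c j k = 0 := by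
      rw [← sum_rot fun b c i => N i b c i * ph b c j k]
      refine Finset.sum_eq_zero fun b _ => Finset.sum_eq_zero fun c _ => ?_
      rw [← Finset.sum_mul, Finset.sum_congr rfl fun i _ => ((hN i).rot i b c).symm, hdiv,
        zero_mul]
    simp only [sub_mul, Finset.sum_sub_distrib, h₁, h₂, Finset.sum_add_distrib, ← Finset.mul_sum,
      hdiv, h₃]
    simp only [hZ]
    ring
  simp only [add_mul, Finset.sum_add_distrib] at hA ⊢
  rw [hA]
  linarith

/-! ### The Levi-Civita symbol and the self-duality of Φ -/

/-- The Levi-Civita symbol on eight indices. -/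
def eps (a b c d e f g h : Fin 8) : ℤ :=
  ordSign a b * ordSign a c * ordSign a d * ordSign a e * ordSign a f * ordSign a g * ordSign a h *
  (ordSign b c * ordSign b d * ordSign b e * ordSign b f * ordSign b g * ordSign b h) *
  (ordSign c d * ordSign c e * ordSign c f * ordSign c g * ordSign c h) *
  (ordSign d e * ordSign d f * ordSign d g * ordSign d h) *
  (ordSign e f * ordSign e g * ordSign e h) *
  (ordSign f g * ordSign f h) * ordSign g h

theorem ordSign_swap (i j : Fin 8) : ordSign i j = -ordSign j i := by
  unfold ordSign
  rcases lt_trichotomy i j with h | rfl | h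
  · simp [h, h.ne, h.ne', h.not_gt]
  · simp
  · simp [h, h.ne, h.ne', h.not_gt]

/-- A product over pairs i < j changes by the sign under a permutation, as a Vandermonde product
does; this form gives access to that fact. -/
theorem eps_eq_prod (s : Fin 8 → Fin 8) :
    eps (s 0) (s 1) (s 2) (s 3) (s 4) (s 5) (s 6) (s 7) =
      ∏ i, ∏ j ∈ Finset.Ioi i, ordSign (s i) (s j) := by
  have h : ∀ i : Fin 8, ∏ j ∈ Finset.Ioi i, ordSign (s i) (s j) =
      ∏ j, if i < j then ordSign (s i) (s j) else 1 := fun i => by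
    rw [← Finset.prod_filter]
    congr 1
    ext
    simp
  simp only [h, Fin.prod_univ_eight]
  simp only [eps, Fin.reduceLT, if_true, if_false, one_mul, mul_one, lt_self_iff_false]

theorem eps_perm (σ : Equiv.Perm (Fin 8)) :
    eps (σ 0) (σ 1) (σ 2) (σ 3) (σ 4) (σ 5) (σ 6) (σ 7) = σ.sign := by
  rw [eps_eq_prod, σ.prod_Ioi_comp_eq_sign_mul_prod ordSign_swap, ← eps_eq_prod (fun i => i)]
  simp [show eps 0 1 2 3 4 5 6 7 = 1 by decide +kernel]

theorem eps_eq_zero (s : Fin 8 → Fin 8) (hs : ¬ Function.Injective s) :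
    eps (s 0) (s 1) (s 2) (s 3) (s 4) (s 5) (s 6) (s 7) = 0 := by
  simp only [Function.Injective, not_forall] at hs
  obtain ⟨i, j, hij, hne⟩ := hs
  have key : ∀ i j, i < j → s i = s j → ∏ i, ∏ j ∈ Finset.Ioi i, ordSign (s i) (s j) = 0 := by
    intro i j hlt hij
    refine Finset.prod_eq_zero (Finset.mem_univ i) (Finset.prod_eq_zero (Finset.mem_Ioi.2 hlt) ?_)
    simp [ordSign, hij]
  rw [eps_eq_prod]
  rcases lt_or_gt_of_ne hne with h | h
  · exact key i j h hij
  · exact key j i h hij.symm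

/-- The sum of a symmetric function over triples, reduced to increasing triples. -/
theorem sum_eq_six_mul_sum_lt {F : Fin 8 → Fin 8 → Fin 8 → ℤ} (h₁ : ∀ a b c, F b a c = F a b c)
    (h₂ : ∀ a b c, F a c b = F a b c) (h₃ : ∀ a c, F a a c = 0) :
    ∑ a, ∑ b, ∑ c, F a b c =
      6 * ∑ a, ∑ b, if a < b then ∑ c, if b < c then F a b c else 0 else 0 := by
  set G : Fin 8 → Fin 8 → Fin 8 → ℤ := fun a b c => if a < b ∧ b < c then F a b c else 0 with hG
  have hsum : (∑ a, ∑ b, if a < b then ∑ c, if b < c then F a b c else 0 else 0) =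
      ∑ a, ∑ b, ∑ c, G a b c := by
    refine Finset.sum_congr rfl fun a _ => Finset.sum_congr rfl fun b _ => ?_
    by_cases h : a < b <;> simp [hG, h]
  have h₄ : ∀ a c, F a c c = 0 := fun a c => by
    rw [h₁, h₂, h₃]
  have h₅ : ∀ a c, F a c a = 0 := fun a c => by
    rw [h₂, h₃]
  -- For distinct indices exactly one of the six orderings is increasing; with a repetition both
  -- sides are zero.
  have e : ∀ a b c, F a b c = G a b c + G b c a + G c a b + G b a c + G a c b + G c b a := by
    intro a b c
    have e₁ := h₁ a b c
    have e₂ := h₂ a b c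
    have e₃ := h₁ b c a
    have e₄ := h₂ b a c
    have e₅ := h₁ a c b
    have z₁ := h₃ a c
    have z₂ := h₄ a c
    have z₃ := h₅ a b
    simp only [hG]
    rcases lt_trichotomy a b with hab | rfl | hab
    · rcases lt_trichotomy b c with hbc | rfl | hbc
      · have := hab.trans hbc
        simp [hab, hbc, this, hab.not_gt, hbc.not_gt, this.not_gt]
      · simp [hab, hab.not_gt, h₄]
      · rcases lt_trichotomy a c with hac | rfl | hac
        · simp [hab, hbc, hac, hab.not_gt, hbc.not_gt, hac.not_gt]; omega
        · simp [hab, hab.not_gt, h₅]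
        · simp [hab, hbc, hac, hab.not_gt, hbc.not_gt, hac.not_gt]; omega
    · simp [h₃, h₅]
    · rcases lt_trichotomy b c with hbc | rfl | hbc
      · rcases lt_trichotomy a c with hac | rfl | hac
        · simp [hab, hbc, hac, hab.not_gt, hbc.not_gt, hac.not_gt]; omega
        · simp [hab, hab.not_gt, h₅]
        · simp [hab, hbc, hac, hab.not_gt, hbc.not_gt, hac.not_gt]; omega
      · simp [hab, hab.not_gt, h₄]
      · have := hbc.trans hab
        simp [hab, hbc, this, hab.not_gt, hbc.not_gt, this.not_gt]; omega
  have rot : ∀ H : Fin 8 → Fin 8 → Fin 8 → ℤ, ∑ a, ∑ b, ∑ c, H b a c = ∑ a, ∑ b, ∑ c, H a b c :=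
    fun H => Finset.sum_comm
  have r₁ := sum_rot G
  have r₂ := sum_rot fun a b c => G b c a
  have r₃ := rot G
  have r₄ := sum_rot fun a b c => G b a c
  have r₅ := sum_rot fun a b c => G c b a
  rw [hsum]
  simp only [e, Finset.sum_add_distrib]
  linarith

/-- The contraction of the Levi-Civita symbol with `r ⌟ Φ`, for a self-dual `Φ`. -/
def epsPhi (r a b j k l : Fin 8) : ℤ :=
  kron r a * phi b j k l - kron r b * phi a j k l + kron r j * phi a b k l
    - kron r k * phi a b j l + kron r l * phi a b j k

-- For increasing free indices, and summed over increasing c, d, e, this is the self-duality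
-- relation between the star of e_r ⌟ Φ and e_r ∧ Φ; its few remaining cases are evaluated.
set_option maxRecDepth 100000 in
theorem sum_phi_mul_eps_of_lt : ∀ a b, a < b → ∀ j, b < j → ∀ k, j < k → ∀ l, k < l → ∀ r,
    (∑ c, ∑ d, if c < d then ∑ e, if d < e then
      (match phi r c d e with
        | 0 => 0
        | x => x * eps a b c d e j k l) else 0 else 0) + epsPhi r a b j k l = 0 := by
  decide +kernel

/-- Adjacent transpositions generate the symmetric group, already as a monoid, so induction on words
suffices. -/
theorem map_comp_perm_of_skew {n : ℕ} {F : (Fin (n + 1) → Fin 8) → ℤ}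
    (h : ∀ (i : Fin n) s, F (s ∘ Equiv.swap i.castSucc i.succ) = -F s)
    (σ : Equiv.Perm (Fin (n + 1))) (s : Fin (n + 1) → Fin 8) : F (s ∘ σ) = σ.sign * F s := by
  have hσ : σ ∈ Submonoid.closure (Set.range fun i : Fin n => Equiv.swap i.castSucc i.succ) := by
    rw [Equiv.Perm.mclosure_swap_castSucc_succ]
    trivial
  induction hσ using Submonoid.closure_induction generalizing s with
  | mem σ hσ =>
    obtain ⟨i, rfl⟩ := hσ
    rw [h, Equiv.Perm.sign_swap (Fin.castSucc_lt_succ).ne]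
    simp
  | one => simp
  | mul σ τ _ _ h₁ h₂ =>
    have := h₂ (s ∘ σ)
    rw [Function.comp_assoc] at this
    rw [Equiv.Perm.coe_mul, this, h₁, Equiv.Perm.sign_mul]
    push_cast
    ring

/-- Sorting makes an injective tuple strictly increasing at the cost of a sign; a repeated index is
fixed by a transposition, so the value equals its own negative. -/
theorem eq_zero_of_skew_of_strictMono {n : ℕ} {F : (Fin (n + 1) → Fin 8) → ℤ}
    (h : ∀ (i : Fin n) s, F (s ∘ Equiv.swap i.castSucc i.succ) = -F s)
    (h₀ : ∀ s, StrictMono s → F s = 0) (s : Fin (n + 1) → Fin 8) : F s = 0 := by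
  have hs := map_comp_perm_of_skew h
  by_cases hinj : Function.Injective s
  · have hm : StrictMono (s ∘ Tuple.sort s) :=
      (Tuple.monotone_sort s).strictMono_of_injective (hinj.comp (Tuple.sort s).injective)
    have := hs (Tuple.sort s) s
    rw [h₀ _ hm] at this
    rcases Int.units_eq_one_or (Tuple.sort s).sign with h' | h' <;> rw [h'] at this <;>
      simpa using this.symm
  · simp only [Function.Injective, not_forall] at hinj
    obtain ⟨i, j, hij, hne⟩ := hinj
    have h₁ : s ∘ Equiv.swap i j = s := by
      funext k
      simp only [Function.comp_apply, Equiv.swap_apply_def]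
      split_ifs with h₁ h₂ <;> simp_all
    have := hs (Equiv.swap i j) s
    rw [h₁, Equiv.Perm.sign_swap hne] at this
    push_cast at this
    omega

theorem eps_swap_01 (a b c d e f g h : Fin 8) :
    eps b a c d e f g h = -eps a b c d e f g h := by
  simp only [eps]
  rw [ordSign_swap b a]
  ring

theorem eps_swap_12 (a b c d e f g h : Fin 8) :
    eps a c b d e f g h = -eps a b c d e f g h := by
  simp only [eps]
  rw [ordSign_swap c b]
  ring

theorem eps_swap_23 (a b c d e f g h : Fin 8) :
    eps a b d c e f g h = -eps a b c d e f g h := by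
  simp only [eps]
  rw [ordSign_swap d c]
  ring

theorem eps_swap_34 (a b c d e f g h : Fin 8) :
    eps a b c e d f g h = -eps a b c d e f g h := by
  simp only [eps]
  rw [ordSign_swap e d]
  ring

theorem eps_swap_15 (a b c d e f g h : Fin 8) :
    eps a f c d e b g h = -eps a b c d e f g h := by
  simp only [eps]
  rw [ordSign_swap f c, ordSign_swap f d, ordSign_swap f e, ordSign_swap f b, ordSign_swap c b, ordSign_swap d b, ordSign_swap e b]
  ring

theorem eps_swap_56 (a b c d e f g h : Fin 8) :
    eps a b c d e g f h = -eps a b c d e f g h := by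
  simp only [eps]
  rw [ordSign_swap g f]
  ring

theorem eps_swap_67 (a b c d e f g h : Fin 8) :
    eps a b c d e f h g = -eps a b c d e f g h := by
  simp only [eps]
  rw [ordSign_swap h g]
  ring

/-- The factor 6 is 3!, from ordering c, d, e. In the remaining five indices both sides alternate,
which reduces them to increasing ones. -/
theorem sum_phi_mul_eps (r a b j k l : Fin 8) :
    ∑ c, ∑ d, ∑ e, phi r c d e * eps a b c d e j k l = -6 * epsPhi r a b j k l := by
  have hlt : ∀ a b, a < b → ∀ j, b < j → ∀ k, j < k → ∀ l, k < l →
      ∑ c, ∑ d, ∑ e, phi r c d e * eps a b c d e j k l = -6 * epsPhi r a b j k l := by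
    intro a b hab j hbj k hjk l hkl
    have h := sum_phi_mul_eps_of_lt a b hab j hbj k hjk l hkl r
    rw [sum_eq_six_mul_sum_lt]
    · have e : ∀ c d e, (match phi r c d e with
        | 0 => 0
        | x => x * eps a b c d e j k l) = phi r c d e * eps a b c d e j k l := by
        intro c d e
        split <;> simp [*]
      simp only [e] at h
      linarith
    · intro c d e
      rw [phi_swap₂₃, eps_swap_23]
      ring
    · intro c d e
      rw [phi_swap₃₄, eps_swap_34]
      ring
    · intro c e
      have := phi_swap₂₃ r c c e
      have h₀ : phi r c c e = 0 := by omega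
      rw [h₀, zero_mul]
  -- The free indices occupy slots 0, 1, 5, 6, 7 of `eps`, so the second and third of them are
  -- exchanged by `eps_swap_15`.
  set F : (Fin 5 → Fin 8) → ℤ := fun s =>
    ∑ c, ∑ d, ∑ e, phi r c d e * eps (s 0) (s 1) c d e (s 2) (s 3) (s 4)
      + 6 * epsPhi r (s 0) (s 1) (s 2) (s 3) (s 4) with hF
  have h₀ : F ![a, b, j, k, l] = 0 := by
    refine eq_zero_of_skew_of_strictMono (fun i s => ?_) (fun s hs => ?_) _
    · fin_cases i
      · simp only [hF, Function.comp_apply]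
        change ∑ c, ∑ d, ∑ e, phi r c d e * eps (s 1) (s 0) c d e (s 2) (s 3) (s 4)
          + 6 * epsPhi r (s 1) (s 0) (s 2) (s 3) (s 4) = _
        simp only [eps_swap_01 (s 0) (s 1), mul_neg, Finset.sum_neg_distrib, epsPhi,
          phi_swap₁₂ (s 0) (s 1)]
        ring
      · simp only [hF, Function.comp_apply]
        change ∑ c, ∑ d, ∑ e, phi r c d e * eps (s 0) (s 2) c d e (s 1) (s 3) (s 4)
          + 6 * epsPhi r (s 0) (s 2) (s 1) (s 3) (s 4) = _
        simp only [eps_swap_15 _ (s 1) _ _ _ (s 2), mul_neg, Finset.sum_neg_distrib, epsPhi,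
          phi_swap₁₂ (s 1) (s 2), phi_swap₂₃ _ (s 1) (s 2)]
        ring
      · simp only [hF, Function.comp_apply]
        change ∑ c, ∑ d, ∑ e, phi r c d e * eps (s 0) (s 1) c d e (s 3) (s 2) (s 4)
          + 6 * epsPhi r (s 0) (s 1) (s 3) (s 2) (s 4) = _
        simp only [eps_swap_56 _ _ _ _ _ (s 2) (s 3), mul_neg, Finset.sum_neg_distrib, epsPhi,
          phi_swap₂₃ _ (s 2) (s 3), phi_swap₃₄ _ _ (s 2) (s 3)]
        ring
      · simp only [hF, Function.comp_apply]
        change ∑ c, ∑ d, ∑ e, phi r c d e * eps (s 0) (s 1) c d e (s 2) (s 4) (s 3)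
          + 6 * epsPhi r (s 0) (s 1) (s 2) (s 4) (s 3) = _
        simp only [eps_swap_67 _ _ _ _ _ _ (s 3) (s 4), mul_neg, Finset.sum_neg_distrib, epsPhi,
          phi_swap₃₄ _ _ (s 3) (s 4)]
        ring
    · have h₁ := hlt (s 0) (s 1) (hs (by decide)) (s 2) (hs (by decide)) (s 3) (hs (by decide))
        (s 4) (hs (by decide))
      simp only [hF]
      linarith
  have : ∑ c, ∑ d, ∑ e, phi r c d e * eps a b c d e j k l + 6 * epsPhi r a b j k l = 0 := h₀
  linarith

theorem sum_ph_mul_eps (r a b j k l : Fin 8) :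
    ∑ c, ∑ d, ∑ e, ph r c d e * (eps a b c d e j k l : ℝ) = -6 * (epsPhi r a b j k l : ℝ) := by
  have := sum_phi_mul_eps r a b j k l
  simp only [ph]
  exact_mod_cast this

/-! ### The volume form on basis vectors, and the standard form in components -/

section

variable {V : Type*} [NormedAddCommGroup V] [InnerProductSpace ℝ V]

/-- Both sides are the sign of the permutation when the indices are distinct, and vanish otherwise.
-/
theorem det_comp_eq_eps (b : OrthonormalBasis (Fin 8) ℝ V) (s : Fin 8 → Fin 8) :
    b.toBasis.det (fun i => b (s i)) =
      (eps (s 0) (s 1) (s 2) (s 3) (s 4) (s 5) (s 6) (s 7) : ℝ) := by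
  by_cases hs : Function.Injective s
  · have h := eps_perm (Equiv.ofBijective s (Finite.injective_iff_bijective.1 hs))
    simp only [Equiv.ofBijective_apply] at h
    rw [h]
    have h₂ := b.toBasis.det.map_perm b (Equiv.ofBijective s (Finite.injective_iff_bijective.1 hs))
    have h₃ : b.toBasis.det b = 1 := by
      simpa using b.toBasis.det_self
    rw [h₃] at h₂
    refine Eq.trans ?_ (h₂.trans ?_)
    · rfl
    · rcases Int.units_eq_one_or (Equiv.Perm.sign
        (Equiv.ofBijective s (Finite.injective_iff_bijective.1 hs))) with h' | h' <;> simp [h']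
  · rw [eps_eq_zero s hs]
    simp only [Function.Injective, not_forall] at hs
    obtain ⟨i, j, hij, hne⟩ := hs
    rw [Int.cast_zero]
    exact b.toBasis.det.map_eq_zero_of_eq _ (by rw [hij]) hne

theorem volForm_apply (b : OrthonormalBasis (Fin 8) ℝ V) {n : ℕ} (h : 8 = n) (v : Fin n → V) :
    volForm b h v = b.toBasis.det fun i => v (finCongr h i) := by
  have := AlternatingMap.domDomCongr_apply (finCongr h) b.toBasis.det v
  exact this

theorem insertFirst_volForm_five (b : OrthonormalBasis (Fin 8) ℝ V) (h : 8 = 3 + 5)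
    (s : Fin 5 → Fin 8) (j k l : Fin 8) :
    insertFirst 5 (fun a => b (s a)) (volForm b h) ![b j, b k, b l] =
      (eps (s 0) (s 1) (s 2) (s 3) (s 4) j k l : ℝ) := by
  refine Eq.trans ?_ (det_comp_eq_eps b ![s 0, s 1, s 2, s 3, s 4, j, k, l])
  simp only [insertFirst, ContinuousAlternatingMap.curryLeft_apply_apply, Fin.tail]
  rw [volForm_apply]
  congr 1
  funext i
  fin_cases i <;> rfl

theorem insertFirst_volForm_four (b : OrthonormalBasis (Fin 8) ℝ V) (h : 8 = 4 + 4)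
    (s : Fin 4 → Fin 8) (i j k l : Fin 8) :
    insertFirst 4 (fun a => b (s a)) (volForm b h) ![b i, b j, b k, b l] =
      (eps (s 0) (s 1) (s 2) (s 3) i j k l : ℝ) := by
  refine Eq.trans ?_ (det_comp_eq_eps b ![s 0, s 1, s 2, s 3, i, j, k, l])
  simp only [insertFirst, ContinuousAlternatingMap.curryLeft_apply_apply, Fin.tail]
  rw [volForm_apply]
  congr 1
  funext i
  fin_cases i <;> rfl

theorem insertFirst_three (α : V [⋀^Fin (1 + 3)]→L[ℝ] ℝ) (u : Fin 3 → V) (v : V) :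
    insertFirst 3 u α ![v] = α ![u 0, u 1, u 2, v] := by
  simp only [insertFirst, ContinuousAlternatingMap.curryLeft_apply_apply, Fin.tail]
  rfl

end

theorem sum_fin_succ {A : Type*} [AddCommMonoid A] {n : ℕ} (F : (Fin (n + 1) → Fin 8) → A) :
    ∑ s, F s = ∑ a, ∑ t, F (Matrix.vecCons a t) := by
  rw [← (Fin.consEquiv fun _ => Fin 8).sum_comp, Fintype.sum_prod_type]
  rfl

theorem sum_fin_three {A : Type*} [AddCommMonoid A] (F : (Fin 3 → Fin 8) → A) :
    ∑ s, F s = ∑ a, ∑ b, ∑ c, F ![a, b, c] := by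
  simp only [sum_fin_succ, Fintype.sum_unique]
  rfl

theorem sum_fin_four {A : Type*} [AddCommMonoid A] (F : (Fin 4 → Fin 8) → A) :
    ∑ s, F s = ∑ a, ∑ b, ∑ c, ∑ d, F ![a, b, c, d] := by
  simp only [sum_fin_succ, Fintype.sum_unique]
  rfl

theorem sum_fin_five {A : Type*} [AddCommMonoid A] (F : (Fin 5 → Fin 8) → A) :
    ∑ s, F s = ∑ a, ∑ b, ∑ c, ∑ d, ∑ e, F ![a, b, c, d, e] := by
  simp only [sum_fin_succ, Fintype.sum_unique]
  rfl

/-- The elementary form `e_i ∧ e_j ∧ e_k ∧ e_l` on basis vectors, as an integer. -/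
def elemInt (i j k l a b c d : Fin 8) : ℤ :=
  -- Laplace expansion of the determinant along its first two rows.
  (kron a i * kron b j - kron a j * kron b i) * (kron c k * kron d l - kron c l * kron d k)
  - (kron a i * kron b k - kron a k * kron b i) * (kron c j * kron d l - kron c l * kron d j)
  + (kron a i * kron b l - kron a l * kron b i) * (kron c j * kron d k - kron c k * kron d j)
  + (kron a j * kron b k - kron a k * kron b j) * (kron c i * kron d l - kron c l * kron d i)
  - (kron a j * kron b l - kron a l * kron b j) * (kron c i * kron d k - kron c k * kron d i)
  + (kron a k * kron b l - kron a l * kron b k) * (kron c i * kron d j - kron c j * kron d i)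

theorem elem_single (i j k l a b c d : Fin 8) :
    elem i j k l (fun r m => if ![a, b, c, d] r = m then 1 else 0) = elemInt i j k l a b c d := by
  have h : ∀ x y : Fin 8, (if x = y then (1 : ℝ) else 0) = (kron x y : ℝ) := fun x y => by
    simp [kron]
  simp only [elem, h, elemInt]
  rw [Matrix.det_succ_row_zero]
  simp [Fin.sum_univ_four, Matrix.det_fin_three, Fin.succAbove]
  ring

/-- The components of the standard form, computed from the elementary forms. -/
def stdInt (a b c d : Fin 8) : ℤ :=
  -elemInt 0 1 2 7 a b c d + elemInt 0 2 3 6 a b c d - elemInt 0 3 4 7 a b c d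
    - elemInt 0 5 6 7 a b c d + elemInt 0 1 4 6 a b c d + elemInt 0 2 4 5 a b c d
    - elemInt 0 1 3 5 a b c d - elemInt 3 4 5 6 a b c d - elemInt 1 4 5 7 a b c d
    - elemInt 1 2 5 6 a b c d - elemInt 1 2 3 4 a b c d - elemInt 2 3 5 7 a b c d
    - elemInt 1 3 6 7 a b c d + elemInt 2 4 6 7 a b c d

theorem stdInt_of_lt : ∀ a b, a < b → ∀ c, b < c → ∀ d, c < d → stdInt a b c d = phi a b c d := by
  decide +kernel

theorem elemInt_swap₁₂ (i j k l a b c d : Fin 8) :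
    elemInt i j k l b a c d = -elemInt i j k l a b c d := by
  unfold elemInt; ring

theorem elemInt_swap₂₃ (i j k l a b c d : Fin 8) :
    elemInt i j k l a c b d = -elemInt i j k l a b c d := by
  unfold elemInt; ring

theorem elemInt_swap₃₄ (i j k l a b c d : Fin 8) :
    elemInt i j k l a b d c = -elemInt i j k l a b c d := by
  unfold elemInt; ring

/-- This is where the binary table of `maskCoeff` is certified: both sides alternate, and increasing
quadruples are evaluated. -/
theorem stdInt_eq_phi (a b c d : Fin 8) : stdInt a b c d = phi a b c d := by
  set F : (Fin 4 → Fin 8) → ℤ := fun s =>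
    stdInt (s 0) (s 1) (s 2) (s 3) - phi (s 0) (s 1) (s 2) (s 3) with hF
  have h : F ![a, b, c, d] = 0 := by
    refine eq_zero_of_skew_of_strictMono (fun i s => ?_) (fun s hs => ?_) _
    · simp only [hF]
      fin_cases i
      · change stdInt (s 1) (s 0) (s 2) (s 3) - phi (s 1) (s 0) (s 2) (s 3) = _
        simp only [stdInt, elemInt_swap₁₂ _ _ _ _ (s 0) (s 1), phi_swap₁₂ (s 0) (s 1)]
        ring
      · change stdInt (s 0) (s 2) (s 1) (s 3) - phi (s 0) (s 2) (s 1) (s 3) = _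
        simp only [stdInt, elemInt_swap₂₃ _ _ _ _ _ (s 1) (s 2), phi_swap₂₃ _ (s 1) (s 2)]
        ring
      · change stdInt (s 0) (s 1) (s 3) (s 2) - phi (s 0) (s 1) (s 3) (s 2) = _
        simp only [stdInt, elemInt_swap₃₄ _ _ _ _ _ _ (s 2) (s 3), phi_swap₃₄ _ _ (s 2) (s 3)]
        ring
    · simp only [hF]
      rw [stdInt_of_lt _ _ (hs (by decide)) _ (hs (by decide)) _ (hs (by decide)), sub_self]
  exact sub_eq_zero.1 h

theorem stdForm_single (a b c d : Fin 8) :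
    stdForm (fun r m => if ![a, b, c, d] r = m then 1 else 0) = ph a b c d := by
  rw [ph, ← stdInt_eq_phi]
  simp only [stdForm, elem_single, stdInt]
  push_cast
  ring

theorem sum_rot_four {A : Type*} [AddCommMonoid A] (G : Fin 8 → Fin 8 → Fin 8 → Fin 8 → A) :
    ∑ a, ∑ b, ∑ c, ∑ d, G a b c d = ∑ d, ∑ a, ∑ b, ∑ c, G a b c d := by
  symm
  rw [Finset.sum_comm]
  refine Finset.sum_congr rfl fun a _ => ?_
  rw [Finset.sum_comm]
  exact Finset.sum_congr rfl fun b _ => Finset.sum_comm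

/-- Self-duality of Φ, by taking r to be a summed index in `sum_ph_mul_eps`: the trace of the delta
contributes 8 and four other terms 1 each, whence 6(8 - 4) = 24 = 4!. -/
theorem sum_ph_mul_eps_four (i j k l : Fin 8) :
    ∑ a, ∑ b, ∑ c, ∑ d, ph a b c d * (eps a b c d i j k l : ℝ) = 24 * ph i j k l := by
  have h : ∀ a, ∑ b, ∑ c, ∑ d, ph a b c d * (eps a b c d i j k l : ℝ) =
      -6 * (kron a i * ph a j k l - kron a a * ph i j k l + kron a j * ph i a k l
        - kron a k * ph i a j l + kron a l * ph i a j k) := by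
    intro a
    have e : ∀ b c d, eps a b c d i j k l = eps i a b c d j k l := fun b c d => by
      rw [eps_swap_34, eps_swap_23, eps_swap_12, eps_swap_01]
      ring
    simp only [e]
    rw [sum_ph_mul_eps]
    simp only [epsPhi, ph]
    push_cast
    ring
  have s₀ : ∑ a : Fin 8, (kron a a : ℝ) = 8 := by simp [kron]
  simp only [h, ← Finset.mul_sum, Finset.sum_add_distrib, Finset.sum_sub_distrib, sum_kron_mul,
    ← Finset.sum_mul, s₀]
  rw [ph_swap₂₃ i j k l, ph_rot₃' i j k l, ph_rot₃' i k l j]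
  ring

/-! ### The components of δΦ and of the Lee form in terms of T -/

/-- The components of `dΦ` expressed through the torsion. -/
def torsionDPhi (T : Fin 8 → Fin 8 → Fin 8 → ℝ) (a b c d e : Fin 8) : ℝ :=
  ∑ r, (T a b r * ph r c d e - T a c r * ph r b d e + T a d r * ph r b c e
    - T a e r * ph r b c d + T b c r * ph r a d e - T b d r * ph r a c e + T b e r * ph r a c d
    + T c d r * ph r a b e - T c e r * ph r a b d + T d e r * ph r a b c)

/-- Relabelling the five summed indices moves σ onto `eps`, which absorbs it as a sign. -/
theorem sum_comp_perm_mul (H : (Fin 5 → Fin 8) → ℝ) (j k l : Fin 8) (σ : Equiv.Perm (Fin 5)) :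
    ∑ s : Fin 5 → Fin 8, H (s ∘ σ) * (eps (s 0) (s 1) (s 2) (s 3) (s 4) j k l : ℝ) =
      σ.sign * ∑ s : Fin 5 → Fin 8, H s * (eps (s 0) (s 1) (s 2) (s 3) (s 4) j k l : ℝ) := by
  set E : (Fin 5 → Fin 8) → ℤ := fun s => eps (s 0) (s 1) (s 2) (s 3) (s 4) j k l with hE
  have h : ∀ s : Fin 5 → Fin 8, E (s ∘ σ) = σ.sign * E s := by
    intro s
    refine map_comp_perm_of_skew (fun i s => ?_) σ s
    simp only [hE]
    fin_cases i
    · exact eps_swap_01 _ _ _ _ _ _ _ _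
    · exact eps_swap_12 _ _ _ _ _ _ _ _
    · exact eps_swap_23 _ _ _ _ _ _ _ _
    · exact eps_swap_34 _ _ _ _ _ _ _ _
  change ∑ s, H (s ∘ σ) * (E s : ℝ) = σ.sign * ∑ s, H s * (E s : ℝ)
  rw [← (Equiv.arrowCongr σ (Equiv.refl (Fin 8))).sum_comp fun s => H (s ∘ σ) * (E s : ℝ),
    Finset.mul_sum]
  refine Finset.sum_congr rfl fun s _ => ?_
  have e₁ : (Equiv.arrowCongr σ (Equiv.refl (Fin 8)) s) ∘ σ = s := by
    funext i
    simp
  have e₂ : (Equiv.arrowCongr σ (Equiv.refl (Fin 8)) s) = s ∘ σ.symm := by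
    funext i
    simp
  have e₃ := h (s ∘ σ.symm)
  have e₄ : (s ∘ σ.symm) ∘ σ = s := by
    funext i
    simp
  rw [e₄] at e₃
  rw [e₁, e₂, e₃]
  rcases Int.units_eq_one_or σ.sign with h' | h' <;> simp [h']

/-- The ten terms of dΦ are signed shuffles of the first, so each contributes the same `Q`.
Self-duality gives `Q` = -6 times the cyclic sum of `phPair`, which by `sum_phTrace_mul` is 2T +
(1/3) t ⌟ Φ; hence -60 · 2 = -120 and -60/3 = -20. -/
theorem sum_torsionDPhi_mul_eps {T : Fin 8 → Fin 8 → Fin 8 → ℝ} (hT : Skew T) (j k l : Fin 8) :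
    ∑ s : Fin 5 → Fin 8, torsionDPhi T (s 0) (s 1) (s 2) (s 3) (s 4) *
        (eps (s 0) (s 1) (s 2) (s 3) (s 4) j k l : ℝ) =
      -120 * T j k l - 20 * ∑ s, phTrace T s * ph s j k l := by
  set H : (Fin 5 → Fin 8) → ℝ := fun s => ∑ r, T (s 0) (s 1) r * ph r (s 2) (s 3) (s 4) with hH
  set Q : ℝ := ∑ s : Fin 5 → Fin 8, H s * (eps (s 0) (s 1) (s 2) (s 3) (s 4) j k l : ℝ) with hQ
  have key : ∀ (p q : Fin 5 → Fin 5) (h₁ : Function.LeftInverse q p)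
      (h₂ : Function.RightInverse q p) (ε : ℤˣ), Equiv.Perm.sign ⟨p, q, h₁, h₂⟩ = ε →
      ∑ s : Fin 5 → Fin 8, H (fun i => s (p i)) * (eps (s 0) (s 1) (s 2) (s 3) (s 4) j k l : ℝ) =
        ε * Q := by
    intro p q h₁ h₂ ε hε
    rw [← hε]
    exact sum_comp_perm_mul H j k l ⟨p, q, h₁, h₂⟩
  -- Each line lists a shuffle placing a pair before the complementary triple, its inverse and its
  -- sign.
  have k₁ := key ![0, 2, 1, 3, 4] ![0, 2, 1, 3, 4] (by decide) (by decide) (-1) (by decide)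
  have k₂ := key ![0, 3, 1, 2, 4] ![0, 2, 3, 1, 4] (by decide) (by decide) 1 (by decide)
  have k₃ := key ![0, 4, 1, 2, 3] ![0, 2, 3, 4, 1] (by decide) (by decide) (-1) (by decide)
  have k₄ := key ![1, 2, 0, 3, 4] ![2, 0, 1, 3, 4] (by decide) (by decide) 1 (by decide)
  have k₅ := key ![1, 3, 0, 2, 4] ![2, 0, 3, 1, 4] (by decide) (by decide) (-1) (by decide)
  have k₆ := key ![1, 4, 0, 2, 3] ![2, 0, 3, 4, 1] (by decide) (by decide) 1 (by decide)
  have k₇ := key ![2, 3, 0, 1, 4] ![2, 3, 0, 1, 4] (by decide) (by decide) 1 (by decide)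
  have k₈ := key ![2, 4, 0, 1, 3] ![2, 3, 0, 4, 1] (by decide) (by decide) (-1) (by decide)
  have k₉ := key ![3, 4, 0, 1, 2] ![2, 3, 4, 0, 1] (by decide) (by decide) 1 (by decide)
  have h₁ : ∑ s : Fin 5 → Fin 8, torsionDPhi T (s 0) (s 1) (s 2) (s 3) (s 4) *
        (eps (s 0) (s 1) (s 2) (s 3) (s 4) j k l : ℝ) = 10 * Q := by
    have e : ∀ s : Fin 5 → Fin 8, torsionDPhi T (s 0) (s 1) (s 2) (s 3) (s 4) =
        H s - H (fun i => s (![0, 2, 1, 3, 4] i)) + H (fun i => s (![0, 3, 1, 2, 4] i))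
        - H (fun i => s (![0, 4, 1, 2, 3] i)) + H (fun i => s (![1, 2, 0, 3, 4] i))
        - H (fun i => s (![1, 3, 0, 2, 4] i)) + H (fun i => s (![1, 4, 0, 2, 3] i))
        + H (fun i => s (![2, 3, 0, 1, 4] i)) - H (fun i => s (![2, 4, 0, 1, 3] i))
        + H (fun i => s (![3, 4, 0, 1, 2] i)) := by
      intro s
      simp only [torsionDPhi, Finset.sum_add_distrib, Finset.sum_sub_distrib]
      rfl
    simp only [e, add_mul, sub_mul, Finset.sum_add_distrib, Finset.sum_sub_distrib, k₁, k₂, k₃, k₄,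
      k₅, k₆, k₇, k₈, k₉, ← hQ]
    push_cast
    ring
  have h₂ : Q = -6 * (phPair T j k l - phPair T k j l + phPair T l j k) := by
    have e₁ : Q = ∑ a, ∑ b, ∑ r, T a b r * (-6 * (epsPhi r a b j k l : ℝ)) := by
      rw [hQ, sum_fin_five]
      refine Finset.sum_congr rfl fun a _ => Finset.sum_congr rfl fun b _ => ?_
      have : ∀ r, T a b r * (-6 * (epsPhi r a b j k l : ℝ)) =
          ∑ c, ∑ d, ∑ e, T a b r * ph r c d e * (eps a b c d e j k l : ℝ) := fun r => by
        rw [← sum_ph_mul_eps]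
        simp only [Finset.mul_sum, mul_assoc]
      simp only [this]
      simp only [hH, Finset.sum_mul]
      exact sum_rot_four fun c d e r => T a b r * ph r c d e * (eps a b c d e j k l : ℝ)
    have e₂ : ∀ a b r, T a b r * (-6 * (epsPhi r a b j k l : ℝ)) =
        -6 * (kron r a * (T a b r * ph b j k l)) + 6 * (kron r b * (T a b r * ph a j k l))
        - 6 * (kron r j * (T a b r * ph a b k l)) + 6 * (kron r k * (T a b r * ph a b j l))
        - 6 * (kron r l * (T a b r * ph a b j k)) := fun a b r => by
      simp only [epsPhi, ph]
      push_cast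
      ring
    have z₁ : ∀ a b, T a b a = 0 := fun a b => by
      rw [hT.swap₂₃, hT.self₁₂, neg_zero]
    rw [e₁]
    simp only [e₂, Finset.sum_add_distrib, Finset.sum_sub_distrib, ← Finset.mul_sum, sum_kron_mul,
      z₁, hT.self₂₃, zero_mul, Finset.sum_const_zero]
    simp only [phPair]
    ring
  have h₃ : phPair T k j l = -phPair T k l j := by
    simp only [phPair, ← Finset.sum_neg_distrib]
    exact Finset.sum_congr rfl fun a _ => Finset.sum_congr rfl fun b _ => by
      rw [ph_swap₃₄]; ring
  rw [h₁, h₂, h₃, sum_phTrace_mul hT]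
  ring

/-- Trace of `sum_ph_mul_ph₁`: 6(8 - 1) = 42, with a sign for moving s past three indices. -/
theorem sum_ph_mul_ph₃ (s a : Fin 8) :
    ∑ i, ∑ j, ∑ k, ph s i j k * ph i j k a = -42 * (kron s a : ℝ) := by
  have h : ∀ i, ∑ j, ∑ k, ph s i j k * ph i j k a =
      ∑ j, ∑ k, (-(ph j k i s * ph j k i a)) := fun i => by
    refine Finset.sum_congr rfl fun j _ => Finset.sum_congr rfl fun k _ => ?_
    rw [ph_rot s i j k, ph_rot₃ i j k s, ph_rot₃ i j k a]
    ring
  have z : ∀ i, ph i s i a = 0 := fun i => by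
    have := ph_swap₂₃ i s i a
    have := ph_swap₁₂ i i s a
    linarith
  have s₀ : ∑ a : Fin 8, (kron a a : ℝ) = 8 := by simp [kron]
  have hk : ∀ x y : Fin 8, kron x y = kron y x := fun x y => by simp [kron, eq_comm]
  simp only [h, Finset.sum_neg_distrib, sum_ph_mul_ph₁, z]
  simp only [mul_sub, Finset.sum_sub_distrib, ← Finset.mul_sum, ← Finset.sum_mul, s₀, hk s _,
    sum_kron_mul]
  simp
  ring

/-- T itself contributes t and the correction contributes -42/6 = -7 times t. With the factor 1/42
in the Lee form this is the constant -1/7. -/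
theorem sum_codiff_mul_ph {T : Fin 8 → Fin 8 → Fin 8 → ℝ} (a : Fin 8) :
    ∑ i, ∑ j, ∑ k, (T i j k + 1 / 6 * ∑ s, phTrace T s * ph s i j k) * ph i j k a =
      -6 * phTrace T a := by
  have h : ∑ i, ∑ j, ∑ k, (∑ s, phTrace T s * ph s i j k) * ph i j k a = -42 * phTrace T a := by
    simp only [Finset.sum_mul]
    have : ∑ i, ∑ j, ∑ k, ∑ s, phTrace T s * ph s i j k * ph i j k a =
        ∑ s, phTrace T s * ∑ i, ∑ j, ∑ k, ph s i j k * ph i j k a := by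
      simp only [Finset.mul_sum, mul_assoc]
      rw [sum_rot_four]
    rw [this]
    have hk : ∀ x y : Fin 8, kron x y = kron y x := fun x y => by simp [kron, eq_comm]
    have e : ∀ s, phTrace T s * (-42 * (kron s a : ℝ)) = -42 * (kron s a * phTrace T s) :=
      fun s => by ring
    simp only [sum_ph_mul_ph₃, e, ← Finset.mul_sum, sum_kron_mul]
  simp only [add_mul, Finset.sum_add_distrib, mul_assoc, ← Finset.mul_sum]
  rw [h]
  simp only [phTrace]
  ring

/-! ### Structure equations in a frame: Bianchi identity, curvature in spin(7), contraction with
parallel Φ -/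

/-- The action of an endomorphism `A` on the standard form. -/
def phAct (A : Fin 8 → Fin 8 → ℝ) (a b c d : Fin 8) : ℝ :=
  ∑ s, (A a s * ph s b c d + A b s * ph a s c d + A c s * ph a b s d + A d s * ph a b c s)

/-- The components of the curvature in a frame with connection coefficients `Γ` and structure
functions `c`; `dΓ p` is the derivative of `Γ` along the `p`-th vector. -/
def frameCurv (Γ c : Fin 8 → Fin 8 → Fin 8 → ℝ) (dΓ : Fin 8 → Fin 8 → Fin 8 → Fin 8 → ℝ)
    (i j k l : Fin 8) : ℝ :=
  dΓ i j k l - dΓ j i k l + ∑ s, (Γ j k s * Γ i s l - Γ i k s * Γ j s l - c i j s * Γ s k l)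

/-- The components of `∇τ` in a frame with connection coefficients `Γ`. -/
def frameNabla (Γ τ : Fin 8 → Fin 8 → Fin 8 → ℝ) (dτ : Fin 8 → Fin 8 → Fin 8 → Fin 8 → ℝ)
    (i j k l : Fin 8) : ℝ :=
  dτ i j k l - ∑ s, (Γ i j s * τ s k l + Γ i k s * τ j s l + Γ i l s * τ j k s)

variable {Γ c τ : Fin 8 → Fin 8 → Fin 8 → ℝ} {dΓ dc dτ : Fin 8 → Fin 8 → Fin 8 → Fin 8 → ℝ}

/-- The Jacobi identity with the structure functions eliminated through the torsion. The quadratic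
terms cancel for each summation index separately, using the skewness of τ and of the connection
coefficients. -/
theorem bianchi_frameCurv (hτs : Skew τ) (hΓ : ∀ i j k, Γ i k j = -Γ i j k)
    (hτ : ∀ i j k, τ i j k = Γ i j k - Γ j i k - c i j k)
    (hdτ : ∀ p i j k, dτ p i j k = dΓ p i j k - dΓ p j i k - dc p i j k)
    (jac : ∀ i j k l, dc i j k l + dc j k i l + dc k i j l
      + ∑ s, (c j k s * c i s l + c k i s * c j s l + c i j s * c k s l) = 0) :
    Bianchi (frameCurv Γ c dΓ) (frameNabla Γ τ dτ) τ := by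
  intro i j k l
  have h := jac i j k l
  have hc : ∀ i j k, c i j k = Γ i j k - Γ j i k - τ i j k := fun i j k => by
    rw [hτ]; ring
  have hdc : ∀ p i j k, dc p i j k = dΓ p i j k - dΓ p j i k - dτ p i j k := fun p i j k => by
    rw [hdτ]; ring
  have e : ∑ s, (Γ j k s * Γ i s l - Γ i k s * Γ j s l - c i j s * Γ s k l)
      + ∑ s, (Γ k i s * Γ j s l - Γ j i s * Γ k s l - c j k s * Γ s i l)
      + ∑ s, (Γ i j s * Γ k s l - Γ k j s * Γ i s l - c k i s * Γ s j l)
      - ∑ s, (τ i j s * τ s k l + τ j k s * τ s i l + τ k i s * τ s j l)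
      + ∑ s, (Γ i j s * τ s k l + Γ i k s * τ j s l + Γ i l s * τ j k s)
      + ∑ s, (Γ j k s * τ s i l + Γ j i s * τ k s l + Γ j l s * τ k i s)
      + ∑ s, (Γ k i s * τ s j l + Γ k j s * τ i s l + Γ k l s * τ i j s)
      - ∑ s, (c j k s * c i s l + c k i s * c j s l + c i j s * c k s l) = 0 := by
    simp only [← Finset.sum_add_distrib, ← Finset.sum_sub_distrib]
    refine Finset.sum_eq_zero fun s _ => ?_
    have t₁ := hτs.swap₁₂ s k l
    have t₂ := hτs.swap₁₂ s i l
    have t₃ := hτs.swap₁₂ s j l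
    have w₁ := hΓ i l s
    have w₂ := hΓ j l s
    have w₃ := hΓ k l s
    rw [t₁, t₂, t₃]
    simp only [hc]
    rw [t₁, t₂, t₃]
    linear_combination τ j k s * w₁ + τ k i s * w₂ + τ i j s * w₃
  simp only [hdc] at h
  simp only [frameCurv, frameNabla]
  linarith

/-- The stabilizer of Φ is a Lie algebra: terms in which A and B act on different slots cancel
between the two orders of composition. -/
theorem phAct_comp_comm {A B : Fin 8 → Fin 8 → ℝ} (hA : ∀ a b c d, phAct A a b c d = 0)
    (hB : ∀ a b c d, phAct B a b c d = 0) (a b c d : Fin 8) :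
    phAct (fun i j => ∑ s, (A i s * B s j - B i s * A s j)) a b c d = 0 := by
  have h : ∀ (A B : Fin 8 → Fin 8 → ℝ), (∀ a b c d, phAct B a b c d = 0) →
      ∑ r, (A a r * phAct B r b c d + A b r * phAct B a r c d + A c r * phAct B a b r d
        + A d r * phAct B a b c r) = 0 := fun A B hB =>
    Finset.sum_eq_zero fun r _ => by simp [hB]
  have h₁ := h A B hB
  have h₂ := h B A hA
  simp only [phAct, mul_add, Finset.mul_sum, Finset.sum_add_distrib, Finset.sum_mul, sub_mul,
    Finset.sum_sub_distrib] at h₁ h₂ ⊢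
  have comm : ∀ F : Fin 8 → Fin 8 → ℝ, ∑ x, ∑ y, F x y = ∑ x, ∑ y, F y x :=
    fun F => Finset.sum_comm
  have e₁ := comm fun r s => A a r * (B b s * ph r s c d)
  have e₂ := comm fun r s => A a r * (B c s * ph r b s d)
  have e₃ := comm fun r s => A a r * (B d s * ph r b c s)
  have e₄ := comm fun r s => A b r * (B a s * ph s r c d)
  have e₅ := comm fun r s => A b r * (B c s * ph a r s d)
  have e₆ := comm fun r s => A b r * (B d s * ph a r c s)
  have e₇ := comm fun r s => A c r * (B a s * ph s b r d)
  have e₈ := comm fun r s => A c r * (B b s * ph a s r d)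
  have e₉ := comm fun r s => A c r * (B d s * ph a b r s)
  have f₁ := comm fun r s => A d r * (B a s * ph s b c r)
  have f₂ := comm fun r s => A d r * (B b s * ph a s c r)
  have f₃ := comm fun r s => A d r * (B c s * ph a b s r)
  have g₁ := comm fun r s => A a r * B r s * ph s b c d
  have g₂ := comm fun r s => A b r * B r s * ph a s c d
  have g₃ := comm fun r s => A c r * B r s * ph a b s d
  have g₄ := comm fun r s => A d r * B r s * ph a b c s
  have k₁ := comm fun r s => B a r * A r s * ph s b c d
  have k₂ := comm fun r s => B b r * A r s * ph a s c d
  have k₃ := comm fun r s => B c r * A r s * ph a b s d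
  have k₄ := comm fun r s => B d r * A r s * ph a b c s
  simp only [← mul_assoc] at h₁ h₂ e₁ e₂ e₃ e₄ e₅ e₆ e₇ e₈ e₉ f₁ f₂ f₃ ⊢
  simp only [mul_comm (B _ _) (A _ _)] at h₁ h₂ e₁ e₂ e₃ e₄ e₅ e₆ e₇ e₈ e₉ f₁ f₂ f₃ g₁ g₂ g₃ g₄ k₁ k₂ k₃ k₄ ⊢
  linarith

/-- The curvature is built from derivatives, commutators and combinations of connection matrices,
all of which remain in the stabilizer of Φ. -/
theorem isCurvature_frameCurv (hΓ : ∀ i j k, Γ i k j = -Γ i j k)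
    (hdΓ : ∀ p i j k, dΓ p i k j = -dΓ p i j k) (hc : ∀ i j k, c j i k = -c i j k)
    (hph : ∀ i a b c d, phAct (Γ i) a b c d = 0)
    (hdph : ∀ p i a b c d, phAct (dΓ p i) a b c d = 0) : IsCurvature (frameCurv Γ c dΓ) where
  swap₁₂ i j k l := by
    simp only [frameCurv, neg_add, ← Finset.sum_neg_distrib]
    congr 1
    · ring
    · exact Finset.sum_congr rfl fun s _ => by rw [hc]; ring
  swap₃₄ i j k l := by
    simp only [frameCurv, neg_add, ← Finset.sum_neg_distrib]
    rw [hdΓ, hdΓ j]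
    congr 1
    · ring
    · refine Finset.sum_congr rfl fun s _ => ?_
      rw [hΓ s k l, hΓ i k s, hΓ j k s, hΓ j l s, hΓ i l s]
      ring
  phi i b j l m k := by
    have h₁ := hdph i b j l m k
    have h₂ := hdph b i j l m k
    have h₃ := phAct_comp_comm (hph b) (hph i) j l m k
    have h₄ : ∑ s, c i b s * phAct (Γ s) j l m k = 0 := by simp [hph]
    have h₅ : phAct (frameCurv Γ c dΓ i b) j l m k = phAct (dΓ i b) j l m k
        - phAct (dΓ b i) j l m k
        + phAct (fun x y => ∑ s, (Γ b x s * Γ i s y - Γ i x s * Γ b s y)) j l m k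
        - ∑ s, c i b s * phAct (Γ s) j l m k := by
      simp only [phAct, frameCurv, Finset.mul_sum]
      rw [Finset.sum_comm]
      simp only [← Finset.sum_add_distrib, ← Finset.sum_sub_distrib]
      refine Finset.sum_congr rfl fun t _ => ?_
      have e : ∀ x, ∑ s, (Γ b x s * Γ i s t - Γ i x s * Γ b s t - c i b s * Γ s x t) =
          ∑ s, (Γ b x s * Γ i s t - Γ i x s * Γ b s t) - ∑ s, c i b s * Γ s x t := fun x => by
        rw [← Finset.sum_sub_distrib]
      have e' : ∑ s, c i b s * (Γ s j t * ph t l m k + Γ s l t * ph j t m k + Γ s m t * ph j l t k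
          + Γ s k t * ph j l m t) = (∑ s, c i b s * Γ s j t) * ph t l m k
          + (∑ s, c i b s * Γ s l t) * ph j t m k + (∑ s, c i b s * Γ s m t) * ph j l t k
          + (∑ s, c i b s * Γ s k t) * ph j l m t := by
        simp only [Finset.sum_mul, ← Finset.sum_add_distrib]
        exact Finset.sum_congr rfl fun s _ => by ring
      rw [e', e, e, e, e]
      ring
    rw [h₁, h₂, h₃, h₄] at h₅
    simp only [phAct] at h₅ ⊢
    linarith

theorem skew_frameNabla (hτ : Skew τ) (hdτ : ∀ p, Skew (dτ p)) (i : Fin 8) :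
    Skew (frameNabla Γ τ dτ i) where
  swap₁₂ j k l := by
    simp only [frameNabla, (hdτ i).swap₁₂ k j l]
    rw [neg_sub, sub_eq_add_neg, ← Finset.sum_neg_distrib, add_comm, sub_eq_add_neg]
    refine congrArg₂ _ (Finset.sum_congr rfl fun s _ => ?_) (neg_neg _).symm
    rw [hτ.swap₁₂ s k l, hτ.swap₁₂ s j l, hτ.swap₁₂ k j s]
    ring
  swap₂₃ j k l := by
    simp only [frameNabla, (hdτ i).swap₂₃ j l k]
    rw [neg_sub, sub_eq_add_neg, ← Finset.sum_neg_distrib, add_comm, sub_eq_add_neg]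
    refine congrArg₂ _ (Finset.sum_congr rfl fun s _ => ?_) (neg_neg _).symm
    rw [hτ.swap₂₃ s l k, hτ.swap₂₃ j s k, hτ.swap₂₃ j l s]
    ring

/-- Contraction with Φ commutes with ∇ because Φ is parallel: skewness of Γ moves it from the slots
of τ to those of Φ, and its action on Φ vanishes. -/
theorem phTrace_frameNabla (hΓ : ∀ i j k, Γ i k j = -Γ i j k)
    (hph : ∀ i a b c d, phAct (Γ i) a b c d = 0) (i j : Fin 8) :
    phTrace (frameNabla Γ τ dτ i) j = phTrace (dτ i) j - ∑ s, Γ i j s * phTrace τ s := by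
  have h : ∑ a, ∑ b, ∑ c, τ a b c * phAct (Γ i) a b c j = 0 := by simp [hph]
  have adj : ∀ X Y : Fin 8 → ℝ,
      ∑ a, (∑ s, Γ i a s * X s) * Y a = -∑ a, X a * ∑ s, Γ i a s * Y s := fun X Y => by
    simp only [Finset.sum_mul, Finset.mul_sum, ← Finset.sum_neg_distrib]
    rw [Finset.sum_comm]
    refine Finset.sum_congr rfl fun a _ => Finset.sum_congr rfl fun s _ => ?_
    rw [hΓ i a s]
    ring
  have e₃ : ∑ a, ∑ b, ∑ c, (∑ s, Γ i c s * τ a b s) * ph a b c j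
      = -∑ a, ∑ b, ∑ c, τ a b c * ∑ s, Γ i c s * ph a b s j := by
    simp only [adj, Finset.sum_neg_distrib]
  have e₂ : ∑ a, ∑ b, ∑ c, (∑ s, Γ i b s * τ a s c) * ph a b c j
      = -∑ a, ∑ b, ∑ c, τ a b c * ∑ s, Γ i b s * ph a s c j := by
    rw [sum_rot fun a b c => (∑ s, Γ i b s * τ a s c) * ph a b c j,
      sum_rot fun a b c => τ a b c * ∑ s, Γ i b s * ph a s c j]
    simp only [adj, Finset.sum_neg_distrib]
  have e₁ : ∑ a, ∑ b, ∑ c, (∑ s, Γ i a s * τ s b c) * ph a b c j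
      = -∑ a, ∑ b, ∑ c, τ a b c * ∑ s, Γ i a s * ph s b c j := by
    rw [← sum_rot fun b c a => (∑ s, Γ i a s * τ s b c) * ph a b c j,
      ← sum_rot fun b c a => τ a b c * ∑ s, Γ i a s * ph s b c j]
    simp only [adj, Finset.sum_neg_distrib]
  have e₀ : ∑ s, Γ i j s * phTrace τ s
      = ∑ a, ∑ b, ∑ c, τ a b c * ∑ s, Γ i j s * ph a b c s := by
    simp only [phTrace, Finset.mul_sum]
    rw [Finset.sum_comm]
    refine Finset.sum_congr rfl fun a _ => ?_
    rw [Finset.sum_comm]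
    refine Finset.sum_congr rfl fun b _ => ?_
    rw [Finset.sum_comm]
    exact Finset.sum_congr rfl fun c _ => Finset.sum_congr rfl fun s _ => by ring
  simp only [phAct, mul_add, Finset.sum_add_distrib] at h
  simp only [phTrace, frameNabla, sub_mul, add_mul, Finset.sum_add_distrib,
    Finset.sum_sub_distrib] at e₀ ⊢
  linarith

theorem isManifold_two {M : Type*} [TopologicalSpace M] [ChartedSpace E8 M]
    [IsManifold (𝓡 8) ∞ M] : IsManifold (𝓡 8) 2 M :=
  IsManifold.of_le (n := ∞) (by norm_cast)

theorem isManifold_minSmoothness_two {M : Type*} [TopologicalSpace M] [ChartedSpace E8 M]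
    [IsManifold (𝓡 8) ∞ M] : IsManifold (𝓡 8) (minSmoothness ℝ 2) M := by
  rw [minSmoothness_of_isRCLikeNormedField]
  exact isManifold_two

theorem isManifold_minSmoothness_three {M : Type*} [TopologicalSpace M] [ChartedSpace E8 M]
    [IsManifold (𝓡 8) ∞ M] : IsManifold (𝓡 8) (minSmoothness ℝ 3) M := by
  rw [minSmoothness_of_isRCLikeNormedField]
  exact IsManifold.of_le (n := ∞) (by norm_cast)

theorem isManifold_infty_add_one {M : Type*} [TopologicalSpace M] [ChartedSpace E8 M]
    [IsManifold (𝓡 8) ∞ M] : IsManifold (𝓡 8) (((⊤ : ℕ∞) : WithTop ℕ∞) + 1) M := by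
  simpa using (inferInstance : IsManifold (𝓡 8) ∞ M)

attribute [local instance] isManifold_two isManifold_minSmoothness_two
  isManifold_minSmoothness_three isManifold_infty_add_one

/-! ### The exterior derivative on vector fields -/

section ExteriorDerivative

open VectorField Topology

variable {M : Type*} [TopologicalSpace M] [ChartedSpace E8 M]
  [IsManifold (𝓡 8) ∞ M]

/-- The vector field `V` read in the preferred chart at `x`. -/
def chartField (V : VField M) (x : M) : E8 → E8 :=
  mpullbackWithin 𝓘(ℝ, E8) (𝓡 8) (extChartAt (𝓡 8) x).symm V (Set.range (𝓡 8))

theorem chartField_def (V : VField M) (x : M) (y : E8) : chartField V x y =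
    (mfderiv 𝓘(ℝ, E8) (𝓡 8) (extChartAt (𝓡 8) x).symm y).inverse
      (V ((extChartAt (𝓡 8) x).symm y)) := by
  unfold chartField
  rw [mpullbackWithin_apply, ModelWithCorners.range_eq_univ, mfderivWithin_univ]

theorem differentiableAt_chartField {V : VField M} {x : M} (hV : DiffAt V x) :
    DifferentiableAt ℝ (chartField V x) (extChartAt (𝓡 8) x x) := by
  have h := MDifferentiableWithinAt.differentiableWithinAt_mpullbackWithin_vectorField
    (mdifferentiableWithinAt_univ.2 hV)
  rw [Set.preimage_univ, Set.univ_inter] at h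
  exact h.differentiableAt (by rw [ModelWithCorners.range_eq_univ]; exact Filter.univ_mem)

theorem mfderiv_symm_chartField (V : VField M) (x : M) {y : E8}
    (hy : y ∈ (extChartAt (𝓡 8) x).target) :
    mfderiv 𝓘(ℝ, E8) (𝓡 8) (extChartAt (𝓡 8) x).symm y (chartField V x y) =
      V ((extChartAt (𝓡 8) x).symm y) := by
  have h := isInvertible_mfderivWithin_extChartAt_symm (I := 𝓡 8) hy
  rw [ModelWithCorners.range_eq_univ, mfderivWithin_univ] at h
  rw [chartField_def]
  exact h.self_apply_inverse _

theorem chartForm_apply {k : ℕ} (α : Form M k) (x : M) (y : E8) (v : Fin k → E8) :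
    chartForm α x y v = α ((extChartAt (𝓡 8) x).symm y) (fun a =>
      mfderiv 𝓘(ℝ, E8) (𝓡 8) (extChartAt (𝓡 8) x).symm y (v a)) :=
  rfl

theorem chartForm_chartField {k : ℕ} (α : Form M k) (V : Fin k → VField M) (x : M) {y : E8}
    (hy : y ∈ (extChartAt (𝓡 8) x).target) :
    chartForm α x y (fun a => chartField (V a) x y) =
      α ((extChartAt (𝓡 8) x).symm y) (fun a => V a ((extChartAt (𝓡 8) x).symm y)) := by
  rw [chartForm_apply]
  congr 1
  funext a
  exact mfderiv_symm_chartField (V a) x hy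

theorem chartField_self (V : VField M) (x : M) :
    chartField V x (extChartAt (𝓡 8) x x) =
      mfderiv (𝓡 8) 𝓘(ℝ, E8) (extChartAt (𝓡 8) x) x (V x) := by
  have h := isInvertible_mfderivWithin_extChartAt_symm (I := 𝓡 8) (mem_extChartAt_target x)
  have h₂ := mfderivWithin_extChartAt_symm_comp_mfderiv_extChartAt' (I := 𝓡 8)
    (mem_extChartAt_source (I := 𝓡 8) x)
  rw [ModelWithCorners.range_eq_univ, mfderivWithin_univ] at h h₂
  have e : ∀ z, z = x → (V z : E8) = (V x : E8) := fun z hz => by subst hz; rfl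
  rw [chartField_def]
  refine (congrArg _ (e ((extChartAt (𝓡 8) x).symm (extChartAt (𝓡 8) x x))
    (extChartAt_to_inv (I := 𝓡 8) x))).trans ?_
  have h₃ := congrArg (fun L => (mfderiv 𝓘(ℝ, E8) (𝓡 8) (extChartAt (𝓡 8) x).symm
    (extChartAt (𝓡 8) x x)).inverse (L (V x))) h₂
  exact h₃.symm.trans (h.inverse_apply_self _)

/-- Brackets are natural under the chart; with `chartField_self` this carries the flat formula for d
over to M. -/
theorem lieBracket_chartField (V W : VField M) (x : M) :
    lieBracket ℝ (chartField V x) (chartField W x) (extChartAt (𝓡 8) x x) =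
      mfderiv (𝓡 8) 𝓘(ℝ, E8) (extChartAt (𝓡 8) x) x (mlieBracket (𝓡 8) V W x) := by
  have h := isInvertible_mfderiv_extChartAt (I := 𝓡 8) (mem_extChartAt_source (I := 𝓡 8) x)
  rw [mlieBracket, mlieBracketWithin_apply]
  refine Eq.trans ?_ (h.self_apply_inverse _).symm
  rw [Set.preimage_univ, Set.univ_inter, ← lieBracketWithin_univ]
  exact congrArg (fun s => lieBracketWithin ℝ (chartField V x) (chartField W x) s
    (extChartAt (𝓡 8) x x)) (ModelWithCorners.range_eq_univ (𝓡 8)).symm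

theorem fderiv_comp_extChartAt_symm {f : M → ℝ} {x : M}
    (hf : MDifferentiableAt (𝓡 8) 𝓘(ℝ, ℝ) f x) (v : TangentSpace (𝓡 8) x) :
    fderiv ℝ (fun y => f ((extChartAt (𝓡 8) x).symm y)) (extChartAt (𝓡 8) x x)
      (mfderiv (𝓡 8) 𝓘(ℝ, E8) (extChartAt (𝓡 8) x) x v) = mvfderiv (𝓡 8) f x v := by
  have h₂ := mfderivWithin_extChartAt_symm_comp_mfderiv_extChartAt' (I := 𝓡 8)
    (mem_extChartAt_source (I := 𝓡 8) x)
  have h₃ := mdifferentiableWithinAt_extChartAt_symm (I := 𝓡 8) (mem_extChartAt_target x)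
  rw [ModelWithCorners.range_eq_univ, mfderivWithin_univ] at h₂
  rw [ModelWithCorners.range_eq_univ, mdifferentiableWithinAt_univ] at h₃
  have h₄ := mvfderiv_comp_apply_of_eq _ hf h₃ (extChartAt_to_inv (I := 𝓡 8) x)
    (mfderiv (𝓡 8) 𝓘(ℝ, E8) (extChartAt (𝓡 8) x) x v)
  have h₅ := congrArg (fun L => mvfderiv (𝓡 8) f x (L v)) h₂
  refine Eq.trans ?_ (h₄.trans h₅)
  have h₆ := mfderiv_eq_fderiv (𝕜 := ℝ) (f := fun y : E8 => f ((extChartAt (𝓡 8) x).symm y))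
    (x := extChartAt (𝓡 8) x x)
  exact (congrArg (fun L => L (mfderiv (𝓡 8) 𝓘(ℝ, E8) (extChartAt (𝓡 8) x) x v)) h₆).symm

theorem neg_one_pow_zsmul (n : ℕ) (r : ℝ) : (-1 : ℤ) ^ n • r = (-1) ^ n * r := by
  simp [zsmul_eq_mul]

/-- The invariant formula for d. In the preferred chart it is `extDeriv_apply_vectorField` applied
to the fields read in the chart, whose values and brackets at the base point correspond to those on
M. -/
theorem extD_apply {n : ℕ} {α : Form M (n + 1)} {V : Fin (n + 2) → VField M} {x : M}
    (hα : DifferentiableAt ℝ (chartForm α x) (extChartAt (𝓡 8) x x)) (hV : ∀ i, DiffAt (V i) x)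
    (hαV : ∀ i : Fin (n + 2), MDifferentiableAt (𝓡 8) 𝓘(ℝ, ℝ)
      (fun y => α y (fun a => V (i.succAbove a) y)) x) :
    extD α x (fun i => V i x) =
      (∑ i : Fin (n + 2), (-1) ^ i.val *
        mvfderiv (𝓡 8) (fun y => α y (fun a => V (i.succAbove a) y)) x (V i x)) -
        ∑ i : Fin (n + 1), ∑ j ≥ i, (-1) ^ (i + j : ℕ) *
            α x (Matrix.vecCons (mlieBracket (𝓡 8) (V i.castSucc) (V j.succ) x)
              (fun a => V (i.castSucc.succAbove (j.succAbove a)) x)) := by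
  have h := extDeriv_apply_vectorField hα (V := fun i => chartField (V i) x)
    fun i => differentiableAt_chartField (hV i)
  simp only [chartField_self, lieBracket_chartField] at h
  refine Eq.trans ?_ (h.trans ?_)
  · rfl
  · refine congrArg₂ _ (Finset.sum_congr rfl fun i _ => ?_) (Finset.sum_congr rfl fun i _ =>
      Finset.sum_congr rfl fun j _ => ?_)
    · refine (neg_one_pow_zsmul _ _).trans (congrArg _ ?_)
      rw [← fderiv_comp_extChartAt_symm (hαV i)]
      have e : (fun y => chartForm α x y (i.removeNth fun a => chartField (V a) x y)) =ᶠ[𝓝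
          (extChartAt (𝓡 8) x x)] fun y => α ((extChartAt (𝓡 8) x).symm y)
            (fun a => V (i.succAbove a) ((extChartAt (𝓡 8) x).symm y)) := by
        filter_upwards [extChartAt_target_mem_nhds (I := 𝓡 8) x] with y hy
        exact chartForm_chartField α (fun a => V (i.succAbove a)) x hy
      exact congrArg (fun L : E8 →L[ℝ] ℝ => L (mfderiv (𝓡 8) 𝓘(ℝ, E8) (extChartAt (𝓡 8) x) x
        (V i x))) e.fderiv_eq
    · refine (neg_one_pow_zsmul _ _).trans (congrArg _ ?_)
      rw [chartForm_apply]
      -- The chart and its inverse compose to x only propositionally; all tangent spaces are the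
      -- same vector space `E8`, so the values can still be compared.
      have key : ∀ z, z = x → ∀ (w : Fin (n + 1) → E8), α z w = α x w := fun z hz => by
        subst hz; exact fun w => rfl
      refine (key ((extChartAt (𝓡 8) x).symm (extChartAt (𝓡 8) x x))
        (extChartAt_to_inv (I := 𝓡 8) x) _).trans (congrArg (α x) ?_)
      have h₂ := mfderivWithin_extChartAt_symm_comp_mfderiv_extChartAt' (I := 𝓡 8)
        (mem_extChartAt_source (I := 𝓡 8) x)
      rw [ModelWithCorners.range_eq_univ, mfderivWithin_univ] at h₂
      funext a
      refine Fin.cases ?_ (fun a => ?_) a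
      · exact congrArg (fun L => L (mlieBracket (𝓡 8) (V i.castSucc) (V j.succ) x)) h₂
      · exact congrArg (fun L => L (V (i.castSucc.succAbove (j.succAbove a)) x)) h₂

/-- A form is differentiable at `x` if its values on vector fields differentiable at `x` are. -/
def FormDiffAt {k : ℕ} (α : Form M k) (x : M) : Prop :=
  ∀ V : Fin k → VField M, (∀ a, DiffAt (V a) x) →
    MDifferentiableAt (𝓡 8) 𝓘(ℝ, ℝ) (fun y => α y (fun a => V a y)) x

/-- A map into a vector space is differentiable if its images under a jointly injective finite
family of functionals are. -/
theorem differentiableAt_of_injective {E F ι : Type*} [NormedAddCommGroup E] [NormedSpace ℝ E]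
    [NormedAddCommGroup F] [NormedSpace ℝ F] [Fintype ι] (L : F →ₗ[ℝ] ι → ℝ)
    (hL : Function.Injective L) {f : E → F} {x : E} (hf : DifferentiableAt ℝ (fun y => L (f y)) x) :
    DifferentiableAt ℝ f x := by
  obtain ⟨G, hG⟩ := L.exists_leftInverse_of_injective (LinearMap.ker_eq_bot.2 hL)
  have h := (LinearMap.toContinuousLinearMap G).differentiableAt.comp x hf
  exact h.congr_of_eventuallyEq (Filter.Eventually.of_forall fun y =>
    (LinearMap.congr_fun hG (f y)).symm)

/-- The coordinate vector field with value `c` in the preferred chart at `x`. -/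
def coordField (x : M) (c : E8) : VField M :=
  mpullback (𝓡 8) 𝓘(ℝ, E8) (extChartAt (𝓡 8) x) fun _ => c

theorem diffAt_coordField (x : M) (c : E8) : DiffAt (coordField x c) x := by
  refine MDifferentiableAt.mpullback_vectorField ?_
    (contMDiffAt_extChartAt (I := 𝓡 8) (n := 2)) (isInvertible_mfderiv_extChartAt (I := 𝓡 8)
    (mem_extChartAt_source (I := 𝓡 8) x)) le_rfl
  exact (contMDiffAt_vectorSpace_iff_contDiffAt (n := 1).2 contDiffAt_const).mdifferentiableAt
    one_ne_zero

theorem coordField_symm (x : M) (c : E8) {y : E8} (hy : y ∈ (extChartAt (𝓡 8) x).target) :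
    coordField x c ((extChartAt (𝓡 8) x).symm y) =
      mfderiv 𝓘(ℝ, E8) (𝓡 8) (extChartAt (𝓡 8) x).symm y c := by
  have h := isInvertible_mfderiv_extChartAt (I := 𝓡 8) ((extChartAt (𝓡 8) x).map_target hy)
  have h₂ := mfderivWithin_extChartAt_symm_comp_mfderiv_extChartAt (I := 𝓡 8) hy
  rw [ModelWithCorners.range_eq_univ, mfderivWithin_univ] at h₂
  have h₃ := congrArg (fun L => L (coordField x c ((extChartAt (𝓡 8) x).symm y))) h₂
  exact h₃.symm.trans (congrArg _ (h.self_apply_inverse c))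

/-- The components of the form in the chart are its values on coordinate fields, and finitely many
components determine an alternating form linearly. -/
theorem FormDiffAt.differentiableAt_chartForm {k : ℕ} {α : Form M k} {x : M}
    (hα : FormDiffAt α x) : DifferentiableAt ℝ (chartForm α x) (extChartAt (𝓡 8) x x) := by
  let b := EuclideanSpace.basisFun (Fin 8) ℝ
  let L : (E8 [⋀^Fin k]→L[ℝ] ℝ) →ₗ[ℝ] ((Fin k → Fin 8) → ℝ) :=
    { toFun := fun β s => β fun a => b (s a)
      map_add' := fun _ _ => rfl
      map_smul' := fun _ _ => rfl }
  have hL : Function.Injective L := fun β γ h =>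
    ContinuousAlternatingMap.toAlternatingMap_injective
      (b.toBasis.ext_alternating fun s _ => by simpa [L] using congrFun h s)
  refine differentiableAt_of_injective L hL (differentiableAt_pi.2 fun s => ?_)
  have h := hα (fun a => coordField x (b (s a))) fun a => diffAt_coordField x _
  have h₃ := mdifferentiableWithinAt_extChartAt_symm (I := 𝓡 8) (mem_extChartAt_target x)
  rw [ModelWithCorners.range_eq_univ, mdifferentiableWithinAt_univ] at h₃
  have h₄ := MDifferentiableAt.comp_of_eq _ (g := fun y => α y fun a => coordField x (b (s a)) y)
    h h₃ (extChartAt_to_inv (I := 𝓡 8) x)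
  refine (mdifferentiableAt_iff_differentiableAt.1 h₄).congr_of_eventuallyEq ?_
  filter_upwards [extChartAt_target_mem_nhds (I := 𝓡 8) x] with y hy
  refine (chartForm_apply α x y _).trans (congrArg _ ?_)
  funext a
  exact (coordField_symm x _ hy).symm

end ExteriorDerivative

/-! ### Adapted frames through the chosen adapted bases -/

section Frame

open VectorField Topology

variable {M : Type*} [TopologicalSpace M] [ChartedSpace E8 M]
  [IsManifold (𝓡 8) ∞ M] [RiemannianBundle (fun x : M => TangentSpace (𝓡 8) x)]

/-- The contraction of a bilinear form does not depend on the orthonormal basis. -/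
theorem sum_bilin_orthonormalBasis {V ι κ : Type*} [NormedAddCommGroup V] [InnerProductSpace ℝ V]
    [Fintype ι] [Fintype κ] (b : OrthonormalBasis ι ℝ V) (c : OrthonormalBasis κ ℝ V)
    (B : V →ₗ[ℝ] V →ₗ[ℝ] ℝ) : ∑ i, B (b i) (b i) = ∑ j, B (c j) (c j) := by
  classical
  have h : ∀ i, B (b i) (b i) = ∑ j, ∑ k, inner ℝ (c j) (b i) * inner ℝ (b i) (c k)
      * B (c j) (c k) := fun i => by
    conv_lhs => rw [← c.sum_repr' (b i)]
    simp only [map_sum, map_smul, LinearMap.sum_apply, LinearMap.smul_apply, smul_eq_mul,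
      Finset.mul_sum]
    rw [Finset.sum_comm]
    refine Finset.sum_congr rfl fun j _ => Finset.sum_congr rfl fun k _ => ?_
    rw [real_inner_comm (c k)]
    ring
  simp only [h]
  rw [Finset.sum_comm]
  refine Finset.sum_congr rfl fun j _ => ?_
  rw [Finset.sum_comm]
  simp only [← Finset.sum_mul, b.sum_inner_mul_inner, c.inner_eq_ite]
  simp

/-- A local frame, orthonormal and adapted to the `Spin(7)`-structure `S` on the open set `U`. -/
structure IsFrame (S : Structure M) (U : Set M) (e : Fin 8 → VField M) : Prop where
  isOpen : IsOpen U
  smooth : ∀ i, SmoothOn (e i) U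
  orthonormal : ∀ y ∈ U, Orthonormal ℝ (fun i => e i y)
  phi : ∀ y ∈ U, ∀ v : Fin 4 → TangentSpace (𝓡 8) y,
    S.Φ y v = stdForm fun a i => inner ℝ (e i y) (v a)

theorem stdForm_inner_single {V : Type*} [NormedAddCommGroup V] [InnerProductSpace ℝ V]
    {b : Fin 8 → V} (hb : Orthonormal ℝ b) (p : Fin 4 → Fin 8) :
    (stdForm fun a i => inner ℝ (b i) (b (p a))) = ph (p 0) (p 1) (p 2) (p 3) := by
  rw [← stdForm_single]
  congr 1
  funext a i
  rw [orthonormal_iff_ite.1 hb i (p a)]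
  have : ![p 0, p 1, p 2, p 3] a = p a := by fin_cases a <;> rfl
  rw [this]
  simp only [eq_comm]

variable {S : Structure M} {U : Set M} {e : Fin 8 → VField M}

theorem Structure.phi_basis (S : Structure M) (x : M) (p : Fin 4 → Fin 8) :
    S.Φ x (fun a => S.basis x (p a)) = ph (p 0) (p 1) (p 2) (p 3) := by
  rw [(S.exists_basis x).choose_spec]
  exact stdForm_inner_single (S.basis x).orthonormal p

namespace IsFrame

/-- The orthonormal basis given by an adapted frame at a point. -/
def basis (he : IsFrame S U e) {y : M} (hy : y ∈ U) :
    OrthonormalBasis (Fin 8) ℝ (TangentSpace (𝓡 8) y) :=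
  OrthonormalBasis.mk (he.orthonormal y hy) (by
    have hc : Fintype.card (Fin 8) = Module.finrank ℝ (TangentSpace (𝓡 8) y) := by
      have : Module.finrank ℝ (TangentSpace (𝓡 8) y) = Module.finrank ℝ E8 := rfl
      rw [this]; simp
    exact ((he.orthonormal y hy).linearIndependent.span_eq_top_of_card_eq_finrank' hc).ge)

variable (he : IsFrame S U e) {y : M} (hy : y ∈ U)
include he hy

theorem basis_apply (i : Fin 8) : he.basis hy i = e i y := by
  simp [basis]

theorem phi_apply (p : Fin 4 → Fin 8) :
    S.Φ y (fun a => e (p a) y) = ph (p 0) (p 1) (p 2) (p 3) := by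
  rw [he.phi y hy]
  exact stdForm_inner_single (he.orthonormal y hy) p

theorem sum_inner_smul (v : TangentSpace (𝓡 8) y) : ∑ i, inner ℝ (e i y) v • e i y = v := by
  simpa only [he.basis_apply hy] using (he.basis hy).sum_repr' v

theorem sum_inner_mul_inner (v w : TangentSpace (𝓡 8) y) :
    ∑ i, inner ℝ v (e i y) * inner ℝ (e i y) w = inner ℝ v w := by
  simpa only [he.basis_apply hy] using (he.basis hy).sum_inner_mul_inner v w

theorem contMDiffAt (i : Fin 8) : ContMDiffAt (𝓡 8) (𝓡 8).tangent ∞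
    (fun z => (⟨z, e i z⟩ : TangentBundle (𝓡 8) M)) y :=
  (he.smooth i).contMDiffAt (he.isOpen.mem_nhds hy)

theorem diffAt (i : Fin 8) : DiffAt (e i) y :=
  (he.contMDiffAt hy i).mdifferentiableAt (by simp)

end IsFrame

/-- Rotating an adapted frame by a constant matrix that fixes the standard form at one point. -/
theorem exists_isFrame (S : Structure M) (x : M) : ∃ (U : Set M) (e : Fin 8 → VField M),
    IsFrame S U e ∧ x ∈ U ∧ ∀ i, e i x = S.basis x i := by
  obtain ⟨U, hU, hx, e, hs, he⟩ := S.exists_frame x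
  have hf : IsFrame S U e := ⟨hU, hs, fun y hy => (he y hy).1, fun y hy => (he y hy).2⟩
  let A : Fin 8 → Fin 8 → ℝ := fun i j => inner ℝ (e j x) (S.basis x i)
  let e' : Fin 8 → VField M := fun i y => ∑ j, A i j • e j y
  have hA : ∀ i k, ∑ j, A i j * A k j = if i = k then 1 else 0 := fun i k => by
    have h := hf.sum_inner_mul_inner hx (S.basis x i) (S.basis x k)
    rw [(S.basis x).inner_eq_ite] at h
    rw [← h]
    exact Finset.sum_congr rfl fun j _ => by rw [real_inner_comm (e j x)]
  have hin : ∀ i y (v : TangentSpace (𝓡 8) y),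
      inner ℝ (e' i y) v = ∑ j, A i j * inner ℝ (e j y) v := fun i y v => by
    simp only [e', sum_inner, inner_smul_left]; simp
  have hx' : ∀ i, e' i x = S.basis x i := fun i => hf.sum_inner_smul hx (S.basis x i)
  -- At x both frames are adapted, so the transition matrix `A` preserves `stdForm` on all vectors.
  -- Being constant, it keeps the frame adapted on the whole of U, and joins the pointwise choice
  -- `S.basis x` to a smooth frame.
  have hstd : ∀ u : Fin 4 → Fin 8 → ℝ, stdForm u = stdForm fun a i => ∑ j, A i j * u a j :=
      fun u => by
    have h₁ := hf.phi x hx fun a => ∑ j, u a j • e j x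
    have h₂ := (S.exists_basis x).choose_spec fun a => ∑ j, u a j • e j x
    have h₃ : ∀ a i, inner ℝ (e i x) (∑ j, u a j • e j x) = u a i := fun a i => by
      simp [inner_sum, inner_smul_right, orthonormal_iff_ite.1 (hf.orthonormal x hx)]
    have h₄ : ∀ a i, inner ℝ (S.basis x i) (∑ j, u a j • e j x) = ∑ j, A i j * u a j :=
      fun a i => by rw [← hx', hin]; simp only [h₃]
    simp only [h₃] at h₁
    rw [← h₁, h₂]
    congr 1
    funext a i
    exact h₄ a i
  refine ⟨U, e', ⟨hU, fun i => ?_, fun y hy => ?_, fun y hy v => ?_⟩, hx, hx'⟩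
  · exact ContMDiffOn.sum_section fun j _ => ContMDiffOn.const_smul_section (hs j)
  · rw [orthonormal_iff_ite]
    intro i k
    rw [hin, ← hA]
    refine Finset.sum_congr rfl fun j _ => ?_
    congr 1
    rw [real_inner_comm, hin]
    simp [orthonormal_iff_ite.1 (hf.orthonormal y hy)]
  · rw [hf.phi y hy, hstd]
    simp only [hin]

end Frame

/-! ### Directional derivatives, brackets and covariant derivatives of local fields -/

section LocalCalculus

open VectorField Topology

variable {M : Type*} [TopologicalSpace M] [ChartedSpace E8 M]
  [IsManifold (𝓡 8) ∞ M]

/-- The derivative of the function `f` at `x` in the direction `v`. -/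
def dir (f : M → ℝ) (x : M) (v : TangentSpace (𝓡 8) x) : ℝ :=
  mvfderiv (𝓡 8) f x v

/-- Differentiability of a real function. -/
abbrev FunDiffAt (f : M → ℝ) (x : M) : Prop := MDifferentiableAt (𝓡 8) 𝓘(ℝ, ℝ) f x

section
variable {f g : M → ℝ} {x : M} {v : TangentSpace (𝓡 8) x}

theorem dir_congr (h : f =ᶠ[𝓝 x] g) : dir f x v = dir g x v := by
  have h₁ := h.mfderiv_eq (I := 𝓡 8) (I' := 𝓘(ℝ, ℝ))
  exact congrArg (fun L : E8 →L[ℝ] ℝ => L v) h₁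

theorem dir_const (r : ℝ) : dir (fun _ : M => r) x v = 0 := by
  simp [dir, mvfderiv_const]

theorem dir_add (hf : FunDiffAt f x) (hg : FunDiffAt g x) :
    dir (fun y => f y + g y) x v = dir f x v + dir g x v := by
  simp [dir, mvfderiv_fun_add hf hg]

theorem dir_sub (hf : FunDiffAt f x) (hg : FunDiffAt g x) :
    dir (fun y => f y - g y) x v = dir f x v - dir g x v := by
  simp [dir, mvfderiv_fun_sub hf hg]

theorem dir_neg : dir (fun y => -f y) x v = -dir f x v := by
  simp [dir, mvfderiv_fun_neg]

theorem dir_mul (hf : FunDiffAt f x) (hg : FunDiffAt g x) :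
    dir (fun y => f y * g y) x v = f x * dir g x v + g x * dir f x v := by
  simp [dir, mvfderiv_fun_mul hf hg]

theorem FunDiffAt.const (r : ℝ) : FunDiffAt (fun _ : M => r) x := mdifferentiableAt_const

theorem FunDiffAt.mul (hf : FunDiffAt f x) (hg : FunDiffAt g x) :
    FunDiffAt (fun y => f y * g y) x := MDifferentiableAt.mul hf hg

theorem FunDiffAt.add (hf : FunDiffAt f x) (hg : FunDiffAt g x) :
    FunDiffAt (fun y => f y + g y) x := MDifferentiableAt.add hf hg

theorem FunDiffAt.sub (hf : FunDiffAt f x) (hg : FunDiffAt g x) :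
    FunDiffAt (fun y => f y - g y) x := MDifferentiableAt.sub hf hg

theorem FunDiffAt.sum {ι : Type*} {s : Finset ι} {f : ι → M → ℝ}
    (h : ∀ i ∈ s, FunDiffAt (f i) x) : FunDiffAt (fun y => ∑ i ∈ s, f i y) x := by
  classical
  induction s using Finset.induction_on with
  | empty => simpa using FunDiffAt.const 0
  | insert a s ha ih =>
    simp only [Finset.sum_insert ha]
    exact (h a (Finset.mem_insert_self a s)).add
      (ih fun i hi => h i (Finset.mem_insert_of_mem hi))

theorem FunDiffAt.prod {ι : Type*} {s : Finset ι} {f : ι → M → ℝ}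
    (h : ∀ i ∈ s, FunDiffAt (f i) x) : FunDiffAt (fun y => ∏ i ∈ s, f i y) x := by
  classical
  induction s using Finset.induction_on with
  | empty => simpa using FunDiffAt.const 1
  | insert a s ha ih =>
    simp only [Finset.prod_insert ha]
    exact (h a (Finset.mem_insert_self a s)).mul
      (ih fun i hi => h i (Finset.mem_insert_of_mem hi))

theorem dir_sum {ι : Type*} {s : Finset ι} {f : ι → M → ℝ} (h : ∀ i ∈ s, FunDiffAt (f i) x) :
    dir (fun y => ∑ i ∈ s, f i y) x v = ∑ i ∈ s, dir (f i) x v := by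
  classical
  induction s using Finset.induction_on with
  | empty => simp [dir_const]
  | insert a s ha ih =>
    simp only [Finset.sum_insert ha]
    rw [dir_add (h a (Finset.mem_insert_self a s))
      (FunDiffAt.sum fun i hi => h i (Finset.mem_insert_of_mem hi)),
      ih fun i hi => h i (Finset.mem_insert_of_mem hi)]

theorem dir_sum_smul {ι : Type*} (s : Finset ι) (k : ι → ℝ) (w : ι → TangentSpace (𝓡 8) x) :
    dir f x (∑ i ∈ s, k i • w i) = ∑ i ∈ s, k i * dir f x (w i) := by
  unfold dir
  rw [map_sum]
  simp only [map_smul, smul_eq_mul]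

end

theorem SmoothOn.diffAt {X : VField M} {U : Set M} (hX : SmoothOn X U) (hU : IsOpen U) {x : M}
    (hx : x ∈ U) : DiffAt X x :=
  (ContMDiffOn.contMDiffAt hX (hU.mem_nhds hx)).mdifferentiableAt (by simp)

theorem SmoothOn.bracket {X Y : VField M} {U : Set M} (hU : IsOpen U) (hX : SmoothOn X U)
    (hY : SmoothOn Y U) : SmoothOn (mlieBracket (𝓡 8) X Y) U := fun x hx =>
  (ContMDiffAt.mlieBracket_vectorField (m := ⊤) (n := ⊤)
    (ContMDiffOn.contMDiffAt hX (hU.mem_nhds hx)) (ContMDiffOn.contMDiffAt hY (hU.mem_nhds hx))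
    (by simp)).contMDiffWithinAt

/-- A vector field that is smooth near a point agrees there with a globally smooth one. -/
theorem exists_contMDiff_eventuallyEq [T2Space M] {X : VField M} {U : Set M} (hU : IsOpen U)
    (hX : SmoothOn X U) {x : M} (hx : x ∈ U) : ∃ Y : VField M,
      ContMDiff (𝓡 8) (𝓡 8).tangent ∞ (fun y => (⟨y, Y y⟩ : TangentBundle (𝓡 8) M)) ∧
      ∀ᶠ y in 𝓝 x, X y = Y y := by
  obtain ⟨f, hf, -⟩ := (SmoothBumpFunction.nhds_basis_support (I := 𝓡 8)
    (hU.mem_nhds hx)).mem_iff.1 (hU.mem_nhds hx)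
  refine ⟨fun y => f y • X y, ContMDiffOn.smul_section_of_tsupport f.contMDiff.contMDiffOn hU hf
    hX, ?_⟩
  filter_upwards [f.eventuallyEq_one] with y hy
  rw [hy]
  simp

/-- Smoothness of the connection is applied to a globally smooth field obtained by a bump function;
∇ is local, so the result passes back to the field on U. -/
theorem SmoothOn.contMDiffAt_cov [T2Space M] {D : Connection M}
    (hD : CovariantDerivative.ContMDiffCovariantDerivative D ∞) {Y : VField M} {U : Set M}
    (hU : IsOpen U) (hY : SmoothOn Y U) {x : M} (hx : x ∈ U) :
    ContMDiffAt (𝓡 8) ((𝓡 8).prod 𝓘(ℝ, E8 →L[ℝ] E8)) ∞ (fun y => TotalSpace.mk' (E8 →L[ℝ] E8)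
      (E := fun y : M => TangentSpace (𝓡 8) y →L[ℝ] TangentSpace (𝓡 8) y) y (D Y y)) x := by
  obtain ⟨Z, hZ, hYZ⟩ := exists_contMDiff_eventuallyEq hU hY hx
  have h₁ := (hD.contMDiff.contMDiff (σ := Z) (by simpa using hZ.contMDiffOn)).contMDiffAt
    (x := x) Filter.univ_mem
  refine h₁.congr_of_eventuallyEq ?_
  filter_upwards [hYZ.eventually_nhds, hU.mem_nhds hx] with y hy hyU
  have h₃ := D.isCovariantDerivativeOn.congr_of_eventuallyEq (s := Set.univ) (hY.diffAt hU hyU)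
    (hZ.contMDiffAt.mdifferentiableAt (by simp)) Filter.univ_mem hy
  simp only [h₃]

theorem SmoothOn.cov [T2Space M] {D : Connection M}
    (hD : CovariantDerivative.ContMDiffCovariantDerivative D ∞) {X Y : VField M} {U : Set M}
    (hU : IsOpen U) (hX : SmoothOn X U) (hY : SmoothOn Y U) :
    SmoothOn (fun y => D Y y (X y)) U := fun _ hx =>
  ((SmoothOn.contMDiffAt_cov hD hU hY hx).clm_bundle_apply
    (ContMDiffOn.contMDiffAt hX (hU.mem_nhds hx))).contMDiffWithinAt

theorem SmoothOn.diffAt_cov [T2Space M] {D : Connection M}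
    (hD : CovariantDerivative.ContMDiffCovariantDerivative D ∞) {X Y : VField M} {U : Set M}
    (hU : IsOpen U) (hY : SmoothOn Y U) {x : M} (hx : x ∈ U) (hX : DiffAt X x) :
    DiffAt (fun y => D Y y (X y)) x :=
  ((SmoothOn.contMDiffAt_cov hD hU hY hx).mdifferentiableAt (by simp)).clm_bundle_apply hX

/-- The Lie bracket is the commutator of the derivations. -/
theorem dir_bracket {X Y Z : VField M} {f : M → ℝ} {U : Set M} (hU : IsOpen U) (hX : SmoothOn X U)
    (hY : SmoothOn Y U) (hZ : SmoothOn Z U)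
    (hf : ContMDiffOn (𝓡 8) 𝓘(ℝ, ℝ) ∞ f U) {x : M} (hx : x ∈ U) (hZx : Z x ≠ 0)
    (hXf : FunDiffAt (fun y => dir f y (X y)) x) (hYf : FunDiffAt (fun y => dir f y (Y y)) x) :
    dir (fun y => dir f y (Y y)) x (X x) - dir (fun y => dir f y (X y)) x (Y x) =
      dir f x (mlieBracket (𝓡 8) X Y x) := by
  have hsm : ∀ {W : VField M}, SmoothOn W U → ContMDiffAt (𝓡 8) (𝓡 8).tangent
      (minSmoothness ℝ 2) (fun y => (⟨y, W y⟩ : TangentBundle (𝓡 8) M)) x := fun {W} hW =>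
    (ContMDiffOn.contMDiffAt hW (hU.mem_nhds hx)).of_le
      (by rw [minSmoothness_of_isRCLikeNormedField]; norm_cast)
  have hfd : ∀ y ∈ U, FunDiffAt f y := fun y hy =>
    (ContMDiffOn.contMDiffAt hf (hU.mem_nhds hy)).mdifferentiableAt (by simp)
  have hfZ : SmoothOn (f • Z) U := ContMDiffOn.smul_section hf hZ
  have inner : ∀ {V W : VField M}, SmoothOn V U → SmoothOn W U →
      FunDiffAt (fun y => dir f y (W y)) x →
      mlieBracket (𝓡 8) V (mlieBracket (𝓡 8) W (f • Z)) x =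
        dir (fun y => dir f y (W y)) x (V x) • Z x + dir f x (W x) • mlieBracket (𝓡 8) V Z x
        + (dir f x (V x) • mlieBracket (𝓡 8) W Z x
          + f x • mlieBracket (𝓡 8) V (mlieBracket (𝓡 8) W Z) x) := by
    intro V W hV hW hd
    have e : mlieBracket (𝓡 8) W (f • Z) =ᶠ[𝓝 x]
        ((fun y => dir f y (W y)) • Z + f • mlieBracket (𝓡 8) W Z) := by
      filter_upwards [hU.mem_nhds hx] with y hy
      exact mlieBracket_smul_right (hfd y hy) (hZ.diffAt hU hy)
    have hWZ := (SmoothOn.bracket hU hW hZ).diffAt hU hx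
    rw [(Filter.EventuallyEq.refl (𝓝 x) V).mlieBracket_vectorField_eq e,
      mlieBracket_add_right (MDifferentiableAt.smul_section hd (hZ.diffAt hU hx))
        (MDifferentiableAt.smul_section (hfd x hx) hWZ),
      mlieBracket_smul_right hd (hZ.diffAt hU hx), mlieBracket_smul_right (hfd x hx) hWZ]
    rfl
  -- The Jacobi identities for X, Y, fZ and for X, Y, Z are compared: what survives is the desired
  -- identity times Z x, which is nonzero.
  have j₁ := leibniz_identity_mlieBracket_apply (hsm hX) (hsm hY) (hsm hfZ)
  have j₂ := leibniz_identity_mlieBracket_apply (hsm hX) (hsm hY) (hsm hZ)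
  rw [inner hX hY hYf, inner hY hX hXf, mlieBracket_smul_right (hfd x hx) (hZ.diffAt hU hx),
    j₂] at j₁
  have h : (dir (fun y => dir f y (Y y)) x (X x) - dir (fun y => dir f y (X y)) x (Y x)
      - dir f x (mlieBracket (𝓡 8) X Y x)) • Z x = 0 := by
    change _ = dir f x (mlieBracket (𝓡 8) X Y x) • Z x + _ + _ at j₁
    rw [sub_smul, sub_smul, sub_sub, sub_eq_zero]
    rw [← sub_eq_zero] at j₁ ⊢
    rw [← j₁]
    module
  exact sub_eq_zero.1 ((smul_eq_zero.1 h).resolve_right hZx)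

end LocalCalculus

/-! ### Connection, torsion and bracket in an adapted frame -/

section FrameGeometry

open VectorField Topology

variable {M : Type*} [TopologicalSpace M] [T2Space M] [ChartedSpace E8 M]
  [IsManifold (𝓡 8) ∞ M] [RiemannianBundle (fun x : M => TangentSpace (𝓡 8) x)]
  [IsContMDiffRiemannianBundle (𝓡 8) ∞ E8 (fun x : M => TangentSpace (𝓡 8) x)]
  {S : Structure M} {D : Connection M} {T : Form M 3} {U : Set M} {e : Fin 8 → VField M}

/-- The connection coefficients `g(∇_{e_i} e_j, e_k)`. -/
def conn (D : Connection M) (e : Fin 8 → VField M) (i j k : Fin 8) (y : M) : ℝ :=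
  inner ℝ (D (e j) y (e i y)) (e k y)

/-- The structure functions `g([e_i, e_j], e_k)`. -/
def brack (e : Fin 8 → VField M)
    (i j k : Fin 8) (y : M) : ℝ :=
  inner ℝ (mlieBracket (𝓡 8) (e i) (e j) y) (e k y)

/-- The components of a 3-form. -/
def comp₃ (T : Form M 3) (e : Fin 8 → VField M) (i j k : Fin 8) (y : M) : ℝ :=
  T y ![e i y, e j y, e k y]

theorem skew_of_form {V : Type*} [NormedAddCommGroup V] [InnerProductSpace ℝ V]
    (α : V [⋀^Fin 3]→L[ℝ] ℝ) (b : Fin 8 → V) : Skew fun i j k => α ![b i, b j, b k] where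
  swap₁₂ i j k := by
    have h := α.map_swap ![b i, b j, b k] (i := 0) (j := 1) (by decide)
    refine Eq.trans (congrArg α ?_) h
    funext a
    fin_cases a <;> rfl
  swap₂₃ i j k := by
    have h := α.map_swap ![b i, b j, b k] (i := 1) (j := 2) (by decide)
    refine Eq.trans (congrArg α ?_) h
    funext a
    fin_cases a <;> rfl

theorem SmoothOn.funDiffAt_inner {X Y : VField M} (hU : IsOpen U) (hX : SmoothOn X U) (hY : SmoothOn Y U)
    {y : M} (hy : y ∈ U) : FunDiffAt (fun z => inner ℝ (X z) (Y z)) y :=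
  MDifferentiableAt.inner_bundle (hX.diffAt hU hy) (hY.diffAt hU hy)

theorem DiffAt.funDiffAt_inner {X Y : VField M} {y : M} (hX : DiffAt X y) (hY : DiffAt Y y) :
    FunDiffAt (fun z => inner ℝ (X z) (Y z)) y :=
  MDifferentiableAt.inner_bundle hX hY

theorem dir_inner (hD : D.IsMetricCompatible) {X Y : VField M} {x : M} (hX : DiffAt X x)
    (hY : DiffAt Y x) (v : TangentSpace (𝓡 8) x) :
    dir (fun y => inner ℝ (X y) (Y y)) x v = inner ℝ (D X x v) (Y x) + inner ℝ (X x) (D Y x v) := by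
  have h := hD.mvfderiv_inner_eq (FiberBundle.extend E8 v) hX hY
  simp only [FiberBundle.extend_apply_self] at h
  exact h

theorem SmoothOn.contMDiffOn_inner {X Y : VField M} (hX : SmoothOn X U) (hY : SmoothOn Y U) :
    ContMDiffOn (𝓡 8) 𝓘(ℝ, ℝ) ∞ (fun z => inner ℝ (X z) (Y z)) U :=
  ContMDiffOn.inner_bundle hX hY

variable (hD : S.IsTorsionConnection D T) (he : IsFrame S U e) {y : M} (hy : y ∈ U)

include he hy

theorem sum_inner_mul (v w : TangentSpace (𝓡 8) y) :
    inner ℝ v w = ∑ s, inner ℝ v (e s y) * inner ℝ w (e s y) := by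
  rw [← he.sum_inner_mul_inner hy v w]
  exact Finset.sum_congr rfl fun s _ => by rw [real_inner_comm w]

theorem diffAt_brack (i j k : Fin 8) : FunDiffAt (brack e i j k) y :=
  SmoothOn.funDiffAt_inner he.isOpen (SmoothOn.bracket he.isOpen (he.smooth i) (he.smooth j)) (he.smooth k) hy

theorem eventually_of_frame {p : M → Prop} (h : ∀ z ∈ U, p z) : ∀ᶠ z in 𝓝 y, p z :=
  Filter.mem_of_superset (he.isOpen.mem_nhds hy) h

omit he hy in
theorem brack_swap (i j k : Fin 8) (y : M) : brack e j i k y = -brack e i j k y := by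
  unfold brack
  rw [mlieBracket_swap_apply, inner_neg_left]

include hD

theorem diffAt_conn (i j k : Fin 8) : FunDiffAt (conn D e i j k) y :=
  SmoothOn.funDiffAt_inner he.isOpen (SmoothOn.cov hD.smooth he.isOpen (he.smooth i) (he.smooth j))
    (he.smooth k) hy

theorem conn_skew (i j k : Fin 8) : conn D e i k j y = -conn D e i j k y := by
  have h := dir_inner hD.metric (he.diffAt hy j) (he.diffAt hy k) (e i y)
  have h₂ : dir (fun z => inner ℝ (e j z) (e k z)) y (e i y) = 0 := by
    rw [dir_congr (g := fun _ => if j = k then 1 else 0), dir_const]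
    exact eventually_of_frame he hy fun z hz => orthonormal_iff_ite.1 (he.orthonormal z hz) j k
  rw [h₂, real_inner_comm _ (e j y)] at h
  simp only [conn]
  linarith

theorem comp₃_torsion (i j k : Fin 8) :
    comp₃ T e i j k y = conn D e i j k y - conn D e j i k y - brack e i j k y := by
  unfold comp₃
  rw [← hD.torsion, D.torsion_apply (he.diffAt hy i) (he.diffAt hy j), inner_sub_left,
    inner_sub_left]
  rfl

theorem diffAt_comp₃ (i j k : Fin 8) : FunDiffAt (comp₃ T e i j k) y := by
  refine MDifferentiableAt.congr_of_eventuallyEq ((((diffAt_conn hD he hy i j k).sub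
    (diffAt_conn hD he hy j i k)).sub (diffAt_brack he hy i j k))) ?_
  exact eventually_of_frame he hy fun z hz => comp₃_torsion hD he hz i j k

/-- Φ has constant components in an adapted frame, so ∇Φ = 0 reduces to its algebraic part: the
connection matrices lie in spin(7). -/
theorem phAct_conn (i a b c d : Fin 8) : phAct (fun j k => conn D e i j k y) a b c d = 0 := by
  have h := hD.parallel y (e i y) (fun t => e (![a, b, c, d] t)) fun t => he.diffAt hy _
  have h₁ : mvfderiv (𝓡 8) (fun z => S.Φ z fun t => e (![a, b, c, d] t) z) y (e i y) = 0 := by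
    refine (dir_congr (g := fun _ => ph a b c d) ?_).trans (dir_const _)
    exact eventually_of_frame he hy fun z hz => he.phi_apply hz _
  have h₂ : ∀ t : Fin 4, S.Φ y (Function.update (fun c' => e (![a, b, c, d] c') y) t
      (D (e (![a, b, c, d] t)) y (e i y))) = ∑ s, conn D e i (![a, b, c, d] t) s y *
        S.Φ y (fun t' => e (Function.update ![a, b, c, d] t s t') y) := fun t => by
    rw [← he.sum_inner_smul hy (D (e (![a, b, c, d] t)) y (e i y))]
    refine ((S.Φ y).toMultilinearMap.map_update_sum _ _ _ _).trans
      (Finset.sum_congr rfl fun s _ => ?_)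
    change S.Φ y _ = _
    rw [ContinuousAlternatingMap.map_update_smul, smul_eq_mul, real_inner_comm]
    congr 2
    funext t'
    by_cases h : t' = t
    · subst h; simp
    · simp [h]
  rw [nablaForm, h₁, zero_sub, neg_eq_zero, Fin.sum_univ_four] at h
  simp only [h₂, he.phi_apply hy] at h
  rw [phAct, ← h]
  simp only [Finset.sum_add_distrib]
  rfl

theorem dir_conn_skew (p : TangentSpace (𝓡 8) y) (i j k : Fin 8) :
    dir (conn D e i k j) y p = -dir (conn D e i j k) y p := by
  rw [← dir_neg]
  exact dir_congr (eventually_of_frame he hy fun z hz => conn_skew hD he hz i j k)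

/-- Derivative of `phAct_conn`, a linear relation with constant coefficients holding on all of U. -/
theorem phAct_dir_conn (p : TangentSpace (𝓡 8) y) (i a b c d : Fin 8) :
    phAct (fun j k => dir (conn D e i j k) y p) a b c d = 0 := by
  have h : dir (fun z => phAct (fun j k => conn D e i j k z) a b c d) y p = 0 := by
    rw [dir_congr (g := fun _ => 0), dir_const]
    exact eventually_of_frame he hy fun z hz => phAct_conn hD he hz i a b c d
  have hm : ∀ j k (r : ℝ), FunDiffAt (fun z => conn D e i j k z * r) y := fun j k r =>
    (diffAt_conn hD he hy i j k).mul (FunDiffAt.const r)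
  have hd : ∀ j k (r : ℝ), dir (fun z => conn D e i j k z * r) y p = dir (conn D e i j k) y p * r :=
    fun j k r => by
      rw [dir_mul (diffAt_conn hD he hy i j k) (FunDiffAt.const r), dir_const]; ring
  rw [← h]
  unfold phAct
  rw [dir_sum fun s _ => (((hm a s _).add (hm b s _)).add (hm c s _)).add (hm d s _)]
  refine Finset.sum_congr rfl fun s _ => ?_
  rw [dir_add (((hm a s _).add (hm b s _)).add (hm c s _)) (hm d s _),
    dir_add ((hm a s _).add (hm b s _)) (hm c s _), dir_add (hm a s _) (hm b s _), hd, hd, hd, hd]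

theorem dir_comp₃ (p : TangentSpace (𝓡 8) y) (i j k : Fin 8) :
    dir (comp₃ T e i j k) y p =
      dir (conn D e i j k) y p - dir (conn D e j i k) y p - dir (brack e i j k) y p := by
  rw [← dir_sub (diffAt_conn hD he hy i j k) (diffAt_conn hD he hy j i k),
    ← dir_sub ((diffAt_conn hD he hy i j k).sub (diffAt_conn hD he hy j i k))
      (diffAt_brack he hy i j k)]
  exact dir_congr (eventually_of_frame he hy fun z hz => comp₃_torsion hD he hz i j k)

omit he hy hD in
theorem skew_comp₃ (y : M) : Skew fun i j k => comp₃ T e i j k y :=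
  skew_of_form (T y) fun i => e i y

omit he hy hD in
theorem skew_dir_comp₃ {y : M} (p : TangentSpace (𝓡 8) y) :
    Skew fun i j k => dir (comp₃ T e i j k) y p where
  swap₁₂ i j k := by
    rw [← dir_neg]
    exact congrArg (fun f => dir f y p) (funext fun z => (skew_comp₃ z).swap₁₂ i j k)
  swap₂₃ i j k := by
    rw [← dir_neg]
    exact congrArg (fun f => dir f y p) (funext fun z => (skew_comp₃ z).swap₂₃ i j k)

/-- With B = [e_j, e_k], the torsion gives [e_i, B] = ∇_{e_i}B - ∇_B e_i - T(e_i, B). After B is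
expanded in the frame, the connection coefficients cancel. -/
theorem inner_bracket_bracket (i j k l : Fin 8) :
    inner ℝ (mlieBracket (𝓡 8) (e i) (mlieBracket (𝓡 8) (e j) (e k)) y) (e l y) =
      dir (brack e j k l) y (e i y) + ∑ s, brack e j k s y * brack e i s l y := by
  set B := mlieBracket (𝓡 8) (e j) (e k) with hB
  have hBd : DiffAt B y :=
    (SmoothOn.bracket he.isOpen (he.smooth j) (he.smooth k)).diffAt he.isOpen hy
  have h := congrArg (fun v => inner ℝ v (e l y)) (D.torsion_apply (he.diffAt hy i) hBd)
  simp only [inner_sub_left] at h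
  have h₁ := dir_inner hD.metric hBd (he.diffAt hy l) (e i y)
  rw [sum_inner_mul he hy (B y)] at h₁
  have hBy : B y = ∑ s, brack e j k s y • e s y := by
    conv_lhs => rw [← he.sum_inner_smul hy (B y)]
    exact Finset.sum_congr rfl fun s _ => by rw [real_inner_comm]; rfl
  have h₂ : inner ℝ (D (e i) y (B y)) (e l y) = ∑ s, brack e j k s y * conn D e s i l y := by
    rw [hBy, map_sum, sum_inner]
    exact Finset.sum_congr rfl fun s _ => by rw [map_smul, real_inner_smul_left]; rfl
  have h₃ : inner ℝ (D.torsion y (e i y) (B y)) (e l y) =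
      ∑ s, brack e j k s y * comp₃ T e i s l y := by
    rw [hBy, map_sum, sum_inner]
    exact Finset.sum_congr rfl fun s _ => by
      rw [map_smul, real_inner_smul_left, hD.torsion]; rfl
  have h₄ : ∑ s, brack e j k s y * comp₃ T e i s l y = - ∑ s, brack e j k s y * conn D e i l s y
      - ∑ s, brack e j k s y * conn D e s i l y - ∑ s, brack e j k s y * brack e i s l y := by
    rw [← Finset.sum_neg_distrib, ← Finset.sum_sub_distrib, ← Finset.sum_sub_distrib]
    refine Finset.sum_congr rfl fun s _ => ?_
    rw [comp₃_torsion hD he hy, conn_skew hD he hy i s l]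
    ring
  change dir (brack e j k l) y (e i y) = _ + ∑ s, brack e j k s y * conn D e i l s y at h₁
  linarith

theorem jacobi (i j k l : Fin 8) :
    dir (brack e j k l) y (e i y) + dir (brack e k i l) y (e j y) + dir (brack e i j l) y (e k y)
      + ∑ s, (brack e j k s y * brack e i s l y + brack e k i s y * brack e j s l y
        + brack e i j s y * brack e k s l y) = 0 := by
  have hsm : ∀ i, ContMDiffAt (𝓡 8) (𝓡 8).tangent
      (minSmoothness ℝ 2) (fun y => (⟨y, e i y⟩ : TangentBundle (𝓡 8) M)) y := fun i =>
    (he.contMDiffAt hy i).of_le (by rw [minSmoothness_of_isRCLikeNormedField]; norm_cast)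
  have h := congrArg (fun v => inner ℝ v (e l y))
    (leibniz_identity_mlieBracket_apply (hsm i) (hsm j) (hsm k))
  rw [mlieBracket_swap_apply (V := mlieBracket (𝓡 8) (e i) (e j))] at h
  simp only [inner_add_left, inner_neg_left, inner_bracket_bracket hD he hy] at h
  have h₁ : dir (brack e i k l) y (e j y) = -dir (brack e k i l) y (e j y) := by
    rw [← dir_neg]
    exact congrArg (fun f => dir f y (e j y)) (funext fun z => brack_swap k i l z)
  have h₂ : ∑ s, brack e i k s y * brack e j s l y = -∑ s, brack e k i s y * brack e j s l y := by
    rw [← Finset.sum_neg_distrib]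
    exact Finset.sum_congr rfl fun s _ => by rw [brack_swap k i s]; ring
  rw [h₁, h₂] at h
  simp only [Finset.sum_add_distrib]
  linarith

theorem inner_cov_cov (i j k l : Fin 8) :
    inner ℝ (D (fun z => D (e k) z (e j z)) y (e i y)) (e l y) =
      dir (conn D e j k l) y (e i y) + ∑ s, conn D e j k s y * conn D e i s l y := by
  have hX : DiffAt (fun z => D (e k) z (e j z)) y :=
    (SmoothOn.cov hD.smooth he.isOpen (he.smooth j) (he.smooth k)).diffAt he.isOpen hy
  have h := dir_inner hD.metric hX (he.diffAt hy l) (e i y)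
  rw [sum_inner_mul he hy (D (e k) y (e j y))] at h
  have h₁ : ∑ s, conn D e j k s y * conn D e i s l y =
      -∑ s, conn D e j k s y * conn D e i l s y := by
    rw [← Finset.sum_neg_distrib]
    exact Finset.sum_congr rfl fun s _ => by rw [conn_skew hD he hy i l s]; ring
  change dir (conn D e j k l) y (e i y) = _ + ∑ s, conn D e j k s y * conn D e i l s y at h
  linarith

theorem inner_curv (i j k l : Fin 8) :
    inner ℝ (curv D (e i) (e j) (e k) y) (e l y) =
      frameCurv (fun i j k => conn D e i j k y) (fun i j k => brack e i j k y)
        (fun p i j k => dir (conn D e i j k) y (e p y)) i j k l := by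
  have h : inner ℝ (D (e k) y (mlieBracket (𝓡 8) (e i) (e j) y)) (e l y) =
      ∑ s, brack e i j s y * conn D e s k l y := by
    conv_lhs => rw [← he.sum_inner_smul hy (mlieBracket (𝓡 8) (e i) (e j) y)]
    rw [map_sum, sum_inner]
    exact Finset.sum_congr rfl fun s _ => by
      rw [map_smul, real_inner_smul_left, real_inner_comm]; rfl
  simp only [curv, inner_sub_left, inner_cov_cov hD he hy, h, frameCurv, Finset.sum_sub_distrib]
  ring

end FrameGeometry

/-! ### Tensoriality of the curvature, and the Ricci tensor in a frame -/

section Curvature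

open VectorField Topology

variable {M : Type*} [TopologicalSpace M] [T2Space M] [ChartedSpace E8 M]
  [IsManifold (𝓡 8) ∞ M] [RiemannianBundle (fun x : M => TangentSpace (𝓡 8) x)]
  [IsContMDiffRiemannianBundle (𝓡 8) ∞ E8 (fun x : M => TangentSpace (𝓡 8) x)]
  {S : Structure M} {D : Connection M} {T : Form M 3} {U : Set M} {e : Fin 8 → VField M}

theorem exists_smoothOn_extend (x : M) (v : TangentSpace (𝓡 8) x) :
    ∃ U : Set M, IsOpen U ∧ x ∈ U ∧ SmoothOn (FiberBundle.extend E8 v : VField M) U := by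
  obtain ⟨s, hs, h⟩ := FiberBundle.exists_contMDiffOn_extend (k := ∞) (𝓡 8) E8 v
  exact ⟨interior s, isOpen_interior, mem_interior_iff_mem_nhds.2 hs, h.mono interior_subset⟩

theorem IsFrame.mono {V : Set M} (he : IsFrame S U e) (hV : IsOpen V) (hVU : V ⊆ U) :
    IsFrame S V e :=
  ⟨hV, fun i => (he.smooth i).mono hVU, fun y hy => he.orthonormal y (hVU hy),
    fun y hy => he.phi y (hVU hy)⟩

theorem curv_swap (D : Connection M) (X Y Z : VField M) (x : M) :
    curv D Y X Z x = -curv D X Y Z x := by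
  simp only [curv]
  rw [mlieBracket_swap_apply, map_neg]
  abel

theorem tensorialAt_curv (hD : CovariantDerivative.ContMDiffCovariantDerivative D ∞)
    (hU : IsOpen U) {Y Z : VField M} (hZ : SmoothOn Z U) {x : M}
    (hx : x ∈ U) : TensorialAt (𝓡 8) E8 (fun X => curv D X Y Z x) x where
  smul {f X} hf hX := by
    have hW := SmoothOn.diffAt_cov hD hU hZ hx hX
    have e : (fun y => D Z y ((f • X) y)) = f • fun y => D Z y (X y) := by
      funext y
      simp
    simp only [curv]
    rw [e, D.isCovariantDerivativeOn.leibniz (s := Set.univ) hW hf trivial,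
      mlieBracket_smul_left hf hX]
    simp
    module
  add {X X'} hX hX' := by
    have e : (fun y => D Z y ((X + X') y)) = (fun y => D Z y (X y)) + fun y => D Z y (X' y) := by
      funext y
      simp
    simp only [curv]
    rw [e, D.isCovariantDerivativeOn.add (s := Set.univ) (SmoothOn.diffAt_cov hD hU hZ hx hX)
      (SmoothOn.diffAt_cov hD hU hZ hx hX') trivial, mlieBracket_add_left hX hX']
    simp
    module

variable (hD : S.IsTorsionConnection D T) (he : IsFrame S U e) {x : M} (hx : x ∈ U)

include hD he hx

/-- Apply the commutator of X and Y to the function g(Z, W) and expand by metric compatibility. It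
also serves for tensoriality in Z: after the swap only the value of Z at x occurs. -/
theorem inner_curv_swap {X Y Z W : VField M} (hX : SmoothOn X U) (hY : SmoothOn Y U)
    (hZ : SmoothOn Z U) (hW : SmoothOn W U) :
    inner ℝ (curv D X Y Z x) (W x) = -inner ℝ (Z x) (curv D X Y W x) := by
  have hU := he.isOpen
  have hc : ∀ {V V' : VField M}, SmoothOn V U → SmoothOn V' U →
      SmoothOn (fun y => D V' y (V y)) U := fun hV hV' => SmoothOn.cov hD.smooth hU hV hV'
  have h₁ : ∀ {V : VField M}, SmoothOn V U →
      (fun y => dir (fun z => inner ℝ (Z z) (W z)) y (V y)) =ᶠ[𝓝 x]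
        fun y => inner ℝ (D Z y (V y)) (W y) + inner ℝ (Z y) (D W y (V y)) := fun hV =>
    eventually_of_frame he hx fun y hy =>
      dir_inner hD.metric (hZ.diffAt hU hy) (hW.diffAt hU hy) _
  have hd : ∀ {V : VField M}, SmoothOn V U →
      FunDiffAt (fun y => dir (fun z => inner ℝ (Z z) (W z)) y (V y)) x := fun {V} hV =>
    MDifferentiableAt.congr_of_eventuallyEq ((SmoothOn.funDiffAt_inner hU (hc hV hZ) hW hx).add
      (SmoothOn.funDiffAt_inner hU hZ (hc hV hW) hx)) (h₁ hV)
  have h₂ : ∀ {V V' : VField M}, SmoothOn V U → SmoothOn V' U →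
      dir (fun y => dir (fun z => inner ℝ (Z z) (W z)) y (V y)) x (V' x) =
        inner ℝ (D (fun y => D Z y (V y)) x (V' x)) (W x)
        + inner ℝ (D Z x (V x)) (D W x (V' x)) + (inner ℝ (D Z x (V' x)) (D W x (V x))
        + inner ℝ (Z x) (D (fun y => D W y (V y)) x (V' x))) := fun {V V'} hV hV' => by
    rw [dir_congr (h₁ hV), dir_add (SmoothOn.funDiffAt_inner hU (hc hV hZ) hW hx)
      (SmoothOn.funDiffAt_inner hU hZ (hc hV hW) hx),
      dir_inner hD.metric ((hc hV hZ).diffAt hU hx) (hW.diffAt hU hx),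
      dir_inner hD.metric (hZ.diffAt hU hx) ((hc hV hW).diffAt hU hx)]
  -- `dir_bracket` needs an auxiliary field that does not vanish at x.
  have h₀ : e 0 x ≠ 0 := fun h => by
    have := (he.orthonormal x hx).1 0
    simp [h] at this
  have h := dir_bracket hU hX hY (he.smooth 0) (SmoothOn.contMDiffOn_inner hZ hW) hx h₀
    (hd hX) (hd hY)
  rw [h₂ hY hX, h₂ hX hY, dir_inner hD.metric (hZ.diffAt hU hx) (hW.diffAt hU hx)] at h
  simp only [curv, inner_sub_left, inner_sub_right]
  linarith

/-- `ricci` uses arbitrary extensions and an arbitrary orthonormal basis. The first slot is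
tensorial, so the trace may use the frame; the second slot follows by antisymmetry and the third by
`inner_curv_swap`. -/
theorem ricci_frame (j k : Fin 8) : ricci D x (e j x) (e k x) =
    ∑ i, inner ℝ (curv D (e i) (e j) (e k) x) (e i x) := by
  obtain ⟨V₁, hV₁, hx₁, h₁⟩ := exists_smoothOn_extend x (e j x)
  obtain ⟨V₂, hV₂, hx₂, h₂⟩ := exists_smoothOn_extend x (e k x)
  set Y : VField M := FiberBundle.extend E8 (e j x) with hYdef
  set Z : VField M := FiberBundle.extend E8 (e k x) with hZdef
  have hYx : Y x = e j x := FiberBundle.extend_apply_self _ _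
  have hZx : Z x = e k x := FiberBundle.extend_apply_self _ _
  set V := U ∩ (V₁ ∩ V₂) with hV
  have hVo : IsOpen V := he.isOpen.inter (hV₁.inter hV₂)
  have hxV : x ∈ V := ⟨hx, hx₁, hx₂⟩
  have hf := he.mono hVo Set.inter_subset_left
  have hY : SmoothOn Y V := h₁.mono fun z hz => hz.2.1
  have hZ : SmoothOn Z V := h₂.mono fun z hz => hz.2.2
  have ht := tensorialAt_curv hD.smooth hVo (Y := Y) hZ hxV
  let L := TensorialAt.mkHom _ _ ht
  let B : TangentSpace (𝓡 8) x →ₗ[ℝ] TangentSpace (𝓡 8) x →ₗ[ℝ] ℝ :=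
    (innerₗ (TangentSpace (𝓡 8) x)).comp L.toLinearMap
  have hB := sum_bilin_orthonormalBasis (stdOrthonormalBasis ℝ (TangentSpace (𝓡 8) x))
    (he.basis hx) B
  refine Eq.trans ?_ (hB.trans ?_)
  · rfl
  · refine Finset.sum_congr rfl fun i _ => ?_
    rw [he.basis_apply hx]
    change inner ℝ (L (e i x)) (e i x) = _
    rw [show L (e i x) = curv D (e i) Y Z x from TensorialAt.mkHom_apply ht (he.diffAt hx i),
      inner_curv_swap hD hf hxV (hf.smooth i) hY hZ (hf.smooth i), hZx,
      curv_swap, (tensorialAt_curv hD.smooth hVo (Y := e i) (hf.smooth i) hxV).pointwise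
        (hY.diffAt hVo hxV) (he.diffAt hx j) hYx, ← curv_swap,
      inner_curv_swap hD hf hxV (hf.smooth i) (hf.smooth j) (hf.smooth k) (hf.smooth i)]

end Curvature

/-! ### δΦ and the Lee form in an adapted frame -/

/-- In a frame with bracket `Γ_ijk - Γ_jik - T_ijk` and parallel `Φ`, the components of `dΦ`. -/
theorem torsionDPhi_eq {Γ T : Fin 8 → Fin 8 → Fin 8 → ℝ}
    (hph : ∀ i a b c d, phAct (Γ i) a b c d = 0) (c : Fin 8 → Fin 8 → Fin 8 → ℝ)
    (hT : ∀ i j k, T i j k = Γ i j k - Γ j i k - c i j k) (i j k l m : Fin 8) :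
    torsionDPhi T i j k l m = -∑ r, (c i j r * ph r k l m - c i k r * ph r j l m
      + c i l r * ph r j k m - c i m r * ph r j k l + c j k r * ph r i l m - c j l r * ph r i k m
      + c j m r * ph r i k l + c k l r * ph r i j m - c k m r * ph r i j l
      + c l m r * ph r i j k) := by
  -- The alternation of ∇Φ = 0: adding it replaces T by minus the structure functions.
  have h : phAct (Γ i) j k l m - phAct (Γ j) i k l m + phAct (Γ k) i j l m
      - phAct (Γ l) i j k m + phAct (Γ m) i j k l = 0 := by simp [hph]
  have key : torsionDPhi T i j k l m = -∑ r, (c i j r * ph r k l m - c i k r * ph r j l m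
      + c i l r * ph r j k m - c i m r * ph r j k l + c j k r * ph r i l m - c j l r * ph r i k m
      + c j m r * ph r i k l + c k l r * ph r i j m - c k m r * ph r i j l
      + c l m r * ph r i j k) + (phAct (Γ i) j k l m - phAct (Γ j) i k l m + phAct (Γ k) i j l m
      - phAct (Γ l) i j k m + phAct (Γ m) i j k l) := by
    simp only [torsionDPhi, phAct]
    rw [← Finset.sum_neg_distrib, ← Finset.sum_sub_distrib, ← Finset.sum_add_distrib,
      ← Finset.sum_sub_distrib, ← Finset.sum_add_distrib, ← Finset.sum_add_distrib]
    refine Finset.sum_congr rfl fun r _ => ?_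
    have s₂ : ∀ a b c, ph a r b c = -ph r a b c := fun a b c => ph_swap₁₂ r a b c
    have s₃ : ∀ a b c, ph a b r c = ph r a b c := fun a b c => by
      rw [ph_swap₂₃ a r b c, s₂]; ring
    have s₄ : ∀ a b c, ph a b c r = -ph r a b c := fun a b c => by
      rw [ph_swap₃₄ a b r c, s₃]
    simp only [hT, s₂, s₃, s₄]
    ring
  rw [key, h, add_zero]

section Forms

open VectorField Topology

theorem form_ext {V : Type*} [NormedAddCommGroup V] [InnerProductSpace ℝ V] {k : ℕ}
    (b : OrthonormalBasis (Fin 8) ℝ V) {α β : V [⋀^Fin k]→L[ℝ] ℝ}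
    (h : ∀ s : Fin k → Fin 8, α (fun a => b (s a)) = β fun a => b (s a)) : α = β :=
  ContinuousAlternatingMap.toAlternatingMap_injective
    (b.toBasis.ext_alternating fun s _ => by simpa using h s)

theorem hodgeStar_apply {V : Type*} [NormedAddCommGroup V] [InnerProductSpace ℝ V] {k l : ℕ}
    (b : OrthonormalBasis (Fin 8) ℝ V) (h : 8 = l + k) (α : V [⋀^Fin k]→L[ℝ] ℝ) (v : Fin l → V) :
    hodgeStar b h α v = 1 / ((Nat.factorial k : ℕ) : ℝ) * ∑ s : Fin k → Fin 8,
      α (fun a => b (s a)) * insertFirst k (fun a => b (s a)) (volForm b h) v := by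
  simp only [hodgeStar, ContinuousAlternatingMap.smul_apply, ContinuousAlternatingMap.sum_apply,
    smul_eq_mul]

variable {M : Type*} [TopologicalSpace M] [T2Space M] [ChartedSpace E8 M]
  [IsManifold (𝓡 8) ∞ M] [RiemannianBundle (fun x : M => TangentSpace (𝓡 8) x)]

theorem Structure.star_phi (S : Structure M) (h : 8 = 4 + 4) : S.star h S.Φ = S.Φ := by
  funext x
  refine form_ext (S.basis x) fun s => ?_
  have e : (fun a => S.basis x (s a)) =
      ![S.basis x (s 0), S.basis x (s 1), S.basis x (s 2), S.basis x (s 3)] := by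
    funext a; fin_cases a <;> rfl
  rw [S.phi_basis, e, Structure.star, hodgeStar_apply]
  have h₂ : ∀ t : Fin 4 → Fin 8, S.Φ x (fun a => S.basis x (t a)) *
      insertFirst 4 (fun a => S.basis x (t a)) (volForm (S.basis x) h)
        ![S.basis x (s 0), S.basis x (s 1), S.basis x (s 2), S.basis x (s 3)] =
      ph (t 0) (t 1) (t 2) (t 3) *
        (eps (t 0) (t 1) (t 2) (t 3) (s 0) (s 1) (s 2) (s 3) : ℝ) := fun t => by
    rw [S.phi_basis, insertFirst_volForm_four]
  rw [Finset.sum_congr rfl fun t _ => h₂ t, sum_fin_four]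
  refine Eq.trans (congrArg _ (sum_ph_mul_eps_four _ _ _ _)) ?_
  rw [show ((Nat.factorial 4 : ℕ) : ℝ) = 24 by norm_num [Nat.factorial]]
  ring

variable [IsContMDiffRiemannianBundle (𝓡 8) ∞ E8 (fun x : M => TangentSpace (𝓡 8) x)]
  {S : Structure M} {D : Connection M} {T : Form M 3} {U : Set M} {e : Fin 8 → VField M}

theorem IsFrame.form_apply (he : IsFrame S U e) {y : M} (hy : y ∈ U) {k : ℕ} (α : Form M k)
    (v : Fin k → TangentSpace (𝓡 8) y) :
    α y v = ∑ s : Fin k → Fin 8, (∏ a, inner ℝ (e (s a) y) (v a)) * α y (fun a => e (s a) y) := by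
  have h := (α y).toMultilinearMap.map_sum (fun a i => inner ℝ (e i y) (v a) • e i y)
  have h₂ : ∀ s : Fin k → Fin 8, (α y).toMultilinearMap
      (fun a => inner ℝ (e (s a) y) (v a) • e (s a) y) =
        (∏ a, inner ℝ (e (s a) y) (v a)) * α y (fun a => e (s a) y) := fun s =>
    (α y).toMultilinearMap.map_smul_univ _ _
  simp only [h₂, he.sum_inner_smul hy] at h
  exact h

theorem IsFrame.formDiffAt (he : IsFrame S U e) {x : M} (hx : x ∈ U) {k : ℕ} {α : Form M k}
    (h : ∀ s : Fin k → Fin 8, FunDiffAt (fun y => α y fun a => e (s a) y) x) : FormDiffAt α x := by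
  intro V hV
  refine MDifferentiableAt.congr_of_eventuallyEq (FunDiffAt.sum fun s _ =>
    FunDiffAt.mul (FunDiffAt.prod fun a _ => (he.diffAt hx (s a)).funDiffAt_inner (hV a)) (h s))
    (eventually_of_frame he hx fun _ hy => he.form_apply hy α _)

theorem IsFrame.formDiffAt_phi (he : IsFrame S U e) {x : M} (hx : x ∈ U) : FormDiffAt S.Φ x :=
  he.formDiffAt hx fun s => MDifferentiableAt.congr_of_eventuallyEq
    (FunDiffAt.const (ph (s 0) (s 1) (s 2) (s 3)))
    (eventually_of_frame he hx fun _ hy => he.phi_apply hy s)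

theorem extD_apply_of_formDiffAt {n : ℕ} {α : Form M (n + 1)} {V : Fin (n + 2) → VField M} {x : M}
    (hα : FormDiffAt α x) (hV : ∀ i, DiffAt (V i) x) :
    extD α x (fun i => V i x) =
      (∑ i : Fin (n + 2), (-1) ^ i.val *
        dir (fun y => α y (fun a => V (i.succAbove a) y)) x (V i x)) -
        ∑ i : Fin (n + 1), ∑ j ≥ i, (-1) ^ (i + j : ℕ) *
            α x (Matrix.vecCons (mlieBracket (𝓡 8) (V i.castSucc) (V j.succ) x)
              (fun a => V (i.castSucc.succAbove (j.succAbove a)) x)) :=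
  extD_apply hα.differentiableAt_chartForm hV fun _ => hα _ fun _ => hV _

/-- The exterior derivative of a 1-form on two vector fields. -/
theorem extD_one_apply {α : Form M 1} {X Y : VField M} {x : M} (hα : FormDiffAt α x)
    (hX : DiffAt X x) (hY : DiffAt Y x) : extD α x ![X x, Y x] =
      dir (fun y => α y ![Y y]) x (X x) - dir (fun y => α y ![X y]) x (Y x)
        - α x ![mlieBracket (𝓡 8) X Y x] := by
  have h := extD_apply_of_formDiffAt hα (V := ![X, Y]) fun i => by fin_cases i <;> assumption
  have e : (fun i => (![X, Y] : Fin 2 → VField M) i x) = ![X x, Y x] := by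
    funext i; fin_cases i <;> rfl
  have e₀ : ∀ y, (fun a : Fin 1 => (![X, Y] : Fin 2 → VField M) ((0 : Fin 2).succAbove a) y) =
      ![Y y] := fun y => by funext a; fin_cases a; rfl
  have e₁ : ∀ y, (fun a : Fin 1 => (![X, Y] : Fin 2 → VField M) ((1 : Fin 2).succAbove a) y) =
      ![X y] := fun y => by funext a; fin_cases a; rfl
  rw [e, Fin.sum_univ_two] at h
  simp only [e₀, e₁] at h
  rw [h, Fin.sum_univ_succ, Fin.sum_univ_zero, add_zero,
    show Finset.Ici (0 : Fin (0 + 1)) = {0} from rfl, Finset.sum_singleton]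
  have e₂ : (Matrix.vecCons (mlieBracket (𝓡 8) ((![X, Y] : Fin 2 → VField M)
      (0 : Fin 1).castSucc) ((![X, Y] : Fin 2 → VField M) (0 : Fin 1).succ) x)
      fun a => (![X, Y] : Fin 2 → VField M)
        ((0 : Fin 1).castSucc.succAbove ((0 : Fin 1).succAbove a)) x) =
      ![mlieBracket (𝓡 8) X Y x] := by
    funext a; fin_cases a; rfl
  rw [e₂]
  simp
  ring

/-- Φ is constant on frame vectors, so only the bracket terms of the invariant formula survive. -/
theorem extD_phi_apply (he : IsFrame S U e) {x : M} (hx : x ∈ U) (s : Fin 5 → Fin 8) :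
    extD S.Φ x (fun a => e (s a) x) = -∑ r, (
      brack e (s 0) (s 1) r x * ph r (s 2) (s 3) (s 4)
      - brack e (s 0) (s 2) r x * ph r (s 1) (s 3) (s 4)
      + brack e (s 0) (s 3) r x * ph r (s 1) (s 2) (s 4)
      - brack e (s 0) (s 4) r x * ph r (s 1) (s 2) (s 3)
      + brack e (s 1) (s 2) r x * ph r (s 0) (s 3) (s 4)
      - brack e (s 1) (s 3) r x * ph r (s 0) (s 2) (s 4)
      + brack e (s 1) (s 4) r x * ph r (s 0) (s 2) (s 3)
      + brack e (s 2) (s 3) r x * ph r (s 0) (s 1) (s 4)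
      - brack e (s 2) (s 4) r x * ph r (s 0) (s 1) (s 3)
      + brack e (s 3) (s 4) r x * ph r (s 0) (s 1) (s 2)) := by
  have h := extD_apply_of_formDiffAt (he.formDiffAt_phi hx) (V := fun a => e (s a))
    fun a => he.diffAt hx (s a)
  have h₁ : ∀ (p : Fin 4 → Fin 8) v, dir (fun y => S.Φ y (fun a => e (p a) y)) x v = 0 :=
      fun p v => by
    rw [dir_congr (g := fun _ => ph (p 0) (p 1) (p 2) (p 3)), dir_const]
    exact eventually_of_frame he hx fun y hy => he.phi_apply hy p
  have h₂ : ∀ (i j : Fin 8) (q : Fin 3 → Fin 8), S.Φ x (Matrix.vecCons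
      (mlieBracket (𝓡 8) (e i) (e j) x) (fun a => e (q a) x)) =
        ∑ r, brack e i j r x * ph r (q 0) (q 1) (q 2) := fun i j q => by
    change ContinuousAlternatingMap.curryLeft (S.Φ x) _ _ = _
    conv_lhs => rw [← he.sum_inner_smul hx (mlieBracket (𝓡 8) (e i) (e j) x)]
    rw [map_sum, ContinuousAlternatingMap.sum_apply]
    refine Finset.sum_congr rfl fun r _ => ?_
    rw [map_smul, ContinuousAlternatingMap.smul_apply, real_inner_comm]
    refine congrArg (brack e i j r x * ·) ((congrArg (S.Φ x) ?_).trans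
      (he.phi_apply hx (Matrix.vecCons r q)))
    funext a
    refine Fin.cases rfl (fun a => rfl) a
  have i₀ : Finset.Ici (0 : Fin 4) = {0, 1, 2, 3} := by decide
  have i₁ : Finset.Ici (1 : Fin 4) = {1, 2, 3} := by decide
  have i₂ : Finset.Ici (2 : Fin 4) = {2, 3} := by decide
  have i₃ : Finset.Ici (3 : Fin 4) = {3} := by decide
  rw [h, Finset.sum_eq_zero fun i _ => by rw [h₁ fun a => s (i.succAbove a), mul_zero], zero_sub,
    neg_inj, Fin.sum_univ_four, i₀, i₁, i₂, i₃]
  simp only [h₂ _ _ fun a => s _]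
  simp [Finset.sum_add_distrib, Finset.sum_sub_distrib, Fin.succAbove]
  ring

/-- As *Φ = Φ, δΦ = -*dΦ; dividing `sum_torsionDPhi_mul_eps` by -5! = -120 gives the coefficients 1
and 1/6. -/
theorem codiff_apply (hD : S.IsTorsionConnection D T) (x : M) (j k l : Fin 8) :
    S.codiff x ![S.basis x j, S.basis x k, S.basis x l] =
      T x ![S.basis x j, S.basis x k, S.basis x l] + 1 / 6 * ∑ s, phTrace (fun a b c =>
        T x ![S.basis x a, S.basis x b, S.basis x c]) s * ph s j k l := by
  obtain ⟨U, e, he, hx, hb⟩ := exists_isFrame S x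
  have h : ∀ s : Fin 5 → Fin 8, extD S.Φ x (fun a => S.basis x (s a)) =
      torsionDPhi (fun i j k => comp₃ T e i j k x) (s 0) (s 1) (s 2) (s 3) (s 4) := fun s => by
    rw [torsionDPhi_eq (phAct_conn hD he hx) (fun i j k => brack e i j k x)
      (comp₃_torsion hD he hx), ← extD_phi_apply he hx]
    simp only [hb]
  have h₂ := sum_torsionDPhi_mul_eps (skew_comp₃ (T := T) (e := e) x) j k l
  have h₃ : ∀ i j k, T x ![S.basis x i, S.basis x j, S.basis x k] = comp₃ T e i j k x :=
    fun i j k => by simp only [comp₃, hb]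
  simp only [h₃]
  have h₄ : ∀ s : Fin 5 → Fin 8, extD S.Φ x (fun a => S.basis x (s a)) *
      insertFirst 5 (fun a => S.basis x (s a)) (volForm (S.basis x) (by norm_num : 8 = 3 + 5))
        ![S.basis x j, S.basis x k, S.basis x l] =
      torsionDPhi (fun i j k => comp₃ T e i j k x) (s 0) (s 1) (s 2) (s 3) (s 4) *
        (eps (s 0) (s 1) (s 2) (s 3) (s 4) j k l : ℝ) := fun s => by
    rw [h, insertFirst_volForm_five]
  have h₅ : S.codiff x ![S.basis x j, S.basis x k, S.basis x l] =
      -(1 / ((Nat.factorial 5 : ℕ) : ℝ) * ∑ s : Fin 5 → Fin 8,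
        extD S.Φ x (fun a => S.basis x (s a)) * insertFirst 5 (fun a => S.basis x (s a))
          (volForm (S.basis x) (by norm_num : 8 = 3 + 5))
            ![S.basis x j, S.basis x k, S.basis x l]) := by
    rw [Structure.codiff, S.star_phi]
    exact congrArg (- ·) (hodgeStar_apply _ _ _ _)
  rw [h₅, Finset.sum_congr rfl fun s _ => h₄ s, h₂,
    show ((Nat.factorial 5 : ℕ) : ℝ) = 120 by norm_num [Nat.factorial]]
  ring

theorem Structure.lee_apply (S : Structure M) (x : M) (v : Fin 1 → TangentSpace (𝓡 8) x) :
    S.lee x v = 1 / 42 * ∑ s : Fin 3 → Fin 8, S.codiff x (fun a => S.basis x (s a)) *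
      insertFirst 3 (fun a => S.basis x (s a)) (S.Φ x) v := by
  unfold Structure.lee
  generalize S.codiff = α
  simp only [ContinuousAlternatingMap.smul_apply, ContinuousAlternatingMap.sum_apply, smul_eq_mul]

theorem phi_apply_last {V : Type*} [NormedAddCommGroup V] [InnerProductSpace ℝ V]
    {b : OrthonormalBasis (Fin 8) ℝ V} {β : V [⋀^Fin 4]→L[ℝ] ℝ}
    (hβ : ∀ p : Fin 4 → Fin 8, β (fun a => b (p a)) = ph (p 0) (p 1) (p 2) (p 3)) (i j k : Fin 8)
    (v : V) : β ![b i, b j, b k, v] = ∑ a, inner ℝ (b a) v * ph i j k a := by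
  have e : ∀ w, β ![b i, b j, b k, w] = -β.curryLeft w ![b i, b j, b k] := fun w => by
    change _ = -β ![w, b i, b j, b k]
    have h := β.map_perm ![w, b i, b j, b k] (finRotate 4)
    rw [sign_finRotate] at h
    refine Eq.trans (congrArg β ?_) (h.trans ?_)
    · funext a; fin_cases a <;> rfl
    · norm_num
  conv_lhs => rw [← b.sum_repr' v, e, map_sum, ContinuousAlternatingMap.sum_apply]
  rw [← Finset.sum_neg_distrib]
  refine Finset.sum_congr rfl fun a _ => ?_
  rw [map_smul, ContinuousAlternatingMap.smul_apply, smul_eq_mul, ← mul_neg, ← e]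
  exact congrArg (inner ℝ (b a) v * ·) ((congrArg β
    (funext fun c => by fin_cases c <;> rfl)).trans (hβ ![i, j, k, a]))

theorem sum_mul_phi_apply {V : Type*} [NormedAddCommGroup V] [InnerProductSpace ℝ V]
    {b : OrthonormalBasis (Fin 8) ℝ V} {β : V [⋀^Fin 4]→L[ℝ] ℝ}
    (hβ : ∀ p : Fin 4 → Fin 8, β (fun a => b (p a)) = ph (p 0) (p 1) (p 2) (p 3))
    (F : Fin 8 → Fin 8 → Fin 8 → ℝ) (v : V) :
    ∑ i, ∑ j, ∑ k, F i j k * β ![b i, b j, b k, v] =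
      ∑ a, inner ℝ (b a) v * ∑ i, ∑ j, ∑ k, F i j k * ph i j k a := by
  simp only [phi_apply_last hβ, Finset.mul_sum]
  rw [sum_rot_four fun i j k a => F i j k * (inner ℝ (b a) v * ph i j k a)]
  exact Finset.sum_congr rfl fun a _ => Finset.sum_congr rfl fun i _ =>
    Finset.sum_congr rfl fun j _ => Finset.sum_congr rfl fun k _ => by ring

theorem sum_form_mul_insertFirst {V : Type*} [NormedAddCommGroup V] [InnerProductSpace ℝ V]
    (b : OrthonormalBasis (Fin 8) ℝ V) (α : V [⋀^Fin 3]→L[ℝ] ℝ) (β : V [⋀^Fin 4]→L[ℝ] ℝ) (v : V) :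
    ∑ s : Fin 3 → Fin 8, α (fun a => b (s a)) * insertFirst 3 (fun a => b (s a)) β ![v] =
      ∑ i, ∑ j, ∑ k, α ![b i, b j, b k] * β ![b i, b j, b k, v] := by
  rw [sum_fin_three]
  refine Finset.sum_congr rfl fun i _ => Finset.sum_congr rfl fun j _ =>
    Finset.sum_congr rfl fun k _ => ?_
  rw [insertFirst_three]
  refine congrArg₂ (· * ·) (congrArg α ?_) rfl
  funext a; fin_cases a <;> rfl

theorem lee_basis (hD : S.IsTorsionConnection D T) (x : M) (v : TangentSpace (𝓡 8) x) :
    S.lee x ![v] = -(1 / 7) * ∑ i, ∑ j, ∑ k, T x ![S.basis x i, S.basis x j, S.basis x k] *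
      S.Φ x ![S.basis x i, S.basis x j, S.basis x k, v] := by
  rw [S.lee_apply, sum_form_mul_insertFirst, sum_mul_phi_apply (S.phi_basis x),
    sum_mul_phi_apply (S.phi_basis x)]
  simp only [codiff_apply hD,
    sum_codiff_mul_ph (T := fun a b c => T x ![S.basis x a, S.basis x b, S.basis x c])]
  rw [Finset.mul_sum, Finset.mul_sum]
  refine Finset.sum_congr rfl fun a _ => ?_
  simp only [phTrace]
  ring

/-- The total contraction of a 3-form with a 4-form does not depend on the orthonormal basis. -/
theorem sum_form_mul_form {V : Type*} [NormedAddCommGroup V] [InnerProductSpace ℝ V]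
    (b c : OrthonormalBasis (Fin 8) ℝ V) (α : V [⋀^Fin 3]→L[ℝ] ℝ) (β : V [⋀^Fin 4]→L[ℝ] ℝ)
    (v : V) : ∑ i, ∑ j, ∑ k, α ![b i, b j, b k] * β ![b i, b j, b k, v] =
      ∑ i, ∑ j, ∑ k, α ![c i, c j, c k] * β ![c i, c j, c k, v] := by
  set G : V → V → V → ℝ := fun p q r => α ![p, q, r] * β ![p, q, r, v] with hG
  -- A 3-cycle is even, so the summand is cyclically invariant. It is then enough to change the
  -- basis in the last slot and rotate, three times.
  have cyc : ∀ p q r, G p q r = G q r p := fun p q r => by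
    have h₁ : α ![p, q, r] = α ![q, r, p] := by
      have h := α.map_perm ![p, q, r] (finRotate 3)
      rw [sign_finRotate] at h
      refine Eq.symm (Eq.trans (congrArg α ?_) (h.trans ?_))
      · funext a; fin_cases a <;> rfl
      · norm_num
    have h₂ : β ![p, q, r, v] = β ![q, r, p, v] := by
      have h₃ := β.map_swap ![p, q, r, v] (i := 0) (j := 1) (by decide)
      have h₄ := β.map_swap ![q, p, r, v] (i := 1) (j := 2) (by decide)
      have e₃ : (![p, q, r, v] ∘ Equiv.swap (0 : Fin 4) 1) = ![q, p, r, v] := by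
        funext a; fin_cases a <;> rfl
      have e₄ : (![q, p, r, v] ∘ Equiv.swap (1 : Fin 4) 2) = ![q, r, p, v] := by
        funext a; fin_cases a <;> rfl
      rw [e₃] at h₃
      rw [e₄, h₃, neg_neg] at h₄
      exact h₄.symm
    simp only [hG, h₁, h₂]
  have slot : ∀ p q, ∑ k, G p q (b k) = ∑ k, G p q (c k) := fun p q => by
    let f : V →ₗ[ℝ] ℝ :=
      { toFun := fun u => α.curryLeft u ![p, q]
        map_add' := fun u w => by rw [map_add, ContinuousAlternatingMap.add_apply]
        map_smul' := fun r w => by rw [map_smul, ContinuousAlternatingMap.smul_apply]; rfl }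
    let g : V →ₗ[ℝ] ℝ :=
      { toFun := fun u => β.curryLeft u ![p, q, v]
        map_add' := fun u w => by rw [map_add, ContinuousAlternatingMap.add_apply]
        map_smul' := fun r w => by rw [map_smul, ContinuousAlternatingMap.smul_apply]; rfl }
    have h := sum_bilin_orthonormalBasis b c (f.smulRight g)
    simp only [← cyc _ p q]
    exact h
  let P : (Fin 8 → V) → (Fin 8 → V) → (Fin 8 → V) → ℝ := fun f g h =>
    ∑ i, ∑ j, ∑ k, G (f i) (g j) (h k)
  have hP : ∀ f g, P f g b = P f g c := fun f g =>
    Finset.sum_congr rfl fun i _ => Finset.sum_congr rfl fun j _ => slot _ _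
  have rot : ∀ f g h, P f g h = P g h f := fun f g h => by
    simp only [P]
    rw [sum_rot fun i j k => G (g i) (h j) (f k)]
    exact Finset.sum_congr rfl fun i _ => Finset.sum_congr rfl fun j _ =>
      Finset.sum_congr rfl fun k _ => cyc _ _ _
  change P b b b = P c c c
  rw [hP, ← rot, hP, ← rot, hP]

/-- The Lee form is defined with bases chosen point by point; basis independence rewrites it in a
smooth frame, where it can be differentiated. -/
theorem lee_frame (hD : S.IsTorsionConnection D T) (he : IsFrame S U e) {y : M} (hy : y ∈ U)
    (a : Fin 8) : S.lee y ![e a y] = -(1 / 7) * phTrace (fun i j k => comp₃ T e i j k y) a := by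
  rw [lee_basis hD, sum_form_mul_form (S.basis y) (he.basis hy)]
  refine congrArg (-(1 / 7) * ·) (Finset.sum_congr rfl fun i _ => Finset.sum_congr rfl fun j _ =>
    Finset.sum_congr rfl fun k _ => ?_)
  simp only [he.basis_apply]
  refine congrArg (comp₃ T e i j k y * ·) ((congrArg (S.Φ y) ?_).trans
    (he.phi_apply hy ![i, j, k, a]))
  funext c; fin_cases c <;> rfl

theorem funDiffAt_phTrace (hD : S.IsTorsionConnection D T) (he : IsFrame S U e) {x : M}
    (hx : x ∈ U) (a : Fin 8) :
    FunDiffAt (fun y => phTrace (fun i j k => comp₃ T e i j k y) a) x :=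
  FunDiffAt.sum fun i _ => FunDiffAt.sum fun j _ => FunDiffAt.sum fun k _ =>
    (diffAt_comp₃ hD he hx i j k).mul (FunDiffAt.const _)

theorem formDiffAt_lee (hD : S.IsTorsionConnection D T) (he : IsFrame S U e) {x : M}
    (hx : x ∈ U) : FormDiffAt S.lee x := by
  refine he.formDiffAt hx fun s => MDifferentiableAt.congr_of_eventuallyEq
    ((FunDiffAt.const (-(1 / 7))).mul (funDiffAt_phTrace hD he hx (s 0)))
    (eventually_of_frame he hx fun y hy => ?_)
  refine (congrArg (S.lee y) ?_).trans (lee_frame hD he hy (s 0))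
  funext a
  fin_cases a
  rfl

theorem dir_lee_frame (hD : S.IsTorsionConnection D T) (he : IsFrame S U e) {x : M}
    (hx : x ∈ U) (p a : Fin 8) : dir (fun y => S.lee y ![e a y]) x (e p x) =
      -(1 / 7) * phTrace (fun i j k => dir (comp₃ T e i j k) x (e p x)) a := by
  rw [dir_congr (eventually_of_frame he hx fun y hy => lee_frame hD he hy a),
    dir_mul (FunDiffAt.const _) (funDiffAt_phTrace hD he hx a), dir_const]
  have h : dir (fun y => phTrace (fun i j k => comp₃ T e i j k y) a) x (e p x) =
      phTrace (fun i j k => dir (comp₃ T e i j k) x (e p x)) a := by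
    have hd := fun i j k => diffAt_comp₃ hD he hx i j k
    simp only [phTrace]
    rw [dir_sum fun i _ => FunDiffAt.sum fun j _ => FunDiffAt.sum fun k _ =>
      (hd i j k).mul (FunDiffAt.const _)]
    refine Finset.sum_congr rfl fun i _ => ?_
    rw [dir_sum fun j _ => FunDiffAt.sum fun k _ => (hd i j k).mul (FunDiffAt.const _)]
    refine Finset.sum_congr rfl fun j _ => ?_
    rw [dir_sum fun k _ => (hd i j k).mul (FunDiffAt.const _)]
    refine Finset.sum_congr rfl fun k _ => ?_
    rw [dir_mul (hd i j k) (FunDiffAt.const _), dir_const]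
    ring
  rw [h]
  ring

end Forms

/-! ### The covariant and exterior derivatives of the Lee form, and the equivalences -/

theorem sum_fin_one (f : (Fin 1 → Fin 8) → ℝ) : ∑ s, f s = ∑ i, f ![i] :=
  Fintype.sum_equiv (Equiv.funUnique (Fin 1) (Fin 8)) _ _ fun s =>
    congrArg f (funext fun a => by fin_cases a; rfl)

theorem sum_mul_sum_mul_ph (f : Fin 8 → ℝ) (k l : Fin 8) :
    ∑ s, f s * ∑ r, f r * ph r s k l = 0 := by
  have h : ∑ s, f s * ∑ r, f r * ph r s k l = -∑ s, f s * ∑ r, f r * ph r s k l := by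
    conv_lhs => simp only [Finset.mul_sum]; rw [Finset.sum_comm]
    simp only [Finset.mul_sum]
    rw [← Finset.sum_neg_distrib]
    refine Finset.sum_congr rfl fun s _ => ?_
    rw [← Finset.sum_neg_distrib]
    refine Finset.sum_congr rfl fun r _ => ?_
    rw [ph_swap₁₂ r s k l]
    ring
  linarith

section Lee

open VectorField Topology

variable {M : Type*} [TopologicalSpace M] [T2Space M] [ChartedSpace E8 M]
  [IsManifold (𝓡 8) ∞ M] [RiemannianBundle (fun x : M => TangentSpace (𝓡 8) x)]

theorem Structure.contract_apply (S : Structure M) {k : ℕ} (θ : Form M 1) (α : Form M (k + 1))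
    (x : M) (v : Fin k → TangentSpace (𝓡 8) x) :
    S.contract θ α x v =
      ∑ s, θ x ![S.basis x s] * α x (Matrix.vecCons (S.basis x s) v) := by
  simp only [Structure.contract, ContinuousAlternatingMap.sum_apply,
    ContinuousAlternatingMap.smul_apply, ContinuousAlternatingMap.curryLeft_apply_apply,
    smul_eq_mul]

variable [IsContMDiffRiemannianBundle (𝓡 8) ∞ E8 (fun x : M => TangentSpace (𝓡 8) x)]
  {S : Structure M} {D : Connection M} {T : Form M 3} {U : Set M} {e : Fin 8 → VField M}

theorem IsFrame.form_one_apply (he : IsFrame S U e) {y : M} (hy : y ∈ U) (α : Form M 1)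
    (v : TangentSpace (𝓡 8) y) : α y ![v] = ∑ j, inner ℝ (e j y) v * α y ![e j y] := by
  rw [he.form_apply hy, sum_fin_one]
  refine Finset.sum_congr rfl fun j _ => ?_
  refine congrArg₂ (· * ·) (by simp) (congrArg (α y) ?_)
  funext a
  fin_cases a
  rfl

variable (S D e) in
/-- The components of `∇θ` in a frame, for the Lee form `θ`. -/
def leeNabla (i j : Fin 8) (x : M) : ℝ :=
  dir (fun y => S.lee y ![e j y]) x (e i x) - ∑ s, conn D e i j s x * S.lee x ![e s x]

variable (D T e) in
/-- The components of `∇T` in a frame. -/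
def torsionNabla (x : M) : Fin 8 → Fin 8 → Fin 8 → Fin 8 → ℝ :=
  frameNabla (fun i j k => conn D e i j k x) (fun i j k => comp₃ T e i j k x)
    (fun p i j k => dir (comp₃ T e i j k) x (e p x))

variable (hD : S.IsTorsionConnection D T) (he : IsFrame S U e) {x : M} (hx : x ∈ U)

include hD he hx

/-- θ = -t/7, and contraction with the parallel form Φ commutes with ∇. -/
theorem leeNabla_eq (i j : Fin 8) :
    leeNabla S D e i j x = -(1 / 7) * phTrace (torsionNabla D T e x i) j := by
  rw [leeNabla, torsionNabla, phTrace_frameNabla (fun i j k => conn_skew hD he hx i j k)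
    (phAct_conn hD he hx), dir_lee_frame hD he hx]
  simp only [lee_frame hD he hx]
  rw [mul_sub, Finset.mul_sum]
  refine congrArg _ (Finset.sum_congr rfl fun s _ => by ring)

/-- Tensoriality of ∇θ, which turns a condition on all vector fields into one on frame components.
-/
theorem nablaForm_lee {Y : VField M} (hY : DiffAt Y x) (v : TangentSpace (𝓡 8) x) :
    nablaForm D S.lee x v ![Y] =
      ∑ i, ∑ k, inner ℝ (e i x) v * inner ℝ (e k x) (Y x) * leeNabla S D e i k x := by
  have hd : ∀ j, FunDiffAt (fun y => S.lee y ![e j y]) x := fun j =>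
    MDifferentiableAt.congr_of_eventuallyEq
      ((FunDiffAt.const (-(1 / 7))).mul (funDiffAt_phTrace hD he hx j))
      (eventually_of_frame he hx fun y hy => lee_frame hD he hy j)
  have h₀ : nablaForm D S.lee x v ![Y] =
      dir (fun y => S.lee y ![Y y]) x v - S.lee x ![D Y x v] := by
    unfold nablaForm dir
    rw [Fin.sum_univ_one]
    refine congrArg₂ (· - ·) (congrArg (fun f => mvfderiv (𝓡 8) f x v) (funext fun y =>
      congrArg (S.lee y) ?_)) (congrArg (S.lee x) ?_)
    · funext a; fin_cases a; rfl
    · funext a; fin_cases a; rfl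
  have h₁ : dir (fun y => S.lee y ![Y y]) x v = ∑ j,
      (inner ℝ (e j x) (Y x) * dir (fun y => S.lee y ![e j y]) x v + S.lee x ![e j x] *
        (inner ℝ (D (e j) x v) (Y x) + inner ℝ (e j x) (D Y x v))) := by
    rw [dir_congr (eventually_of_frame he hx fun y hy => he.form_one_apply hy S.lee (Y y)),
      dir_sum fun j _ => ((he.diffAt hx j).funDiffAt_inner hY).mul (hd j)]
    refine Finset.sum_congr rfl fun j _ => ?_
    rw [dir_mul ((he.diffAt hx j).funDiffAt_inner hY) (hd j),
      dir_inner hD.metric (he.diffAt hx j) hY]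
  have h₂ : ∀ f : M → ℝ, dir f x v = ∑ i, inner ℝ (e i x) v * dir f x (e i x) := fun f => by
    conv_lhs => rw [← he.sum_inner_smul hx v, dir_sum_smul]
  have h₃ : ∀ j, inner ℝ (D (e j) x v) (Y x) =
      ∑ i, ∑ k, inner ℝ (e i x) v * inner ℝ (e k x) (Y x) * conn D e i j k x := fun j => by
    conv_lhs => rw [← he.sum_inner_smul hx v, map_sum, sum_inner]
    refine Finset.sum_congr rfl fun i _ => ?_
    rw [map_smul, real_inner_smul_left, sum_inner_mul he hx (D (e j) x (e i x)), Finset.mul_sum]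
    refine Finset.sum_congr rfl fun k _ => ?_
    rw [real_inner_comm (e k x) (Y x), conn]
    ring
  rw [h₀, h₁, he.form_one_apply hx S.lee (D Y x v), ← Finset.sum_sub_distrib]
  simp only [h₂ (fun y => S.lee y ![e _ y]), h₃, leeNabla, mul_sub, Finset.sum_sub_distrib,
    Finset.mul_sum, mul_add, Finset.sum_add_distrib]
  have c₁ : ∑ k, ∑ i, inner ℝ (e k x) (Y x) *
        (inner ℝ (e i x) v * dir (fun y => S.lee y ![e k y]) x (e i x)) =
      ∑ i, ∑ k, inner ℝ (e i x) v * inner ℝ (e k x) (Y x) *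
        dir (fun y => S.lee y ![e k y]) x (e i x) := by
    rw [Finset.sum_comm]
    exact Finset.sum_congr rfl fun i _ => Finset.sum_congr rfl fun k _ => by ring
  have c₂ : ∑ j, ∑ i, ∑ k, S.lee x ![e j x] *
        (inner ℝ (e i x) v * inner ℝ (e k x) (Y x) * conn D e i j k x) =
      -∑ i, ∑ k, ∑ s, inner ℝ (e i x) v * inner ℝ (e k x) (Y x) *
        (conn D e i k s x * S.lee x ![e s x]) := by
    rw [← sum_rot, ← Finset.sum_neg_distrib]
    refine Finset.sum_congr rfl fun i _ => ?_
    rw [← Finset.sum_neg_distrib]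
    refine Finset.sum_congr rfl fun k _ => ?_
    rw [← Finset.sum_neg_distrib]
    refine Finset.sum_congr rfl fun s _ => ?_
    rw [conn_skew hD he hx i k s]
    ring
  rw [c₁, c₂]
  have c₃ : ∀ j, S.lee x ![e j x] * inner ℝ (e j x) (D Y x v) =
      inner ℝ (e j x) (D Y x v) * S.lee x ![e j x] := fun j => mul_comm _ _
  simp only [c₃]
  ring

/-- In dθ(e_i, e_j) the bracket is replaced by ∇_i e_j - ∇_j e_i - T(e_i, e_j); the torsion leaves
the term θ ⌟ T. -/
theorem extD_lee (i j : Fin 8) : extD S.lee x ![e i x, e j x] =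
    leeNabla S D e i j x - leeNabla S D e j i x
      + ∑ s, S.lee x ![e s x] * comp₃ T e s i j x := by
  rw [extD_one_apply (formDiffAt_lee hD he hx) (he.diffAt hx i) (he.diffAt hx j),
    he.form_one_apply hx S.lee (mlieBracket (𝓡 8) (e i) (e j) x)]
  have h : ∑ s, inner ℝ (e s x) (mlieBracket (𝓡 8) (e i) (e j) x) * S.lee x ![e s x] =
      ∑ s, conn D e i j s x * S.lee x ![e s x] - ∑ s, conn D e j i s x * S.lee x ![e s x]
        - ∑ s, S.lee x ![e s x] * comp₃ T e s i j x := by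
    rw [← Finset.sum_sub_distrib, ← Finset.sum_sub_distrib]
    refine Finset.sum_congr rfl fun s _ => ?_
    have h₁ := comp₃_torsion hD he hx i j s
    have h₂ : comp₃ T e i j s x = comp₃ T e s i j x := ((skew_comp₃ x).rot s i j).symm
    rw [real_inner_comm, show inner ℝ (mlieBracket (𝓡 8) (e i) (e j) x) (e s x) =
      brack e i j s x from rfl, ← h₂, h₁]
    ring
  rw [h, leeNabla, leeNabla]
  ring

theorem sum_extD_lee (hRic : ∀ v w : TangentSpace (𝓡 8) x, ricci D x v w = ricci D x w v)
    (j k : Fin 8) : ∑ a, ∑ b, extD S.lee x ![e a x, e b x] * ph a b j k =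
      2 * ∑ s, S.lee x ![e s x] * comp₃ T e s j k x := by
  have hs := skew_comp₃ (T := T) (e := e) x
  have hR : IsCurvature (frameCurv (fun i j k => conn D e i j k x)
      (fun i j k => brack e i j k x) fun p i j k => dir (conn D e i j k) x (e p x)) :=
    isCurvature_frameCurv (fun i j k => conn_skew hD he hx i j k)
      (fun p i j k => dir_conn_skew hD he hx (e p x) i j k) (fun i j k => brack_swap i j k x)
      (phAct_conn hD he hx) fun p => phAct_dir_conn hD he hx (e p x)
  have hN : ∀ i, Skew (torsionNabla D T e x i) := fun i =>
    skew_frameNabla hs (fun p => skew_dir_comp₃ (e p x)) i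
  have hB : Bianchi (frameCurv (fun i j k => conn D e i j k x)
      (fun i j k => brack e i j k x) fun p i j k => dir (conn D e i j k) x (e p x))
      (torsionNabla D T e x) fun i j k => comp₃ T e i j k x :=
    bianchi_frameCurv hs (fun i j k => conn_skew hD he hx i j k)
      (fun i j k => comp₃_torsion hD he hx i j k)
      (fun p i j k => dir_comp₃ hD he hx (e p x) i j k) fun i j k l => jacobi hD he hx i j k l
  have h := sum_extD_lee_mul_ph hR hs hN hB (fun j k => by
    have h := hRic (e j x) (e k x)
    rw [ricci_frame hD he hx, ricci_frame hD he hx] at h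
    simpa only [inner_curv hD he hx] using h) j k
  simp only [extD_lee hD he hx, leeNabla_eq hD he hx, lee_frame hD he hx]
  have h₁ : ∀ a b, (-(1 / 7) * phTrace (torsionNabla D T e x a) b
      - -(1 / 7) * phTrace (torsionNabla D T e x b) a
      + ∑ s, -(1 / 7) * phTrace (fun i j k => comp₃ T e i j k x) s * comp₃ T e s a b x) *
        ph a b j k = -(1 / 7) * ((phTrace (torsionNabla D T e x a) b
      - phTrace (torsionNabla D T e x b) a
      + ∑ s, phTrace (fun i j k => comp₃ T e i j k x) s * comp₃ T e s a b x) * ph a b j k) :=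
    fun a b => by
      simp only [mul_assoc (-(1 / 7) : ℝ), ← Finset.mul_sum]
      ring
  simp only [h₁, ← Finset.mul_sum]
  rw [h]
  simp only [mul_assoc (-(1 / 7) : ℝ), ← Finset.mul_sum]
  ring

omit hD hx in
theorem mem_lambda21_iff (hb : ∀ i, e i x = S.basis x i)
    (φ : TangentSpace (𝓡 8) x [⋀^Fin 2]→L[ℝ] ℝ) :
    φ ∈ S.lambda21 x ↔ ∀ k l, ∑ i, ∑ j, φ ![e i x, e j x] * ph i j k l =
      2 * φ ![e k x, e l x] := by
  have h : ∀ i j k l, S.Φ x ![S.basis x i, S.basis x j, S.basis x k, S.basis x l] =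
      ph i j k l := fun i j k l => by
    refine (congrArg (S.Φ x) ?_).trans (S.phi_basis x ![i, j, k, l])
    funext a; fin_cases a <;> rfl
  simp only [hb, ← h]
  exact Iff.rfl

theorem contract_lee_apply (hb : ∀ i, e i x = S.basis x i) (i j : Fin 8) :
    S.contract S.lee T x ![e i x, e j x] = ∑ s, S.lee x ![e s x] * comp₃ T e s i j x := by
  rw [S.contract_apply]
  simp only [← hb]
  rfl

theorem leeNabla_symm_iff_nablaForm : (∀ X Y : VField M, DiffAt X x → DiffAt Y x →
    nablaForm D S.lee x (X x) ![Y] = nablaForm D S.lee x (Y x) ![X]) ↔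
      ∀ i j, leeNabla S D e i j x = leeNabla S D e j i x := by
  constructor
  · intro h i j
    have h₁ := h (e i) (e j) (he.diffAt hx i) (he.diffAt hx j)
    rw [nablaForm_lee hD he hx (he.diffAt hx j), nablaForm_lee hD he hx (he.diffAt hx i)] at h₁
    simpa [orthonormal_iff_ite.1 (he.orthonormal x hx)] using h₁
  · intro h X Y hX hY
    rw [nablaForm_lee hD he hx hY, nablaForm_lee hD he hx hX, Finset.sum_comm]
    refine Finset.sum_congr rfl fun i _ => Finset.sum_congr rfl fun k _ => ?_
    rw [h k i]
    ring

/-- By `sum_extD_lee`, membership reads 2β = 2(A + β) with A the skew part of ∇θ and β = θ ⌟ T. -/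
theorem leeNabla_symm_iff_extD (hb : ∀ i, e i x = S.basis x i)
    (hRic : ∀ v w : TangentSpace (𝓡 8) x, ricci D x v w = ricci D x w v) :
    extD S.lee x ∈ S.lambda21 x ↔ ∀ i j, leeNabla S D e i j x = leeNabla S D e j i x := by
  rw [mem_lambda21_iff he hb]
  simp only [sum_extD_lee hD he hx hRic]
  simp only [extD_lee hD he hx]
  refine forall_congr' fun i => forall_congr' fun j => ⟨fun h => ?_, fun h => ?_⟩
  · linarith
  · rw [h]; ring

/-- With c(A + β) = 2β, membership of β is equivalent to c(A) = 0, hence to A = 0 by injectivity of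
c. -/
theorem leeNabla_symm_iff_contract (hb : ∀ i, e i x = S.basis x i)
    (hRic : ∀ v w : TangentSpace (𝓡 8) x, ricci D x v w = ricci D x w v) :
    S.contract S.lee T x ∈ S.lambda21 x ↔
      ∀ i j, leeNabla S D e i j x = leeNabla S D e j i x := by
  rw [mem_lambda21_iff he hb]
  simp only [contract_lee_apply hD he hx hb, ← sum_extD_lee hD he hx hRic, extD_lee hD he hx]
  have h : ∀ k l, ∑ i, ∑ j, (leeNabla S D e i j x - leeNabla S D e j i x
      + ∑ s, S.lee x ![e s x] * comp₃ T e s i j x) * ph i j k l =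
        ∑ i, ∑ j, (leeNabla S D e i j x - leeNabla S D e j i x) * ph i j k l
          + ∑ i, ∑ j, (∑ s, S.lee x ![e s x] * comp₃ T e s i j x) * ph i j k l := fun k l => by
    simp only [add_mul, Finset.sum_add_distrib]
  simp only [h]
  refine ⟨fun h₁ i j => ?_, fun h₁ k l => ?_⟩
  · exact sub_eq_zero.1 (eq_zero_of_sum_mul_ph
      (A := fun i j => leeNabla S D e i j x - leeNabla S D e j i x) (fun i j => by ring)
      (fun k l => by linarith [h₁ k l]) i j)
  · simp [h₁]

omit he hx in
theorem contract_lee_codiff : S.contract S.lee S.codiff = S.contract S.lee T := by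
  funext x
  refine form_ext (S.basis x) fun p => ?_
  rw [S.contract_apply, S.contract_apply]
  obtain ⟨U, e, he, hx, hb⟩ := exists_isFrame S x
  have h₁ : ∀ s, (Matrix.vecCons (S.basis x s) fun a => S.basis x (p a)) =
      ![S.basis x s, S.basis x (p 0), S.basis x (p 1)] := fun s => by
    funext a; fin_cases a <;> rfl
  have h₂ : ∀ s, S.lee x ![S.basis x s] =
      -(1 / 7) * phTrace (fun a b c => T x ![S.basis x a, S.basis x b, S.basis x c]) s :=
    fun s => by
      have h := lee_frame hD he hx s
      simpa only [comp₃, hb] using h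
  simp only [h₁, codiff_apply hD, mul_add, Finset.sum_add_distrib]
  -- The constant is -(1/7) · (1/6), from θ = -t/7 and the correction (1/6) t ⌟ Φ; the double
  -- contraction of Φ with t vanishes.
  rw [add_eq_left, ← mul_zero (-(1 / 42) : ℝ), ← sum_mul_sum_mul_ph (phTrace fun a b c =>
    T x ![S.basis x a, S.basis x b, S.basis x c]) (p 0) (p 1), Finset.mul_sum]
  refine Finset.sum_congr rfl fun s _ => ?_
  rw [h₂]
  ring

end Lee

end Spin7

end

theorem mainTheorem10 {M : Type*} [TopologicalSpace M] [T2Space M] [SecondCountableTopology M]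
    [ChartedSpace Spin7.E8 M] [IsManifold (𝓡 8) ∞ M]
    [RiemannianBundle (fun x : M => TangentSpace (𝓡 8) x)]
    [IsContMDiffRiemannianBundle (𝓡 8) ∞ Spin7.E8 (fun x : M => TangentSpace (𝓡 8) x)]
    (S : Spin7.Structure M) (D : Spin7.Connection M) (T : Spin7.Form M 3)
    (hD : S.IsTorsionConnection D T)
    (hRic : ∀ (x : M) (v w : TangentSpace (𝓡 8) x),
      Spin7.ricci D x v w = Spin7.ricci D x w v) :
    S.contract S.lee S.codiff = S.contract S.lee T ∧
    List.TFAE [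
      ∀ (x : M) (X Y : Spin7.VField M), Spin7.DiffAt X x → Spin7.DiffAt Y x →
        Spin7.nablaForm D S.lee x (X x) ![Y] = Spin7.nablaForm D S.lee x (Y x) ![X],
      ∀ x : M, S.contract S.lee T x ∈ S.lambda21 x,
      ∀ x : M, Spin7.extD S.lee x ∈ S.lambda21 x] := by
  refine ⟨Spin7.contract_lee_codiff hD, ?_⟩
  tfae_have 1 ↔ 2 := forall_congr' fun x => by
    obtain ⟨U, e, he, hx, hb⟩ := Spin7.exists_isFrame S x
    exact (Spin7.leeNabla_symm_iff_nablaForm hD he hx).trans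
      (Spin7.leeNabla_symm_iff_contract hD he hx hb (hRic x)).symm
  tfae_have 2 ↔ 3 := forall_congr' fun x => by
    obtain ⟨U, e, he, hx, hb⟩ := Spin7.exists_isFrame S x
    exact (Spin7.leeNabla_symm_iff_contract hD he hx hb (hRic x)).trans
      (Spin7.leeNabla_symm_iff_extD hD he hx hb (hRic x)).symm
  tfae_finish
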